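/- A *generalised safety/reachability game* for Player $i$ consists of a finite non-empty set $P$ of players with $i\in P$, a finite directed graph $(V,E)$ in which every vertex has a successor, a partition $V=\biguplus_{j\in P}V_j$ (Player $j$ moves at the vertices of $V_j$; blocks may be empty), an initial vertex $v_0\in V$, and a set $L\subseteq V$ of leaves, where the only outgoing edge of a leaf is its self-loop and each leaf $\ell\in L$ has a payoff $n_\ell\in\mathbb Z$. The payoff $p_i(\rho)$ of an infinite path $\rho$ to Player $i$ is $n_\ell$ if $\rho\in V^*\ell^\omega$ for some $\ell\in L$, and $0$ otherwise. A strategy of Player $j$ maps each history (non-empty finite path) ending in $V_j$ to a successor of its last vertex. For strategies $\sigma,\sigma'$ of Player $i$, write $\sigma\preceq\sigma'$ if for every profile $\tau$ of strategies of the other players the plays from $v_0$ satisfy $p_i(\sigma,\tau)\le p_i(\sigma',\tau)$. A *parameterized automaton* for Player $i$ over $(V,E)$ consists of a finite non-empty set $M$ of memory states, a set $M_C\subseteq M$ of counter-access states, an initial state $m_0\in M$, and functions $\mu:M\times V\times\mathbb N\to M\times\mathbb N$ and $\nu:M\times V_i\times\mathbb N\to V$ with $(v,\nu(m,v,n))\in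 E$ for all $m\in M$, $v\in V_i$, $n\in\mathbb N$, such that * if $m\notin M_C$: for each $v\in V$ there is $m'$ with $\mu(m,v,n)=(m',n)$ for all $n$, and for each $v\in V_i$ the value $\nu(m,v,n)$ does not depend on $n$; * if $m\in M_C$: for each $v\in V$ there are $m',m''$ with $\mu(m,v,n)=(m',n-1)$ for all $n>0$ and $\mu(m,v,0)=(m'',0)$, and for each $v\in V_i$ the value $\nu(m,v,n)$ is the same for all $n>0$. For $n\in\mathbb N$ it realizes the following strategy $\sigma_n$ of Player $i$: on a history $u_0\dots u_k$ with $u_k\in V_i$, start in $(m_0,n)$, update memory state and counter with $\mu$ on $u_0,\dots,u_{k-1}$ successively to reach $(m,c)$, and play $\nu(m,u_k,c)$. The automaton *realizes a chain of strategies* if $\sigma_k\preceq\sigma_l$ for all $k<l$ in $\mathbb N$ (a weakly increasing chain). **Theorem.** There is a deterministic Turing machine which, given a generalised safety/reachability game and a parameterized automaton over its graph (listed explicitly, with the payoffs $n_\ell$ written in binary), decides in time polynomial in the length of the input whether the automaton realizes a chain of strategies. -/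

import Mathlib

namespace SafetyReach

/-- A generalised safety/reachability game for the player `protagonist`, with vertex set `V`, player
set `P` and initial vertex `init`. The vertices are partitioned among the players by `owner`.
Every vertex has a successor, so that strategies and infinite plays are defined.
Only the payoffs of `protagonist` are recorded; the definition leaves those of the other players
arbitrary, and dominance between strategies of `protagonist` does not depend on them. -/
structure Game (V P : Type) where
  owner : V → P
  edge : V → V → Prop
  exists_succ : ∀ v, ∃ w, edge v w
  protagonist : P
  leaves : Set V
  leaf_edge : ∀ l ∈ leaves, ∀ v, edge l v ↔ v = l
  leafPayoff : leaves → ℤ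
  init : V

variable {V P M : Type}

namespace Game

/-- `G.Hist v` is the type of histories (non-empty finite paths) of `G` whose last vertex is `v`. -/
inductive Hist (G : Game V P) : V → Type
  | single (v : V) : Hist G v
  | snoc {u v : V} (h : Hist G u) (e : G.edge u v) : Hist G v

/-- A strategy of player `j`: to each history whose last vertex belongs to `j` it associates a
successor of that vertex. -/
def Strategy (G : Game V P) (j : P) : Type :=
  ∀ v : V, G.Hist v → G.owner v = j → {w : V // G.edge v w}

/-- Profiles of strategies of all players other than the protagonist. -/
def CoStrategy (G : Game V P) : Type :=
  ∀ j : P, j ≠ G.protagonist → G.Strategy j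

open Classical in
/-- The complete profile consisting of `s` for the protagonist and `t` for the others. -/
noncomputable def profile (G : Game V P) (s : G.Strategy G.protagonist) (t : G.CoStrategy) :
    ∀ j : P, G.Strategy j :=
  fun j => if h : j = G.protagonist then h ▸ s else t j h

/-- The history of length `k + 1` produced by a complete profile from the initial vertex, together
with its last vertex. -/
def play (G : Game V P) (f : ∀ j : P, G.Strategy j) : ℕ → (v : V) × G.Hist v
  | 0 => ⟨G.init, Hist.single G.init⟩
  | k + 1 =>
    let c := play G f k
    let w := f (G.owner c.1) c.1 c.2 rfl
    ⟨w.1, Hist.snoc c.2 w.2⟩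

/-- The outcome of a complete profile from the initial vertex. -/
def outcome (G : Game V P) (f : ∀ j : P, G.Strategy j) : ℕ → V :=
  fun k => (G.play f k).1

/-- The infinite sequence `r` ends in `l, l, l, …`. -/
def EndsIn (r : ℕ → V) (l : V) : Prop :=
  ∃ N, ∀ k, N ≤ k → r k = l

open Classical in
/-- The payoff of the protagonist: the payoff of the leaf in which the outcome ends, if there is
one (it is then unique), and `0` otherwise. -/
noncomputable def payoff (G : Game V P) (r : ℕ → V) : ℤ :=
  if h : ∃ l : G.leaves, EndsIn r l.1 then G.leafPayoff h.choose else 0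

/-- `s` is weakly dominated by `s'` (from the initial vertex). -/
def WeaklyDominated (G : Game V P) (s s' : G.Strategy G.protagonist) : Prop :=
  ∀ t : G.CoStrategy,
    G.payoff (G.outcome (G.profile s t)) ≤ G.payoff (G.outcome (G.profile s' t))

/-- A sequence of strategies is a (weakly increasing) chain. -/
def IsChain (G : Game V P) (s : ℕ → G.Strategy G.protagonist) : Prop :=
  ∀ k l : ℕ, k < l → G.WeaklyDominated (s k) (s l)

end Game

/-- A parameterized automaton for the protagonist over the graph of `G`, with memory states `M`:
a Mealy automaton with access to a counter. Only the counter-access states test the counter;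
they decrement it when it is positive. -/
structure ParamAutomaton (G : Game V P) (M : Type) where
  counterAccess : Set M
  start : M
  update : M → V → ℕ → M × ℕ
  move : M → {v : V // G.owner v = G.protagonist} → ℕ → V
  move_edge : ∀ m v n, G.edge v.1 (move m v n)
  update_free : ∀ m, m ∉ counterAccess → ∀ v, ∃ m', ∀ n, update m v n = (m', n)
  update_pos : ∀ m, m ∈ counterAccess → ∀ v, ∃ m', ∀ n, 0 < n → update m v n = (m', n - 1)
  update_zero : ∀ m, m ∈ counterAccess → ∀ v, ∃ m', update m v 0 = (m', 0)
  move_free : ∀ m, m ∉ counterAccess → ∀ v, ∃ v', ∀ n, move m v n = v'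
  move_pos : ∀ m, m ∈ counterAccess → ∀ v, ∃ v', ∀ n, 0 < n → move m v n = v'

namespace ParamAutomaton

variable {G : Game V P}

/-- Memory state and counter value with which the automaton, started with counter value `n`,
arrives at the last vertex of a history (that vertex has not been read yet). -/
def config (A : ParamAutomaton G M) (n : ℕ) : {v : V} → G.Hist v → M × ℕ
  | _, .single _ => (A.start, n)
  | _, .snoc (u := u) h _ => A.update (A.config n h).1 u (A.config n h).2

/-- The strategy realized when the counter is initialized with `n`. -/
def strategy (A : ParamAutomaton G M) (n : ℕ) : G.Strategy G.protagonist :=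
  fun v h hv =>
    ⟨A.move (A.config n h).1 ⟨v, hv⟩ (A.config n h).2, A.move_edge _ ⟨v, hv⟩ _⟩

/-- The automaton realizes a chain of strategies. -/
def RealizesChain (A : ParamAutomaton G M) : Prop :=
  G.IsChain A.strategy

end ParamAutomaton

/-- An input of the decision problem: a game on finitely many vertices and players and a
parameterized automaton over its graph, with finitely many memory states. -/
structure Input where
  numVertices : ℕ
  numPlayers : ℕ
  numStates : ℕ
  game : Game (Fin numVertices) (Fin numPlayers)
  automaton : ParamAutomaton game (Fin numStates)

/-- An integer as a sign bit followed by the binary expansion of its absolute value. -/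
def intWord (z : ℤ) : List Bool :=
  decide (z < 0) :: Computability.encodeNat z.natAbs

/-- An index (of a vertex, player or state) or a size, in unary. The listing of the game and the
automaton is at least as long as these numbers anyway. -/
def natWord (k : ℕ) : List Bool :=
  Computability.unaryEncodeNat k

namespace Input

open Classical in
/-- The input as a list of words: sizes, distinguished elements, owners, leaves and their payoffs,
adjacency matrix, counter-access states, and for every memory state and every vertex the memory
updates and the moves at counter value zero and at positive counter values. -/
noncomputable def words (x : Input) : List (List Bool) :=
  let G := x.game
  let A := x.automaton
  let vs := List.finRange x.numVertices
  let ms := List.finRange x.numStates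
  [natWord x.numVertices, natWord x.numPlayers, natWord x.numStates,
    natWord G.protagonist, natWord G.init, natWord A.start] ++
  (vs.map fun v => natWord (G.owner v)) ++
  (vs.map fun v => [decide (v ∈ G.leaves)]) ++
  (vs.map fun v => if h : v ∈ G.leaves then intWord (G.leafPayoff ⟨v, h⟩) else []) ++
  (vs.flatMap fun v => vs.map fun w => [decide (G.edge v w)]) ++
  (ms.map fun m => [decide (m ∈ A.counterAccess)]) ++
  (ms.flatMap fun m => vs.flatMap fun v =>
    [natWord (A.update m v 0).1, natWord (A.update m v 1).1,
      if h : G.owner v = G.protagonist then natWord (A.move m ⟨v, h⟩ 0) else [],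
      if h : G.owner v = G.protagonist then natWord (A.move m ⟨v, h⟩ 1) else []])

/-- The encoding of an input over the three-letter alphabet `Option Bool`, the letter `none` marking
the end of each word. -/
noncomputable def encode (x : Input) : List (Option Bool) :=
  x.words.flatMap fun w => w.map some ++ [none]

end Input

end SafetyReach

/-!
Dominance is transitive, so the automaton fails to realize a chain if and only if, for some `n`, the
strategy with initial counter value `n` is not dominated by the one with `n + 1`. As strategies
depend on the whole history, a profile of the other players refutes dominance if and only if there
are two runs of the automaton, for `n` and `n + 1`, that do not separate at a vertex of another
player and whose payoffs are in the wrong order (`ParamAutomaton.not_weaklyDominated_iff`).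

Such a pair of runs is traced in a finite graph, in spite of the counter. As long as both counters
are positive the automaton does not distinguish their values, so the two runs agree; they part at a
counter-access state with counter values `0` and `1`, and from then on both counters are zero. The
value `n` itself need not be recorded: it is the number of visits to counter-access states before
that point. Once the histories have separated the two plays are independent, and the payoffs
possible for each of them are those of the reachable leaves, and `0` if a cycle outside the leaves
is reachable. Hence the automaton fails to realize a chain if and only if a bad node is reachable in
a graph whose nodes consist of at most two pairs of a memory state and a vertex
(`ParamAutomaton.not_realizesChain_iff`).

The nodes of this graph are coded by 5-tuples of numbers below the length of the input, and its
edges and bad nodes are definable by first-order formulas over the input with arithmetic terms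
(`result_iff_not_realizesChain`). Reachability in a graph that is defined in this way is decidable
in polynomial time (`polyTime_query`): the formulas are evaluated by nested loops over numbers in
unary, and the set of reachable nodes is computed in a table with one bit for each tuple, by passing
to the set of successors as often as there are tuples. The machine is compiled from a structured
program over finitely many stacks, with a semantics that counts steps (`Run.evalsTo`,
`polyTime_of_run`).
-/

namespace SafetyReach

/-! ### Structured stack programs -/

/-- The letters of the input; also used on all work stacks. -/
abbrev Letter := Option Bool

/-- Names of the registers that hold numbers. -/
abbrev Var := Fin 24

/-- The stacks of a program: the input and its back-up, two argument stacks and two auxiliary stacks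
for arithmetic, three stacks for tables of bits, a clock, and for each register its unary contents
`var x` together with a stack `co x` of the tokens that are not in use. -/
inductive Stk
  | inp | bak | argOne | argTwo | tmp | count | tabA | tabB | tabC | clock
  | var (x : Var)
  | co (x : Var)
  deriving DecidableEq, Fintype

/-- The finite control memory of a program: a truth value, two auxiliary bits, and the letter that
was popped last by a loop. -/
structure Ctl where
  flag : Bool
  done : Bool
  empty : Bool
  sym : Option Letter
  deriving Fintype

/-- The control memory between two parts of a program: only the truth value carries information. -/
def ctl (b : Bool) : Ctl := ⟨b, false, false, none⟩

/-- The contents of the stacks. -/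
abbrev Mem := Stk → List Letter

/-- Structured programs over the stacks `Stk`. The loop `drain k P` pops the letters of stack `k`
one after the other, stores each of them in the control memory and executes `P`. -/
inductive Prog
  | push (k : Stk) (f : Ctl → Letter)
  | pop (k : Stk) (f : Ctl → Option Letter → Ctl)
  | peek (k : Stk) (f : Ctl → Option Letter → Ctl)
  | load (f : Ctl → Ctl)
  | seq (P Q : Prog)
  | ite (c : Ctl → Bool) (P Q : Prog)
  | drain (k : Stk) (P : Prog)

open Function (update)

/-- `Run P s t s'`: started in `s`, the program `P` terminates in `s'` after at most `t` steps. -/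
inductive Run : Prog → Ctl × Mem → ℕ → Ctl × Mem → Prop
  | push (k f v S) : Run (.push k f) (v, S) 1 (v, update S k (f v :: S k))
  | pop (k f v S) : Run (.pop k f) (v, S) 1 (f v (S k).head?, update S k (S k).tail)
  | peek (k f v S) : Run (.peek k f) (v, S) 1 (f v (S k).head?, S)
  | load (f v S) : Run (.load f) (v, S) 1 (f v, S)
  | seq {P Q s s' s'' t t'} : Run P s t s' → Run Q s' t' s'' → Run (.seq P Q) s (t + t') s''
  | iteTrue {c P Q v S t s'} : c v = true → Run P (v, S) t s' → Run (.ite c P Q) (v, S) (t + 1) s'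
  | iteFalse {c P Q v S t s'} : c v = false → Run Q (v, S) t s' → Run (.ite c P Q) (v, S) (t + 1) s'
  | drainNil {k P v S} : S k = [] → Run (.drain k P) (v, S) 1 ({ v with sym := none }, S)
  | drainCons {k P v S a L s' s'' t t'} : S k = a :: L →
      Run P ({ v with sym := some a }, update S k L) t s' → Run (.drain k P) s' t' s'' →
      Run (.drain k P) (v, S) (t + t' + 1) s''
  | mono {P s t t' s'} : Run P s t s' → t ≤ t' → Run P s t' s'

/-! ### Compilation to Turing machines -/

namespace Prog

/-- The program points of a program. -/
def Label : Prog → Type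
  | push _ _ | pop _ _ | peek _ _ | load _ => Unit
  | seq P Q => Label P ⊕ Label Q
  | ite _ P Q => Option (Label P ⊕ Label Q)
  | drain _ P => Option (Label P)

/-- The program point at which the execution starts. -/
def entry : (P : Prog) → Label P
  | push _ _ | pop _ _ | peek _ _ | load _ => ()
  | seq P _ => .inl (entry P)
  | ite _ _ _ | drain _ _ => none

/-- There are finitely many program points. -/
@[reducible]
noncomputable def fintypeLabel : (P : Prog) → Fintype (Label P)
  | push _ _ | pop _ _ | peek _ _ | load _ => inferInstanceAs (Fintype Unit)
  | seq P Q =>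
    haveI := fintypeLabel P
    haveI := fintypeLabel Q
    inferInstanceAs (Fintype (Label P ⊕ Label Q))
  | ite _ P Q =>
    haveI := fintypeLabel P
    haveI := fintypeLabel Q
    inferInstanceAs (Fintype (Option (Label P ⊕ Label Q)))
  | drain _ P =>
    haveI := fintypeLabel P
    inferInstanceAs (Fintype (Option (Label P)))

end Prog

/-- The alphabets of the machine: the additional stack `none` is for the output. -/
abbrev StackLetter : Option Stk → Type
  | none => Bool
  | some _ => Letter

open Turing TM2.Stmt in
/-- The statements of the program points of `P` inside a machine with labels `Λ`, where `e` embeds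
the program points and `x` is the label at which the machine continues after `P`. -/
def Prog.code {Λ : Type} : (P : Prog) → (e : P.Label → Λ) → (x : Λ) → P.Label →
    TM2.Stmt StackLetter Λ Ctl
  | .push k f, _, x => fun _ => TM2.Stmt.push (some k) f (goto fun _ => x)
  | .pop k f, _, x => fun _ => TM2.Stmt.pop (some k) f (goto fun _ => x)
  | .peek k f, _, x => fun _ => TM2.Stmt.peek (some k) f (goto fun _ => x)
  | .load f, _, x => fun _ => TM2.Stmt.load f (goto fun _ => x)
  | .seq P Q, e, x => fun l =>
    match l with
    | .inl l => P.code (fun i => e (.inl i)) (e (.inr Q.entry)) l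
    | .inr l => Q.code (fun i => e (.inr i)) x l
  | .ite c P Q, e, x => fun l =>
    match l with
    | none => TM2.Stmt.branch c (goto fun _ => e (some (.inl P.entry)))
        (goto fun _ => e (some (.inr Q.entry)))
    | some (.inl l) => P.code (fun i => e (some (.inl i))) x l
    | some (.inr l) => Q.code (fun i => e (some (.inr i))) x l
  | .drain k P, e, x => fun l =>
    match l with
    | none => TM2.Stmt.pop (some k) (fun v a => { v with sym := a })
        (TM2.Stmt.branch (fun v => v.sym.isSome) (goto fun _ => e (some P.entry)) (goto fun _ => x))
    | some l => P.code (fun i => e (some i)) (e none) l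

/-- The stacks of the machine, given those of the program; the output stack is empty. -/
def Mem.toStacks (S : Mem) : (k : Option Stk) → List (StackLetter k)
  | none => []
  | some k => S k

theorem Mem.update_toStacks (S : Mem) (k : Stk) (L : List Letter) :
    update S.toStacks (some k) L = Mem.toStacks (update S k L) := by
  funext j
  cases j with
  | none => rfl
  | some j =>
    by_cases h : j = k
    · subst h
      rw [Function.update_self]
      exact (Function.update_self j L S).symm
    · rw [Function.update_of_ne (by simpa using h)]
      exact (Function.update_of_ne h L S).symm

/-- A machine that contains the statements of `P` simulates the runs of `P` step by step. -/
theorem Run.evalsTo {Λ : Type} (m : Λ → Turing.TM2.Stmt StackLetter Λ Ctl) {P : Prog}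
    {s s' : Ctl × Mem} {t : ℕ} (h : Run P s t s') :
    ∀ (e : P.Label → Λ) (x : Λ), (∀ l, m (e l) = P.code e x l) →
      Nonempty (StateTransition.EvalsToInTime (Turing.TM2.step m)
        ⟨some (e P.entry), s.1, s.2.toStacks⟩ (some ⟨some x, s'.1, s'.2.toStacks⟩) t) := by
  induction h with
  | push k f v S =>
    intro e x hm
    refine ⟨⟨⟨1, ?_⟩, le_rfl⟩⟩
    simp only [Function.iterate_one, flip, Option.bind_eq_bind, Option.bind_some,
      Turing.TM2.step, hm, Prog.code, Turing.TM2.stepAux]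
    exact congrArg (fun z => some (Turing.TM2.Cfg.mk (some x) v z)) (Mem.update_toStacks S k _)
  | pop k f v S =>
    intro e x hm
    refine ⟨⟨⟨1, ?_⟩, le_rfl⟩⟩
    simp only [Function.iterate_one, flip, Option.bind_eq_bind, Option.bind_some,
      Turing.TM2.step, hm, Prog.code, Turing.TM2.stepAux]
    exact congrArg (fun z => some (Turing.TM2.Cfg.mk (some x) (f v (S k).head?) z))
      (Mem.update_toStacks S k _)
  | peek k f v S =>
    intro e x hm
    refine ⟨⟨⟨1, ?_⟩, le_rfl⟩⟩
    simp only [Function.iterate_one, flip, Option.bind_eq_bind, Option.bind_some,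
      Turing.TM2.step, hm, Prog.code, Turing.TM2.stepAux]
    rfl
  | load f v S =>
    intro e x hm
    refine ⟨⟨⟨1, ?_⟩, le_rfl⟩⟩
    simp only [Function.iterate_one, flip, Option.bind_eq_bind, Option.bind_some,
      Turing.TM2.step, hm, Prog.code, Turing.TM2.stepAux]
  | @seq P Q s s' s'' t t' _ _ ih₁ ih₂ =>
    intro e x hm
    obtain ⟨h₁⟩ := ih₁ (fun i => e (.inl i)) (e (.inr Q.entry)) (fun l => hm (.inl l))
    obtain ⟨h₂⟩ := ih₂ (fun i => e (.inr i)) x (fun l => hm (.inr l))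
    rw [add_comm]
    exact ⟨.trans _ _ _ _ _ _ h₁ h₂⟩
  | @iteTrue c P Q v S t s' hc _ ih =>
    intro e x hm
    obtain ⟨h₂⟩ := ih (fun i => e (some (.inl i))) x (fun l => hm (some (.inl l)))
    refine ⟨.trans _ 1 _ _ _ _ ⟨⟨1, ?_⟩, le_rfl⟩ h₂⟩
    have h0 := hm none
    simp only [Prog.code] at h0
    refine congrArg some ?_
    change Turing.TM2.stepAux (m (e none)) _ _ = _
    rw [h0]
    simp only [Turing.TM2.stepAux, hc, cond_true]
  | @iteFalse c P Q v S t s' hc _ ih =>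
    intro e x hm
    obtain ⟨h₂⟩ := ih (fun i => e (some (.inr i))) x (fun l => hm (some (.inr l)))
    refine ⟨.trans _ 1 _ _ _ _ ⟨⟨1, ?_⟩, le_rfl⟩ h₂⟩
    have h0 := hm none
    simp only [Prog.code] at h0
    refine congrArg some ?_
    change Turing.TM2.stepAux (m (e none)) _ _ = _
    rw [h0]
    simp only [Turing.TM2.stepAux, hc, cond_false]
  | @drainNil k P v S hk =>
    intro e x hm
    have h0 : S.toStacks (some k) = [] := hk
    have h1 : update S.toStacks (some k) [] = S.toStacks := by
      rw [← h0, Function.update_eq_self]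
    refine ⟨⟨⟨1, ?_⟩, le_rfl⟩⟩
    have hc := hm none
    simp only [Prog.code] at hc
    refine congrArg some ?_
    change Turing.TM2.stepAux (m (e none)) _ _ = _
    rw [hc]
    simp only [Turing.TM2.stepAux, h0, List.head?_nil, List.tail_nil, Option.isSome_none,
      cond_false, h1]
  | @drainCons k P v S a L s' s'' t t' hk _ _ ih₁ ih₂ =>
    intro e x hm
    obtain ⟨h₁⟩ := ih₁ (fun i => e (some i)) (e none) (fun l => hm (some l))
    obtain ⟨h₂⟩ := ih₂ e x hm
    have h0 : Mem.toStacks S (some k) = a :: L := hk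
    rw [show t + t' + 1 = t' + (t + 1) by ring]
    refine ⟨.trans _ _ _ _ _ _ (.trans _ 1 _ _ _ _ ⟨⟨1, ?_⟩, le_rfl⟩ h₁) h₂⟩
    have hc := hm none
    simp only [Prog.code] at hc
    refine congrArg some ?_
    change Turing.TM2.stepAux (m (e none)) _ _ = _
    rw [hc]
    simp only [Turing.TM2.stepAux, h0, List.head?_cons, List.tail_cons, Option.isSome_some,
      cond_true]
    exact congrArg (fun z => Turing.TM2.Cfg.mk (some (e (some P.entry)))
      { v with sym := some a } z) (Mem.update_toStacks S k _)
  | mono _ hle ih =>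
    intro e x hm
    obtain ⟨h⟩ := ih e x hm
    exact ⟨⟨h.toEvalsTo, h.steps_le_m.trans hle⟩⟩

/-- The initial contents of the stacks. -/
def initMem (l : List Letter) : Mem := update (fun _ => []) .inp l

open Turing TM2.Stmt in
/-- The machine of a program: it ends by writing the truth value to the output stack. -/
noncomputable def Prog.machine (P : Prog) : FinTM2 where
  K := Option Stk
  k₀ := some .inp
  k₁ := none
  Γ := StackLetter
  Λ := Option P.Label
  main := some P.entry
  ΛFin := haveI := P.fintypeLabel; inferInstance
  σ := Ctl
  initialState := ctl false
  Γk₀Fin := inferInstanceAs (Fintype Letter)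
  m
    | some l => P.code some none l
    | none => TM2.Stmt.push none (fun v => v.flag) (TM2.Stmt.load (fun _ => ctl false) halt)

/-- A function is computable in polynomial time if some program computes it within a polynomial
number of steps and leaves all its stacks empty. -/
theorem polyTime_of_run {α : Type} (enc : α → List Letter) (f : α → Bool) (P : Prog)
    (p : Polynomial ℕ)
    (h : ∀ x, Run P (ctl false, initMem (enc x)) (p.eval (enc x).length)
      (ctl (f x), fun _ => [])) :
    Nonempty (Turing.TM2ComputableInPolyTime enc Computability.encodeBool f) := by
  have key : ∀ x, Nonempty (StateTransition.EvalsToInTime P.machine.step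
      (Turing.initList P.machine (enc x)) (some (Turing.haltList P.machine [f x]))
      ((p + 1).eval (enc x).length)) := by
    intro x
    obtain ⟨h₁⟩ := (h x).evalsTo P.machine.m some none (fun l => rfl)
    have h0 : Turing.initList P.machine (enc x) =
        ⟨some (some P.entry), ctl false, (initMem (enc x)).toStacks⟩ := by
      simp only [Turing.initList]
      congr 1
      funext k
      rcases k with _ | k
      · rfl
      · by_cases hk : k = .inp
        · subst hk; rfl
        · have : (some k : Option Stk) ≠ some .inp := by simpa using hk
          refine (dif_neg this).trans ?_
          exact (Function.update_of_ne hk (enc x) (fun _ => ([] : List Letter))).symm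
    rw [h0, Polynomial.eval_add, Polynomial.eval_one, add_comm]
    refine ⟨.trans _ _ _ _ _ _ h₁ ⟨⟨1, ?_⟩, le_rfl⟩⟩
    simp only [Function.iterate_one, flip, Option.bind_eq_bind]
    refine congrArg some (congrArg (Turing.TM2.Cfg.mk none (ctl false)) ?_)
    funext k
    rcases k with _ | k
    · rfl
    · rfl
  exact ⟨{
    tm := P.machine
    inputAlphabet := Equiv.refl Letter
    outputAlphabet := Equiv.refl Bool
    time := p + 1
    outputsFun := fun x => by
      have h1 : List.map (Equiv.refl Letter).invFun (enc x) = enc x := List.map_id _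
      have h2 : List.map (Equiv.refl Bool).invFun (Computability.encodeBool (f x)) = [f x] :=
        List.map_id _
      exact h1.symm ▸ h2.symm ▸ (key x).some }⟩

/-! ### Basic subroutines -/

/-- The control memory after a loop. -/
def Ctl.clearSym (v : Ctl) : Ctl := { v with sym := none }

@[simp] theorem clearSym_ctl (b : Bool) : (ctl b).clearSym = ctl b := rfl
@[simp] theorem flag_ctl (b : Bool) : (ctl b).flag = b := rfl

theorem Ctl.clearSym_eq {v : Ctl} (h : v.sym = none) : v.clearSym = v := by
  cases v; cases h; rfl

namespace Prog

/-- Do nothing. -/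
def skip : Prog := load id

/-- Push the letter that was popped last by a loop. -/
def pushSym (k : Stk) : Prog := push k fun v => v.sym.getD none

/-- Move the contents of stack `k` to stack `k'`, reversing their order. -/
def move (k k' : Stk) : Prog := drain k (pushSym k')

/-- Empty a stack. -/
def clear (k : Stk) : Prog := drain k skip

/-- Add the length of stack `k` to the unary number on stack `c`. -/
def copy (k c : Stk) : Prog :=
  seq (move k .tmp) (drain .tmp (seq (pushSym k) (push c fun _ => none)))

end Prog

open Prog

theorem Run.to {P : Prog} {s s' s'' : Ctl × Mem} {t t' : ℕ} (h : Run P s t s') (ht : t ≤ t')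
    (hs : s' = s'') : Run P s t' s'' :=
  hs ▸ h.mono ht

theorem run_skip (s : Ctl × Mem) : Run skip s 1 s := Run.load _ _ _

theorem run_move {k k' : Stk} (hk : k ≠ k') (v : Ctl) (S : Mem) :
    Run (move k k') (v, S) (2 * (S k).length + 1)
      (v.clearSym, update (update S k []) k' ((S k).reverse ++ S k')) := by
  generalize hL : S k = L
  induction L generalizing v S with
  | nil =>
    refine Run.to (Run.drainNil hL) (by simp) ?_
    refine Prod.ext rfl ?_
    funext j
    dsimp only
    by_cases h₁ : j = k' <;> by_cases h₂ : j = k <;> simp [*]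
  | cons a L ih =>
    refine Run.to (Run.drainCons hL (Run.push _ _ _ _)
      (ih _ _ (by simp [Function.update_of_ne hk]))) (by simp; ring_nf; omega) ?_
    refine Prod.ext rfl ?_
    funext j
    dsimp only
    by_cases h₁ : j = k' <;> by_cases h₂ : j = k <;> simp [*] <;> simp_all

theorem run_clear (k : Stk) (v : Ctl) (S : Mem) :
    Run (clear k) (v, S) (2 * (S k).length + 1) (v.clearSym, update S k []) := by
  generalize hL : S k = L
  induction L generalizing v S with
  | nil =>
    refine Run.to (Run.drainNil hL) (by simp) ?_
    rw [← hL, Function.update_eq_self]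
    rfl
  | cons a L ih =>
    refine Run.to (Run.drainCons hL (run_skip _)
      (ih _ _ (by simp))) (by simp; ring_nf; omega) ?_
    simp [Ctl.clearSym]

theorem run_copy {k c : Stk} (hk : k ≠ c) (hkt : k ≠ .tmp) (hct : c ≠ .tmp) (v : Ctl) (S : Mem)
    (hS : S .tmp = []) :
    Run (copy k c) (v, S) (5 * (S k).length + 2)
      (v.clearSym, update S c (List.replicate (S k).length none ++ S c)) := by
  have back : ∀ (L : List Letter) (v : Ctl) (S : Mem), S .tmp = L →
      Run (drain .tmp (seq (pushSym k) (push c fun _ => none))) (v, S) (3 * L.length + 1)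
        (v.clearSym, update (update (update S .tmp []) k (L.reverse ++ S k)) c
          (List.replicate L.length none ++ S c)) := by
    intro L
    induction L with
    | nil =>
      intro v S hL
      refine Run.to (Run.drainNil hL) (by simp) ?_
      refine Prod.ext rfl ?_
      funext j
      dsimp only
      by_cases h₁ : j = c <;> by_cases h₂ : j = k <;> by_cases h₃ : j = .tmp <;> simp [*]
      simp_all
    | cons a L ih =>
      intro v S hL
      refine Run.to (Run.drainCons hL (Run.seq (Run.push _ _ _ _) (Run.push _ _ _ _))
        (ih _ _ (by simp [Function.update_of_ne hkt.symm, Function.update_of_ne hct.symm])))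
        (by simp; ring_nf; omega) ?_
      refine Prod.ext rfl ?_
      funext j
      dsimp only
      have := hk.symm
      by_cases h₁ : j = c <;> by_cases h₂ : j = k <;> by_cases h₃ : j = .tmp <;>
        simp [*, List.replicate_succ']
      simp_all
  refine Run.to (Run.seq (run_move hkt v S) (back _ _ _ rfl)) (by simp [hS]; ring_nf; omega) ?_
  refine Prod.ext rfl ?_
  funext j
  dsimp only
  have := hk.symm
  by_cases h₁ : j = c <;> by_cases h₂ : j = k <;> by_cases h₃ : j = .tmp <;> simp [*]
  simp_all

/-! ### Arithmetic terms -/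

/-- Arithmetic terms over the registers. -/
inductive Tm
  | const (n : ℕ)
  | var (x : Var)
  | add (s t : Tm)
  | mul (x y : Var)

/-- The value of a term. -/
def Tm.val (ρ : Var → ℕ) : Tm → ℕ
  | const n => n
  | var x => ρ x
  | add s t => s.val ρ + t.val ρ
  | mul x y => ρ x * ρ y

/-- Add the value of a term to the unary number on stack `k`. -/
def Tm.eval (k : Stk) : Tm → Prog
  | const 0 => skip
  | const (n + 1) => seq (push k fun _ => none) (eval k (const n))
  | var x => copy (.var x) k
  | add s t => seq (t.eval k) (s.eval k)
  | mul x y => seq (copy (.var x) .count) (drain .count (copy (.var y) k))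

/-- A bound for the running time of the evaluation of a term, and for its value, if the registers
have values at most `X`. -/
noncomputable def Tm.time : Tm → Polynomial ℕ
  | const n => Polynomial.C (n + 1)
  | var _ => 5 * .X + 2
  | add s t => t.time + s.time
  | mul _ _ => 5 * .X + 2 + (.X * (5 * .X + 3) + 1)

/-- The numbers in the registers. -/
def Mem.env (S : Mem) (x : Var) : ℕ := (S (.var x)).length

/-- The contents of the stacks between two parts of a program that evaluates formulas on the input
`l`: the auxiliary stacks are empty and the registers hold numbers up to the length of the input. -/
structure Mem.Ready (l : List Letter) (S : Mem) : Prop where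
  inp : S .inp = l
  bak : S .bak = []
  argOne : S .argOne = []
  argTwo : S .argTwo = []
  tmp : S .tmp = []
  count : S .count = []
  le : ∀ x, S.env x ≤ l.length

theorem Tm.val_le {ρ : Var → ℕ} {D : ℕ} (h : ∀ x, ρ x ≤ D) (t : Tm) : t.val ρ ≤ t.time.eval D := by
  induction t with
  | const n => simp [val, time]
  | var x => simp [val, time]; linarith [h x]
  | add s t hs ht => simp [val, time]; linarith
  | mul x y => simp [val, time]; nlinarith [Nat.mul_le_mul (h x) (h y)]

theorem run_tm {l : List Letter} {k : Stk} (hk : k = .argOne ∨ k = .argTwo) (t : Tm) :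
    ∀ (v : Ctl) (S : Mem), v.sym = none → S .tmp = [] → S .count = [] → (∀ x, S.env x ≤ l.length) →
    Run (t.eval k) (v, S) (t.time.eval l.length)
      (v, update S k (List.replicate (t.val S.env) none ++ S k)) := by
  have hkt : k ≠ .tmp := by rcases hk with rfl | rfl <;> simp
  have hkc : k ≠ .count := by rcases hk with rfl | rfl <;> simp
  have hkv : ∀ x, .var x ≠ k := by rcases hk with rfl | rfl <;> simp
  have henv : ∀ (S : Mem) (L : List Letter), Mem.env (update S k L) = S.env := by
    intro S L; funext x; simp [Mem.env, Function.update_of_ne (hkv x)]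
  induction t with
  | const n =>
    intro v S hv ht hc hle
    induction n generalizing S with
    | zero =>
      rw [Tm.eval]
      refine Run.to (run_skip _) (by simp [Tm.time]) ?_
      simp [Tm.val]
    | succ n ih =>
      rw [Tm.eval]
      refine Run.to (Run.seq (Run.push _ _ _ _) (ih _ ?_ ?_ ?_)) ?_ ?_
      · simp [Function.update_of_ne hkt.symm, ht]
      · simp [Function.update_of_ne hkc.symm, hc]
      · simpa only [henv] using hle
      · simp [Tm.time]; omega
      · simp [Tm.val, List.replicate_succ']
  | var x =>
    intro v S hv ht hc hle
    rw [Tm.eval]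
    refine Run.to (run_copy (hkv x) (by simp) hkt v S ht) ?_ ?_
    · have := hle x
      simp only [Mem.env] at this
      simp [Tm.time]; omega
    · rw [Ctl.clearSym_eq hv]; rfl
  | add s t hs ht' =>
    intro v S hv ht hc hle
    rw [Tm.eval]
    refine Run.to (Run.seq (ht' v S hv ht hc hle) (hs v _ hv ?_ ?_ ?_)) ?_ ?_
    · simp [Function.update_of_ne hkt.symm, ht]
    · simp [Function.update_of_ne hkc.symm, hc]
    · simpa only [henv] using hle
    · simp [Tm.time]
    · simp only [Tm.val, henv, Function.update_self, Function.update_idem, ← List.append_assoc,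
        List.replicate_append_replicate]
  | mul x y =>
    intro v S hv ht hc hle
    have loop : ∀ (L : List Letter) (v : Ctl) (S : Mem), S .count = L → S .tmp = [] →
        S.env y ≤ l.length →
        Run (drain .count (copy (.var y) k)) (v, S) (L.length * (5 * l.length + 3) + 1)
          (v.clearSym, update (update S .count []) k
            (List.replicate (L.length * S.env y) none ++ S k)) := by
      intro L
      induction L with
      | nil =>
        intro v S hL _ _
        refine Run.to (Run.drainNil hL) (by simp) ?_
        refine Prod.ext rfl ?_
        funext j
        dsimp only
        by_cases h₁ : j = k <;> by_cases h₂ : j = .count <;> simp [*]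
        simp_all
      | cons a L ih =>
        intro v S hL hT hy
        refine Run.to (Run.drainCons hL
          (run_copy (hkv y) (by simp) hkt _ _ (by simp [hT])) (ih _ _ ?_ ?_ ?_)) ?_ ?_
        · simp [Function.update_of_ne hkc.symm]
        · simp [Function.update_of_ne hkt.symm, hT]
        · simpa [henv, Mem.env, Function.update_of_ne (hkv y)] using hy
        · simp only [Mem.env] at hy
          simp only [List.length_cons, ne_eq, reduceCtorEq, not_false_eq_true,
            Function.update_of_ne]
          ring_nf
          omega
        · have h₀ : Mem.env (update S .count L) = S.env := by
            funext x; simp [Mem.env]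
          have key : ∀ n R, List.replicate (L.length * n) (none : Letter) ++
              (List.replicate n none ++ R) = List.replicate ((L.length + 1) * n) none ++ R := by
            intro n R
            rw [← List.append_assoc, List.replicate_append_replicate, add_mul, one_mul]
          simp only [henv, h₀]
          refine Prod.ext rfl ?_
          funext j
          dsimp only
          by_cases h₁ : j = k <;> by_cases h₂ : j = .count <;>
            simp [*, Mem.env]
          simp_all
    rw [Tm.eval]
    refine Run.to (Run.seq (run_copy (k := .var x) (c := .count) (by simp) (by simp) (by simp)
      v S ht) (loop _ _ _ rfl (by simp [ht]) ?_)) ?_ ?_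
    · simpa [Mem.env] using hle y
    · have := hle x
      simp only [Mem.env] at this
      simp [hc, Tm.time]
      gcongr
    · rw [Ctl.clearSym_eq (v := v.clearSym) rfl, Ctl.clearSym_eq hv]
      refine Prod.ext rfl ?_
      funext j
      dsimp only
      by_cases h₁ : j = k <;> by_cases h₂ : j = .count <;> simp [*, Mem.env, Tm.val]
      simp_all

theorem Run.congr {P : Prog} {s₀ s s' s'' : Ctl × Mem} {t : ℕ} (h : Run P s t s') (h₀ : s₀ = s)
    (h₁ : s' = s'') : Run P s₀ t s'' :=
  h₀ ▸ h₁ ▸ h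

/-! ### Loops over all values of a register -/

/-- Execute `P` for all values of the register `x` below the number of available tokens. -/
def Prog.forVar (x : Var) (P : Prog) : Prog :=
  seq (drain (.co x) (seq (load Ctl.clearSym) (seq P (push (.var x) fun _ => none))))
    (drain (.var x) (push (.co x) fun _ => none))

/-- The stacks while the register `x` has value `i` inside a loop over all values below `D`. -/
def Mem.set (D : ℕ) (x : Var) (i : ℕ) (S : Mem) : Mem :=
  update (update S (.var x) (List.replicate i none)) (.co x) (List.replicate (D - 1 - i) none)

/-- A loop over all values of a register folds the effect `F` of its body on the remaining data `δ`.
-/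
theorem run_forVar {δ : Type} {x : Var} {P : Prog} {D T : ℕ} (c : δ → Ctl) (emb : δ → Mem)
    (F : δ → ℕ → δ) (hsym : ∀ d, (c d).sym = none) (hvar : ∀ d, emb d (.var x) = [])
    (hco : ∀ d, emb d (.co x) = List.replicate D none)
    (hP : ∀ i < D, ∀ d, Run P (c d, (emb d).set D x i) T (c (F d i), (emb (F d i)).set D x i))
    (d : δ) :
    Run (forVar x P) (c d, emb d) (D * (T + 5) + 2)
      (c ((List.range D).foldl F d), emb ((List.range D).foldl F d)) := by
  have loop : ∀ (n i : ℕ) (d : δ), i + n = D →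
      Run (drain (.co x) (seq (load Ctl.clearSym) (seq P (push (.var x) fun _ => none))))
        (c d, update (update (emb d) (.var x) (List.replicate i none)) (.co x)
          (List.replicate n none)) (n * (T + 3) + 1)
        (c ((List.range' i n).foldl F d),
          update (update (emb ((List.range' i n).foldl F d)) (.var x) (List.replicate D none))
            (.co x) []) := by
    intro n
    induction n with
    | zero =>
      intro i d h
      obtain rfl : i = D := h
      refine Run.to (Run.drainNil (by simp)) (by simp) ?_
      refine Prod.ext ?_ rfl
      exact Ctl.clearSym_eq (hsym d)
    | succ n ih =>
      intro i d h
      have h1 := hP i (by omega) d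
      have h2 := ih (i + 1) (F d i) (by omega)
      have hb := Run.seq (Run.load Ctl.clearSym { c d with sym := some none }
        ((emb d).set D x i)) (Run.seq (h1.congr (Prod.ext (Ctl.clearSym_eq (hsym d)) rfl) rfl)
          (Run.push (.var x) (fun _ => none) _ _))
      refine Run.to (Run.drainCons (a := none) (L := List.replicate n none)
        (by simp [List.replicate_succ]) (hb.congr ?_ rfl)
        (h2.congr ?_ rfl)) (by ring_nf; omega) (by simp [List.range'_succ])
      · simp [Mem.set, show D - 1 - i = n by omega]
      · refine Prod.ext rfl ?_
        simp only [Mem.set, show D - 1 - i = n by omega]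
        funext j
        by_cases h₁ : j = .co x <;> by_cases h₂ : j = .var x <;> simp [*, List.replicate_succ]
  have back : ∀ (n i : ℕ) (v : Ctl) (S : Mem), S (.var x) = List.replicate n none →
      S (.co x) = List.replicate i none →
      Run (drain (.var x) (push (.co x) fun _ => none)) (v, S) (n * 2 + 1)
        (v.clearSym, update (update S (.var x) []) (.co x) (List.replicate (n + i) none)) := by
    intro n
    induction n with
    | zero =>
      intro i v S h₁ h₂
      refine Run.to (Run.drainNil (by simpa using h₁)) (by simp) ?_
      refine Prod.ext rfl ?_
      funext j
      by_cases h₃ : j = .co x <;> by_cases h₄ : j = .var x <;> simp_all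
    | succ n ih =>
      intro i v S h₁ h₂
      refine Run.to (Run.drainCons (a := none) (L := List.replicate n none)
        (by simp [h₁, List.replicate_succ]) (Run.push _ _ _ _)
        (ih (i + 1) _ _ (by simp) (by simp [h₂, List.replicate_succ]))) (by ring_nf; omega) ?_
      refine Prod.ext rfl ?_
      funext j
      by_cases h₃ : j = .co x <;> by_cases h₄ : j = .var x <;> simp [*] <;> try omega
  have h1 := loop D 0 d (by simp)
  have h2 := back D 0 (c ((List.range' 0 D).foldl F d))
    (update (update (emb ((List.range' 0 D).foldl F d)) (.var x) (List.replicate D none))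
            (.co x) []) (by simp) (by simp)
  rw [show update (update (emb d) (.var x) (List.replicate 0 none)) (.co x)
    (List.replicate D none) = emb d from by
      funext j
      by_cases h₃ : j = .co x <;> by_cases h₄ : j = .var x <;> simp [*]] at h1
  refine Run.to (Run.seq h1 h2) (by ring_nf; omega) ?_
  rw [← List.range_eq_range']
  refine Prod.ext (Ctl.clearSym_eq (hsym _)) ?_
  funext j
  by_cases h₃ : j = .co x <;> by_cases h₄ : j = .var x <;> simp [*]

/-! ### Formulas -/

/-- The letter at position `j` of word number `i`, as a truth value, where every letter `none` ends
a word; `false` if there is no such letter. -/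
def bitAt : List Letter → ℕ → ℕ → Bool
  | [], _, _ => false
  | none :: _, 0, _ => false
  | none :: l, i + 1, j => bitAt l i j
  | some b :: _, 0, 0 => b
  | some _ :: l, 0, j + 1 => bitAt l 0 j
  | some _ :: l, i + 1, j => bitAt l (i + 1) j

/-- First-order formulas over an input that consists of words. Quantifiers range over the numbers
below the length of the input. -/
inductive Fm
  | bit (a b : Tm)
  | lt (a b : Tm)
  | neg (φ : Fm)
  | and (φ ψ : Fm)
  | ex (x : Var) (φ : Fm)

namespace Fm

/-- The truth value of a formula. -/
def eval (l : List Letter) : Fm → (Var → ℕ) → Bool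
  | bit a b, ρ => bitAt l (a.val ρ) (b.val ρ)
  | lt a b, ρ => decide (a.val ρ < b.val ρ)
  | neg φ, ρ => !φ.eval l ρ
  | and φ ψ, ρ => φ.eval l ρ && ψ.eval l ρ
  | ex x φ, ρ => (List.range l.length).any fun i => φ.eval l (update ρ x i)

/-- The bound variables of a formula. -/
def bound : Fm → List Var
  | bit _ _ | lt _ _ => []
  | neg φ => φ.bound
  | and φ ψ => φ.bound ++ ψ.bound
  | ex x φ => x :: φ.bound

/-- No variable is bound again in the scope of a quantifier for it. This is needed because a
quantifier uses the register of its variable. -/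
def wellScoped : Fm → Bool
  | bit _ _ | lt _ _ => true
  | neg φ => φ.wellScoped
  | and φ ψ => φ.wellScoped && ψ.wellScoped
  | ex x φ => !φ.bound.contains x && φ.wellScoped

/-- One step of the search for a bit: `argOne` counts the words and `argTwo` the letters that have
to be skipped. -/
def scanStep : Prog :=
  seq (pushSym .bak) (ite (fun v => v.done) skip
    (ite (fun v => v.sym = some none)
      (pop .argOne fun v o => { v with done := o.isNone })
      (seq (peek .argOne fun v o => { v with empty := o.isNone })
        (ite (fun v => v.empty)
          (pop .argTwo fun v o =>
            if o.isNone then { v with done := true, flag := decide (v.sym = some (some true)) }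
            else v)
          skip))))

/-- A program that evaluates a formula. -/
def prog : Fm → Prog
  | bit a b => seq (load fun _ => ctl false) <| seq (a.eval .argOne) <| seq (b.eval .argTwo) <|
      seq (drain .inp scanStep) <| seq (clear .argOne) <| seq (clear .argTwo) <|
      seq (move .bak .inp) (load fun v => ctl v.flag)
  | lt a b => seq (a.eval .argOne) <| seq (b.eval .argTwo) <|
      seq (drain .argOne (pop .argTwo fun v _ => v)) <|
      seq (pop .argTwo fun _ o => ctl o.isSome) (clear .argTwo)
  | neg φ => seq φ.prog (load fun v => ctl !v.flag)
  | and φ ψ => seq φ.prog (ite (fun v => v.flag) ψ.prog skip)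
  | ex x φ => seq (load fun _ => ctl false) (forVar x (ite (fun v => v.flag) skip φ.prog))

open Polynomial in
/-- A bound for the running time of the evaluation. -/
noncomputable def time : Fm → Polynomial ℕ
  | bit a b => 1 + (a.time + (b.time + (7 * X + 1 + (2 * a.time + 1 + (2 * b.time + 1 +
      (2 * X + 1 + 1))))))
  | lt a b => a.time + (b.time + (2 * a.time + 1 + (1 + (2 * b.time + 1))))
  | neg φ => φ.time + 1
  | and φ ψ => φ.time + (ψ.time + 2)
  | ex _ φ => 1 + (X * (φ.time + 2 + 5) + 2)

end Fm

/-- The search for a bit. Until it has stopped, the truth value is `false`. -/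
theorem run_scan (L : List Letter) : ∀ (v : Ctl) (S : Mem) (i j : ℕ), S .inp = L →
    S .argOne = List.replicate i none → S .argTwo = List.replicate j none →
    (v.done = false → v.flag = false) →
    ∃ s e i' j', i' ≤ i ∧ j' ≤ j ∧ Run (drain .inp Fm.scanStep) (v, S) (7 * L.length + 1)
      (⟨if v.done then v.flag else bitAt L i j, s, e, none⟩,
        update (update (update (update S .inp []) .bak (L.reverse ++ S .bak)) .argOne
          (List.replicate i' none)) .argTwo (List.replicate j' none)) := by
  induction L with
  | nil =>
    intro v S i j hL hi hj hv
    refine ⟨v.done, v.empty, i, j, le_rfl, le_rfl, Run.to (Run.drainNil hL) (by simp) ?_⟩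
    refine Prod.ext ?_ ?_
    · cases hs : v.done <;> simp [bitAt, hs] at hv ⊢
      exact hv
    · funext k
      cases k <;> simp [*]
  | cons a L ih =>
    intro v S i j hL hi hj hv
    -- It suffices to know the effect of one step on the arguments.
    suffices H : ∃ v' i₁ j₁, i₁ ≤ i ∧ j₁ ≤ j ∧ Run Fm.scanStep ({ v with sym := some a }, update S .inp L) 6
        (v', update (update (update (update S .inp L) .bak (a :: S .bak)) .argOne
          (List.replicate i₁ none)) .argTwo (List.replicate j₁ none)) ∧
        (v'.done = false → v'.flag = false) ∧
        (if v'.done then v'.flag else bitAt L i₁ j₁) =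
          if v.done then v.flag else bitAt (a :: L) i j by
      obtain ⟨v', i₁, j₁, hi₁, hj₁, hr, hv', he⟩ := H
      obtain ⟨s, e, i₂, j₂, hi₂, hj₂, hr'⟩ := ih v' (update (update (update (update S .inp L) .bak
        (a :: S .bak)) .argOne (List.replicate i₁ none)) .argTwo (List.replicate j₁ none)) i₁ j₁
        (by simp) (by simp) (by simp) hv'
      refine ⟨s, e, i₂, j₂, hi₂.trans hi₁, hj₂.trans hj₁,
        Run.to (Run.drainCons hL hr hr') (by simp; omega) ?_⟩
      refine Prod.ext (by simp [he]) ?_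
      funext k
      cases k <;> simp
    obtain ⟨fl, st, em, sy⟩ := v
    have mem : ∀ A B, S .argOne = A → S .argTwo = B →
        update (update S .inp L) .bak (a :: S .bak) =
        update (update (update (update S .inp L) .bak (a :: S .bak)) .argOne A) .argTwo B := by
      rintro A B rfl rfl
      funext k
      cases k <;> simp
    cases st with
    | true =>
      refine ⟨⟨fl, true, em, some a⟩, i, j, le_rfl, le_rfl,
        Run.to (Run.seq (Run.push _ _ _ _) (Run.iteTrue rfl (run_skip _))) (by simp) ?_,
        by simp, by simp⟩
      exact Prod.ext rfl (mem _ _ hi hj)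
    | false =>
      obtain rfl : fl = false := hv rfl
      rcases a with _ | b
      · refine ⟨⟨false, decide (i = 0), em, some none⟩, i - 1, j, by omega, le_rfl,
          Run.to (Run.seq (Run.push _ _ _ _) (Run.iteFalse rfl (Run.iteTrue (by simp)
            (Run.pop _ _ _ _)))) (by simp) ?_, by simp, ?_⟩
        · refine Prod.ext ?_ ?_
          · cases i <;> simp [hi, List.replicate_succ]
          · funext k
            cases k <;> simp [hi, hj]
        · cases i <;> simp [bitAt]
      · rcases i with _ | i
        · refine ⟨⟨decide (j = 0) && b, decide (j = 0), true, some (some b)⟩, 0, j - 1, le_rfl,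
            by omega, Run.to (Run.seq (Run.push _ _ _ _) (Run.iteFalse rfl (Run.iteFalse (by simp)
              (Run.seq (Run.peek _ _ _ _) (Run.iteTrue (by simp [hi]) (Run.pop _ _ _ _))))))
              (by simp) ?_, by simp; tauto, ?_⟩
          · refine Prod.ext ?_ ?_
            · cases j <;> simp [hi, hj, List.replicate_succ]
            · funext k
              cases k <;> simp [hi, hj]
          · cases j <;> simp [bitAt]
        · refine ⟨⟨false, false, false, some (some b)⟩, i + 1, j, le_rfl, le_rfl,
            Run.to (Run.seq (Run.push _ _ _ _) (Run.iteFalse rfl (Run.iteFalse (by simp)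
              (Run.seq (Run.peek _ _ _ _) (Run.iteFalse (by simp [hi, List.replicate_succ])
                (run_skip _)))))) (by simp) ?_, by simp, by simp [bitAt]⟩
          refine Prod.ext ?_ (mem _ _ hi hj)
          simp [hi, List.replicate_succ]

theorem run_fm {l : List Letter} (φ : Fm) : ∀ (b : Bool) (S : Mem), S.Ready l → φ.wellScoped = true →
    (∀ x ∈ φ.bound, S (.var x) = [] ∧ S (.co x) = List.replicate l.length none) →
    Run φ.prog (ctl b, S) (φ.time.eval l.length) (ctl (φ.eval l S.env), S) := by
  induction φ with
  | bit s t =>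
    intro b S hS _ _
    have hle := hS.le
    have h₁ := run_tm (l := l) (.inl rfl) s (ctl false) S rfl hS.tmp hS.count hle
    have henv : ∀ L, Mem.env (update S .argOne L) = S.env := by
      intro L; funext x; simp [Mem.env]
    have h₂ := run_tm (l := l) (.inr rfl) t (ctl false)
      (update S .argOne (List.replicate (s.val S.env) none ++ S .argOne)) rfl
      (by simp [hS.tmp]) (by simp [hS.count]) (by simpa only [henv] using hle)
    rw [henv] at h₂
    obtain ⟨st, em, i', j', hi', hj', h₃⟩ := run_scan l (ctl false) (i := s.val S.env) (j := t.val S.env)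
      (by simp [hS.inp]) (by simp [hS.argOne]) (by simp [hS.argTwo]) (fun _ => rfl)
      (S := (update (update S .argOne (List.replicate (s.val S.env) none ++ S .argOne)) .argTwo
        (List.replicate (t.val S.env) none ++
          update S .argOne (List.replicate (s.val S.env) none ++ S .argOne) .argTwo)))
    refine Run.to (Run.seq (Run.load _ _ _) (Run.seq h₁ (Run.seq h₂ (Run.seq h₃ (Run.seq
      (run_clear _ _ _) (Run.seq (run_clear _ _ _) (Run.seq (run_move (by simp) _ _)
        (Run.load _ _ _)))))))) ?_ (Prod.ext rfl ?_)
    · have h₄ := hi'.trans (s.val_le hle)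
      have h₅ := hj'.trans (t.val_le hle)
      simp [Fm.time, hS.bak]
      omega
    · funext k
      cases k <;> simp [hS.inp, hS.bak, hS.argOne, hS.argTwo]
  | lt s t =>
    intro b S hS _ _
    have hle := hS.le
    have h₁ := run_tm (l := l) (.inl rfl) s (ctl b) S rfl hS.tmp hS.count hle
    have henv : ∀ L, Mem.env (update S .argOne L) = S.env := by
      intro L; funext x; simp [Mem.env]
    have h₂ := run_tm (l := l) (.inr rfl) t (ctl b)
      (update S .argOne (List.replicate (s.val S.env) none ++ S .argOne)) rfl
      (by simp [hS.tmp]) (by simp [hS.count]) (by simpa only [henv] using hle)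
    rw [henv] at h₂
    -- Both numbers are decremented as often as possible; the loop realizes truncated subtraction.
    have loop : ∀ (i j : ℕ) (v : Ctl) (S : Mem), S .argOne = List.replicate i none →
        S .argTwo = List.replicate j none →
        Run (drain .argOne (pop .argTwo fun v _ => v)) (v, S) (2 * i + 1)
          (v.clearSym, update (update S .argOne []) .argTwo (List.replicate (j - i) none)) := by
      intro i
      induction i with
      | zero =>
        intro j v S hi hj
        refine Run.to (Run.drainNil (by simpa using hi)) (by simp) (Prod.ext rfl ?_)
        funext k
        cases k <;> simp [hi, hj]
      | succ i ih =>
        intro j v S hi hj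
        refine Run.to (Run.drainCons (a := none) (L := List.replicate i none)
          (by simp [hi, List.replicate_succ]) (Run.pop _ _ _ _)
          (ih (j - 1) _ _ (by simp) (by simp [hj]))) (by omega) (Prod.ext rfl ?_)
        funext k
        cases k <;> simp
        omega
    refine Run.to (Run.seq h₁ (Run.seq h₂ (Run.seq (loop (s.val S.env) (t.val S.env) _ _
      (by simp [hS.argOne]) (by simp [hS.argTwo])) (Run.seq (Run.pop _ _ _ _)
        (run_clear _ _ _))))) ?_ (Prod.ext ?_ ?_)
    · have h₄ := s.val_le hle
      have h₅ := t.val_le hle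
      simp [Fm.time]
      omega
    · simp only [clearSym_ctl, Fm.eval, Function.update_self]
      congr 1
      rw [Bool.eq_iff_iff]
      cases h : t.val S.env - s.val S.env <;> simp [List.replicate_succ] <;> omega
    · funext k
      cases k <;> simp [hS.argOne, hS.argTwo]
  | neg φ ih =>
    intro b S hS hs hb
    exact Run.to (Run.seq (ih b S hS hs hb) (Run.load _ _ _)) (by simp [Fm.time]) rfl
  | and φ ψ ih₁ ih₂ =>
    intro b S hS hs hb
    simp only [Fm.wellScoped, Bool.and_eq_true] at hs
    simp only [Fm.bound, List.mem_append] at hb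
    have h₁ := ih₁ b S hS hs.1 fun x hx => hb x (.inl hx)
    cases h : φ.eval l S.env with
    | true =>
      rw [h] at h₁
      exact Run.to (Run.seq h₁ (Run.iteTrue rfl
        (ih₂ true S hS hs.2 fun x hx => hb x (.inr hx)))) (by simp [Fm.time]) (by simp [Fm.eval, h])
    | false =>
      rw [h] at h₁
      exact Run.to (Run.seq h₁ (Run.iteFalse rfl (run_skip _))) (by simp [Fm.time])
        (by simp [Fm.eval, h])
  | ex x φ ih =>
    intro b S hS hs hb
    simp only [Fm.wellScoped, Bool.and_eq_true, Bool.not_eq_true', List.contains_eq_mem,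
      decide_eq_false_iff_not] at hs
    have hx := hb x (by simp [Fm.bound])
    have hl := run_forVar (P := ite (fun v => v.flag) skip φ.prog) (x := x) (D := l.length)
      (T := φ.time.eval l.length + 2) ctl
      (fun _ => S) (fun fl i => fl || φ.eval l (update S.env x i)) (fun _ => rfl) (fun _ => hx.1)
      (fun _ => hx.2) ?_ false
    · refine Run.to (Run.seq (Run.load _ _ _) hl) (by simp [Fm.time]) ?_
      have : ∀ (L : List ℕ) (b : Bool), L.foldl (fun fl i => fl || φ.eval l (update S.env x i)) b =
          (b || L.any fun i => φ.eval l (update S.env x i)) := by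
        intro L
        induction L with
        | nil => simp
        | cons i L ih => intro b; simp [ih, Bool.or_assoc]
      simp [this, Fm.eval]
    · intro i hi d
      cases d with
      | true => exact Run.to (Run.iteTrue rfl (run_skip _)) (by omega) (by simp)
      | false =>
        have henv : (S.set l.length x i).env = update S.env x i := by
          funext y
          by_cases h : y = x
          · subst h; simp [Mem.set, Mem.env]
          · simp [Mem.set, Mem.env, h]
        have := ih false (S.set l.length x i) ?_ hs.2 ?_
        · rw [henv] at this
          exact Run.to (Run.iteFalse rfl this) (by omega) (by simp)
        · constructor <;> try simp [Mem.set, hS.inp, hS.bak, hS.argOne, hS.argTwo, hS.tmp, hS.count]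
          intro y
          change Mem.env (S.set l.length x i) y ≤ _
          rw [henv]
          by_cases h : y = x
          · subst h; simp; omega
          · simp [h, hS.le]
        · intro y hy
          have hyx : y ≠ x := fun h => hs.1 (h ▸ hy)
          have := hb y (by simp [Fm.bound, hy])
          simpa [Mem.set, hyx] using this

/-! ### Loops over tuples -/

/-- All tuples of length `k` of numbers below `D`, in lexicographic order. -/
def tuples (D : ℕ) : ℕ → List (List ℕ)
  | 0 => [[]]
  | k + 1 => (List.range D).flatMap fun i => (tuples D k).map (i :: ·)

theorem mem_tuples {D k : ℕ} {u : List ℕ} : u ∈ tuples D k ↔ u.length = k ∧ ∀ i ∈ u, i < D := by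
  induction k generalizing u with
  | zero => simp +contextual [tuples]
  | succ k ih =>
    cases u with
    | nil => simp [tuples]
    | cons i u => simp [tuples, ih]; tauto

theorem length_tuples (D k : ℕ) : (tuples D k).length = D ^ k := by
  induction k with
  | zero => rfl
  | succ k ih => simp [tuples, ih, pow_succ, mul_comm]

/-- Execute `P` for all values of the registers `xs`. -/
def Prog.forVars : List Var → Prog → Prog
  | [], P => P
  | x :: xs, P => forVar x (forVars xs P)

/-- The stacks while the registers `xs` have the values `u` inside a loop over all tuples. -/
def Mem.setAll (D : ℕ) : List Var → List ℕ → Mem → Mem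
  | x :: xs, i :: u, S => setAll D xs u (S.set D x i)
  | _, _, S => S

/-- The assignment that gives the registers `xs` the values `u`. -/
def assign (ρ : Var → ℕ) : List Var → List ℕ → Var → ℕ
  | x :: xs, i :: u => assign (update ρ x i) xs u
  | _, _ => ρ

open Polynomial in
/-- A bound for the running time of `k` nested loops around a program with running time `T`. -/
noncomputable def loopTime (T : Polynomial ℕ) : ℕ → Polynomial ℕ
  | 0 => T
  | k + 1 => X * (loopTime T k + 5) + 2

/-- Nested loops over the values of registers fold the effect `F` of their body over all tuples. -/
theorem run_forVars {δ : Type} {P : Prog} {D : ℕ} {T : Polynomial ℕ} (c : δ → Ctl)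
    (hsym : ∀ d, (c d).sym = none) (xs : List Var) :
    ∀ (emb : δ → Mem) (F : δ → List ℕ → δ), xs.Nodup →
      (∀ x ∈ xs, ∀ d, emb d (.var x) = [] ∧ emb d (.co x) = List.replicate D none) →
      (∀ u ∈ tuples D xs.length, ∀ d, Run P (c d, (emb d).setAll D xs u) (T.eval D)
        (c (F d u), (emb (F d u)).setAll D xs u)) → ∀ d,
      Run (forVars xs P) (c d, emb d) ((loopTime T xs.length).eval D)
        (c ((tuples D xs.length).foldl F d), emb ((tuples D xs.length).foldl F d)) := by
  induction xs with
  | nil =>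
    intro emb F _ _ hP d
    exact hP [] (by simp [tuples]) d
  | cons x xs ih =>
    intro emb F hnd hx hP d
    rw [List.nodup_cons] at hnd
    have := run_forVar (P := forVars xs P) (x := x) (T := (loopTime T xs.length).eval D) c emb
      (fun d i => (tuples D xs.length).foldl (fun d u => F d (i :: u)) d) hsym
      (fun d => (hx x (by simp) d).1) (fun d => (hx x (by simp) d).2) ?_ d
    · refine Run.to this (by simp [loopTime]) ?_
      simp [tuples, List.foldl_flatMap, List.foldl_map]
    · intro i hi d
      refine ih (fun d => (emb d).set D x i) (fun d u => F d (i :: u)) hnd.2 ?_ ?_ d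
      · intro y hy d
        have hyx : y ≠ x := fun h => hnd.1 (h ▸ hy)
        have := hx y (by simp [hy]) d
        simpa [Mem.set, hyx] using this
      · intro u hu d
        exact hP (i :: u) (by simpa [tuples, hi] using hu) d

/-- Whether a stack belongs to a register. -/
def Stk.isReg : Stk → Bool
  | var _ | co _ => true
  | _ => false

section
variable {D : ℕ} {xs : List Var} {u : List ℕ} {S : Mem} {k : Stk}

theorem Mem.set_apply {x : Var} {i : ℕ} (h : k.isReg = false) : S.set D x i k = S k := by
  cases k <;> simp_all [Mem.set, Stk.isReg]

theorem Mem.update_set {x : Var} {i : ℕ} (h : k.isReg = false) (L : List Letter) :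
    update (S.set D x i) k L = Mem.set D x i (update S k L) := by
  have h₁ : k ≠ .var x := by rintro rfl; simp [Stk.isReg] at h
  have h₂ : k ≠ .co x := by rintro rfl; simp [Stk.isReg] at h
  rw [Mem.set, Mem.set, Function.update_comm h₂.symm, Function.update_comm h₁.symm]

theorem Mem.setAll_apply (h : k.isReg = false) : S.setAll D xs u k = S k := by
  induction xs, u, S using Mem.setAll.induct D with
  | case1 x xs i u S ih => rw [Mem.setAll, ih, Mem.set_apply h]
  | case2 xs u S h' => rw [Mem.setAll]; exact h'

theorem Mem.update_setAll (h : k.isReg = false) (L : List Letter) :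
    update (S.setAll D xs u) k L = Mem.setAll D xs u (update S k L) := by
  induction xs, u, S using Mem.setAll.induct D with
  | case1 x xs i u S ih => rw [Mem.setAll, ih, Mem.setAll, Mem.update_set h]
  | case2 xs u S h' => rw [Mem.setAll, Mem.setAll] <;> exact h'

@[simp] theorem Mem.setAll_tabA : S.setAll D xs u .tabA = S .tabA := Mem.setAll_apply rfl
@[simp] theorem Mem.setAll_tabB : S.setAll D xs u .tabB = S .tabB := Mem.setAll_apply rfl
@[simp] theorem Mem.setAll_tabC : S.setAll D xs u .tabC = S .tabC := Mem.setAll_apply rfl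
@[simp] theorem Mem.setAll_clock : S.setAll D xs u .clock = S .clock := Mem.setAll_apply rfl
@[simp] theorem Mem.update_setAll_tabA (L : List Letter) :
    update (S.setAll D xs u) .tabA L = Mem.setAll D xs u (update S .tabA L) := Mem.update_setAll rfl L
@[simp] theorem Mem.update_setAll_tabB (L : List Letter) :
    update (S.setAll D xs u) .tabB L = Mem.setAll D xs u (update S .tabB L) := Mem.update_setAll rfl L
@[simp] theorem Mem.update_setAll_tabC (L : List Letter) :
    update (S.setAll D xs u) .tabC L = Mem.setAll D xs u (update S .tabC L) := Mem.update_setAll rfl L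
@[simp] theorem Mem.update_setAll_clock (L : List Letter) :
    update (S.setAll D xs u) .clock L = Mem.setAll D xs u (update S .clock L) := Mem.update_setAll rfl L

theorem Mem.setAll_reg {x : Var} (h : x ∉ xs) :
    S.setAll D xs u (.var x) = S (.var x) ∧ S.setAll D xs u (.co x) = S (.co x) := by
  induction xs, u, S using Mem.setAll.induct D with
  | case1 y xs i u S ih =>
    simp only [List.mem_cons, not_or] at h
    rw [Mem.setAll, (ih h.2).1, (ih h.2).2]
    simp [Mem.set, h.1]
  | case2 xs u S h' => rw [Mem.setAll]; exacts [⟨rfl, rfl⟩, h']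

theorem Mem.env_set {x : Var} {i : ℕ} : (S.set D x i).env = update S.env x i := by
  funext y
  by_cases h : y = x
  · subst h; simp [Mem.set, Mem.env]
  · simp [Mem.set, Mem.env, h]

theorem Mem.env_setAll : (S.setAll D xs u).env = assign S.env xs u := by
  induction xs, u, S using Mem.setAll.induct D with
  | case1 x xs i u S ih => rw [Mem.setAll, ih, Mem.env_set, assign]
  | case2 xs u S h' => rw [Mem.setAll, assign] <;> exact h'

theorem Mem.Ready.setAll {l : List Letter} (hS : S.Ready l) (hu : ∀ i ∈ u, i < l.length) :
    (S.setAll l.length xs u).Ready l := by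
  induction xs, u, S using Mem.setAll.induct l.length with
  | case1 x xs i u S ih =>
    simp only [List.mem_cons, forall_eq_or_imp] at hu
    rw [Mem.setAll]
    refine ih ?_ hu.2
    constructor
    case le =>
      intro y
      rw [Mem.env_set]
      by_cases h : y = x
      · subst h; simp [hu.1.le]
      · simpa [h] using hS.le y
    all_goals rw [Mem.set_apply rfl]
    exacts [hS.inp, hS.bak, hS.argOne, hS.argTwo, hS.tmp, hS.count]
  | case2 xs u S h' => rw [Mem.setAll]; exacts [hS, h']

end

/-! ### Reachability by saturation -/

/-- The registers for the source of an edge. -/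
def srcVars : List Var := [0, 1, 2, 3, 4]

/-- The registers for the target of an edge. -/
def tgtVars : List Var := [5, 6, 7, 8, 9]

/-- Formulas that describe a graph on the 5-tuples of numbers below the length of the input: initial
nodes, edges and accepting nodes. -/
structure Query where
  init : Fm
  edge : Fm
  acc : Fm

namespace Query

/-- The truth value of `init` at a node. -/
def initAt (q : Query) (l : List Letter) (u : List ℕ) : Bool :=
  q.init.eval l (assign 0 tgtVars u)

/-- The truth value of `edge` for an edge from `w` to `u`. -/
def edgeAt (q : Query) (l : List Letter) (w u : List ℕ) : Bool :=
  q.edge.eval l (assign (assign 0 tgtVars u) srcVars w)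

/-- The truth value of `acc` at a node. -/
def accAt (q : Query) (l : List Letter) (w : List ℕ) : Bool :=
  q.acc.eval l (assign 0 srcVars w)

/-- The successors of a set of nodes. -/
def post (q : Query) (l : List Letter) (R : List ℕ → Bool) (u : List ℕ) : Bool :=
  (tuples l.length 5).any fun w => R w && q.edgeAt l w u

/-- Whether an accepting node is found by computing successors as often as there are nodes. -/
def result (q : Query) (l : List Letter) : Bool :=
  (tuples l.length 5).any fun w =>
    (q.post l)^[(tuples l.length 5).length] (q.initAt l) w && q.accAt l w

/-- The formulas bind each variable only once in a scope, and do not bind the variables of the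
nodes. -/
structure WellScoped (q : Query) : Prop where
  init : q.init.wellScoped = true
  edge : q.edge.wellScoped = true
  acc : q.acc.wellScoped = true
  init_bound : ∀ x ∈ q.init.bound, x ∉ tgtVars
  edge_bound : ∀ x ∈ q.edge.bound, x ∉ tgtVars ∧ x ∉ srcVars
  acc_bound : ∀ x ∈ q.acc.bound, x ∉ srcVars

/-- Start the table with the initial nodes, and the clock. -/
def startProg (q : Query) : Prog :=
  seq (forVars tgtVars (seq q.init.prog (seq (push .tabC fun v => some v.flag)
    (seq (push .clock fun _ => none) (load fun _ => ctl false))))) (move .tabC .tabA)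

/-- Search the table for a node that satisfies `φ`; the table is moved to the second stack. -/
def scan (φ : Fm) : Prog :=
  forVars srcVars (seq (pop .tabA fun v o => { v with sym := o }) (seq (pushSym .tabB)
    (ite (fun v => !v.flag && decide (v.sym = some (some true)))
      (seq (load fun _ => ctl false) φ.prog) (load fun v => ctl v.flag))))

/-- Replace the set of nodes in the table by its set of successors. -/
def sweep (q : Query) : Prog :=
  seq (forVars tgtVars (seq (scan q.edge) (seq (move .tabB .tabA)
    (seq (push .tabC fun v => some v.flag) (load fun _ => ctl false)))))
  (seq (clear .tabA) (move .tabC .tabA))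

end Query

/-- The stacks between the phases of the saturation, given the tables and the clock: all registers
hold `0` and have all their tokens. -/
def tabMem (l A B C Z : List Letter) : Mem
  | .inp => l
  | .co _ => List.replicate l.length none
  | .tabA => A
  | .tabB => B
  | .tabC => C
  | .clock => Z
  | _ => []

section
variable (l A B C Z L : List Letter)

@[simp] theorem update_tabMem_tabA : update (tabMem l A B C Z) .tabA L = tabMem l L B C Z := by
  funext k; cases k <;> simp [tabMem]
@[simp] theorem update_tabMem_tabB : update (tabMem l A B C Z) .tabB L = tabMem l A L C Z := by
  funext k; cases k <;> simp [tabMem]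
@[simp] theorem update_tabMem_tabC : update (tabMem l A B C Z) .tabC L = tabMem l A B L Z := by
  funext k; cases k <;> simp [tabMem]
@[simp] theorem update_tabMem_clock : update (tabMem l A B C Z) .clock L = tabMem l A B C L := by
  funext k; cases k <;> simp [tabMem]
@[simp] theorem env_tabMem : (tabMem l A B C Z).env = 0 := rfl
@[simp] theorem tabMem_tabA : tabMem l A B C Z .tabA = A := rfl
@[simp] theorem tabMem_tabB : tabMem l A B C Z .tabB = B := rfl
@[simp] theorem tabMem_tabC : tabMem l A B C Z .tabC = C := rfl
@[simp] theorem tabMem_clock : tabMem l A B C Z .clock = Z := rfl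

theorem ready_tabMem : (tabMem l A B C Z).Ready l := by
  constructor <;> simp [tabMem]

end

variable {l : List Letter} {q : Query}

/-- The letters of the table of a set of nodes. -/
def table (l : List Letter) (R : List ℕ → Bool) : List Letter :=
  (tuples l.length 5).map fun u => some (R u)

theorem foldl_cons_map {α β : Type} (f : α → β) (L : List α) (B : List β) :
    L.foldl (fun d u => f u :: d) B = (L.map f).reverse ++ B := by
  induction L generalizing B with
  | nil => rfl
  | cons a L ih => simp [ih]

open Polynomial in
theorem run_start (hq : q.WellScoped) :
    Run q.startProg (ctl false, tabMem l [] [] [] [])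
      ((loopTime (q.init.time + 3) 5 + (2 * X ^ 5 + 1)).eval l.length)
      (ctl false, tabMem l (table l (q.initAt l)) [] []
        (List.replicate (tuples l.length 5).length none)) := by
  have h := run_forVars (P := (seq q.init.prog (seq (push .tabC fun v => some v.flag)
    (seq (push .clock fun _ => none) (load fun _ => ctl false))))) (D := l.length)
    (T := q.init.time + 3) (δ := List Letter) (fun _ => ctl false) (fun _ => rfl) tgtVars
    (fun d => tabMem l [] [] d (List.replicate d.length none))
    (fun d u => some (q.initAt l u) :: d) (by decide) (fun _ _ _ => ⟨rfl, rfl⟩) ?_ []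
  · rw [foldl_cons_map] at h
    refine Run.to (Run.seq h (run_move (by simp) _ _)) ?_ (Prod.ext rfl ?_)
    · simp [length_tuples, tgtVars]
    · simp [table, tgtVars]
  · intro u hu d
    rw [mem_tuples] at hu
    have hr := run_fm q.init false (Mem.setAll l.length tgtVars u
      (tabMem l [] [] d (List.replicate d.length none))) ((ready_tabMem _ _ _ _ _).setAll hu.2)
      hq.init (fun x hx => by
        rw [(Mem.setAll_reg (hq.init_bound x hx)).1, (Mem.setAll_reg (hq.init_bound x hx)).2]
        exact ⟨rfl, rfl⟩)
    rw [Mem.env_setAll] at hr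
    refine Run.to (Run.seq hr (Run.seq (Run.push _ _ _ _) (Run.seq (Run.push _ _ _ _)
      (Run.load _ _ _)))) (by simp) (Prod.ext rfl ?_)
    simp [Query.initAt, List.replicate_succ]

open Polynomial in
theorem run_tableScan {φ : Fm} (hφ : φ.wellScoped = true)
    (hb : ∀ x ∈ φ.bound, x ∉ tgtVars ∧ x ∉ srcVars)
    (R : List ℕ → Bool) (C Z : List Letter) (u : List ℕ) (hu : ∀ i ∈ u, i < l.length) :
    Run (Query.scan φ) (ctl false, (tabMem l (table l R) [] C Z).setAll l.length tgtVars u)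
      ((loopTime (φ.time + 4) 5).eval l.length)
      (ctl ((tuples l.length 5).any fun w =>
        R w && φ.eval l (assign (assign 0 tgtVars u) srcVars w)),
        (tabMem l [] (table l R).reverse C Z).setAll l.length tgtVars u) := by
  have h := run_forVars (P := (seq (pop .tabA fun v o => { v with sym := o }) (seq (pushSym .tabB)
    (ite (fun v => !v.flag && decide (v.sym = some (some true)))
      (seq (load fun _ => ctl false) φ.prog) (load fun v => ctl v.flag))))) (D := l.length)
    (T := φ.time + 4) (δ := Bool × List Letter × List Letter) (fun d => ctl d.1) (fun _ => rfl)
    srcVars (fun d => (tabMem l d.2.1 d.2.2 C Z).setAll l.length tgtVars u)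
    (fun d w => (d.1 || (decide (d.2.1.head? = some (some true)) &&
      φ.eval l (assign (assign 0 tgtVars u) srcVars w)), d.2.1.tail, d.2.1.head?.getD none :: d.2.2))
    (by decide) ?_ ?_ (false, table l R, [])
  · have hf : ∀ (L : List (List ℕ)) (b : Bool) (B : List Letter),
        L.foldl (fun (d : Bool × List Letter × List Letter) w =>
          (d.1 || (decide (d.2.1.head? = some (some true)) &&
            φ.eval l (assign (assign 0 tgtVars u) srcVars w)), d.2.1.tail,
            d.2.1.head?.getD none :: d.2.2)) (b, L.map fun w => some (R w), B) =
        (b || L.any fun w => R w && φ.eval l (assign (assign 0 tgtVars u) srcVars w), [],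
          (L.map fun w => some (R w)).reverse ++ B) := by
      intro L
      induction L with
      | nil => simp
      | cons w L ih =>
        intro b B
        simp [ih, Bool.or_assoc]
    have h' := hf (tuples l.length 5) false []
    change List.foldl _ (false, table l R, []) _ = _ at h'
    rw [show srcVars.length = 5 from rfl, h'] at h
    refine Run.to h le_rfl ?_
    simp [table]
  · intro x hx d
    have : x ∉ tgtVars := by
      revert x; decide
    rw [(Mem.setAll_reg this).1, (Mem.setAll_reg this).2]
    exact ⟨rfl, rfl⟩
  · rintro w hw ⟨b, A, B⟩
    rw [mem_tuples] at hw
    dsimp only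
    set S := (tabMem l A.tail (A.head?.getD none :: B) C Z).setAll l.length tgtVars u with hS
    have hr := run_fm φ false (S.setAll l.length srcVars w)
      (((ready_tabMem _ _ _ _ _).setAll hu).setAll hw.2) hφ (fun x hx => by
        rw [(Mem.setAll_reg (hb x hx).2).1, (Mem.setAll_reg (hb x hx).2).2, hS,
          (Mem.setAll_reg (hb x hx).1).1, (Mem.setAll_reg (hb x hx).1).2]
        exact ⟨rfl, rfl⟩)
    rw [Mem.env_setAll, hS, Mem.env_setAll, env_tabMem, ← hS] at hr
    by_cases hc : b = false ∧ A.head? = some (some true)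
    · refine Run.to (Run.seq (Run.pop _ _ _ _) (Run.seq (Run.push _ _ _ _) (Run.iteTrue ?_
        (Run.seq (Run.load _ _ _) (hr.congr (Prod.ext rfl ?_) rfl))))) ?_ ?_
      · simp [ctl, hc.1, hc.2]
      · simp [hS]
      · simp; ring_nf; omega
      · simp [hc.1, hc.2]
    · refine Run.to (Run.seq (Run.pop _ _ _ _) (Run.seq (Run.push _ _ _ _) (Run.iteFalse ?_
        (Run.load _ _ _)))) ?_ (Prod.ext ?_ ?_)
      · simp only [ctl]
        cases b <;> simp_all
      · simp
      · simp only [ctl]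
        congr 1
        cases b <;> simp_all
      · simp [hS]

open Polynomial in
/-- A bound for the running time of a sweep. -/
noncomputable def Query.sweepTime (q : Query) : Polynomial ℕ :=
  loopTime (loopTime (q.edge.time + 4) 5 + (2 * X ^ 5 + 1 + 2)) 5 + (2 * X ^ 5 + 1 + (2 * X ^ 5 + 1))

theorem run_sweep (hq : q.WellScoped) (v : Ctl) (hv : v.clearSym = ctl false) (R : List ℕ → Bool)
    (Z : List Letter) :
    Run (seq (load Ctl.clearSym) q.sweep) (v, tabMem l (table l R) [] [] Z)
      (1 + q.sweepTime.eval l.length)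
      (ctl false, tabMem l (table l (q.post l R)) [] [] Z) := by
  have h := run_forVars (P := seq (Query.scan q.edge) (seq (move .tabB .tabA)
    (seq (push .tabC fun v => some v.flag) (load fun _ => ctl false)))) (D := l.length)
    (T := loopTime (q.edge.time + 4) 5 + (2 * .X ^ 5 + 1 + 2)) (δ := List Letter)
    (fun _ => ctl false) (fun _ => rfl) tgtVars (fun d => tabMem l (table l R) [] d Z)
    (fun d u => some (q.post l R u) :: d) (by decide) (fun _ _ _ => ⟨rfl, rfl⟩) ?_ []
  · rw [foldl_cons_map] at h
    refine Run.to (Run.seq (Run.load _ _ _) (Run.seq (h.congr (Prod.ext hv rfl) rfl)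
      (Run.seq (run_clear _ _ _) (run_move (by simp) _ _)))) ?_ (Prod.ext rfl ?_)
    · simp [length_tuples, tgtVars, table, Query.sweepTime]
    · simp [table, tgtVars]
  · intro u hu d
    rw [mem_tuples] at hu
    have hr := run_tableScan hq.edge hq.edge_bound R d Z u hu.2
    refine Run.to (Run.seq hr (Run.seq (run_move (by simp) _ _) (Run.seq (Run.push _ _ _ _)
      (Run.load _ _ _)))) ?_ (Prod.ext rfl ?_)
    · simp [table, length_tuples]
    · simp
      rfl

/-- The clock has one letter for each node, so the loop over it computes the set of nodes that are
reached after as many steps as there are nodes. -/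
theorem run_clock (hq : q.WellScoped) (n : ℕ) : ∀ (v : Ctl) (R : List ℕ → Bool),
    v.clearSym = ctl false →
    Run (drain .clock (seq (load Ctl.clearSym) q.sweep))
      (v, tabMem l (table l R) [] [] (List.replicate n none))
      (n * (q.sweepTime.eval l.length + 2) + 1)
      (ctl false, tabMem l (table l ((q.post l)^[n] R)) [] [] []) := by
  induction n with
  | zero =>
    intro v R hv
    exact Run.to (Run.drainNil rfl) (by simp) (Prod.ext hv rfl)
  | succ n ih =>
    intro v R hv
    refine Run.to (Run.drainCons (a := none) (L := List.replicate n none) rfl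
      ((run_sweep (l := l) hq _ ?_ R (List.replicate n none)).congr (Prod.ext rfl (by simp)) rfl)
      (ih _ _ rfl)) ?_ rfl
    · exact hv
    · ring_nf; omega

/-! ### Set-up and clean-up -/

/-- Execute `f x` for the registers `x` in a list. -/
def Prog.forEach (f : Var → Prog) : List Var → Prog
  | [] => skip
  | x :: xs => seq (f x) (forEach f xs)

theorem run_pushAll (xs : List Var) (hxs : xs.Nodup) (v : Ctl) (S : Mem) :
    Run (forEach (fun x => push (.co x) fun _ => none) xs) (v, S) (xs.length + 1)
      (v, fun k => match k with
        | .co x => if x ∈ xs then none :: S (.co x) else S (.co x)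
        | k => S k) := by
  induction xs generalizing S with
  | nil =>
    refine Run.to (run_skip _) (by simp) (Prod.ext rfl ?_)
    funext k
    cases k <;> simp
  | cons x xs ih =>
    rw [List.nodup_cons] at hxs
    refine Run.to (Run.seq (Run.push _ _ _ _) (ih hxs.2 _)) (by simp; omega) (Prod.ext rfl ?_)
    funext k
    cases k with
    | co y =>
      by_cases h : y = x
      · subst h; simp [hxs.1]
      · simp [h]
    | _ => simp

theorem run_clearAll (xs : List Var) (v : Ctl) (hv : v.sym = none) (S : Mem) (D : ℕ)
    (hD : ∀ x, (S (.co x)).length ≤ D) :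
    Run (forEach (fun x => clear (.co x)) xs) (v, S) (xs.length * (2 * D + 1) + 1)
      (v, fun k => match k with
        | .co x => if x ∈ xs then [] else S (.co x)
        | k => S k) := by
  induction xs generalizing S with
  | nil =>
    refine Run.to (run_skip _) (by simp) (Prod.ext rfl ?_)
    funext k
    cases k <;> simp
  | cons x xs ih =>
    have := hD x
    refine Run.to (Run.seq (run_clear _ _ _) ((ih (update S (.co x) []) ?_).congr
      (Prod.ext (Ctl.clearSym_eq hv) rfl) rfl)) (by simp; ring_nf; omega) (Prod.ext rfl ?_)
    · intro y
      by_cases h : y = x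
      · subst h; simp
      · simpa [h] using hD y
    · funext k
      cases k with
      | co y =>
        by_cases h : y = x
        · subst h; simp
        · simp [h]
      | _ => simp

/-- Provide each register with as many tokens as the input has letters. -/
def setupProg : Prog :=
  seq (drain .inp (seq (pushSym .bak)
    (forEach (fun x => push (.co x) fun _ => none) (List.finRange 24)))) (move .bak .inp)

theorem run_setup (l : List Letter) :
    Run setupProg (ctl false, initMem l) (29 * l.length + 2) (ctl false, tabMem l [] [] [] []) := by
  have loop : ∀ (L : List Letter) (v : Ctl) (S : Mem) (n : ℕ), S .inp = L →
      (∀ x, S (.co x) = List.replicate n none) →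
      Run (drain .inp (seq (pushSym .bak)
        (forEach (fun x => push (.co x) fun _ => none) (List.finRange 24)))) (v, S)
        (27 * L.length + 1) (v.clearSym, fun k => match k with
          | .co _ => List.replicate (n + L.length) none
          | .inp => []
          | .bak => L.reverse ++ S .bak
          | k => S k) := by
    intro L
    induction L with
    | nil =>
      intro v S n hL hn
      refine Run.to (Run.drainNil hL) (by simp) (Prod.ext rfl ?_)
      funext k
      cases k <;> simp [hL, hn]
    | cons a L ih =>
      intro v S n hL hn
      refine Run.to (Run.drainCons hL (Run.seq (Run.push _ _ _ _)
        (run_pushAll _ (List.nodup_finRange 24) _ _)) (ih _ _ (n + 1) ?_ ?_)) ?_ (Prod.ext rfl ?_)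
      · simp
      · intro x; simp [hn, List.replicate_succ]
      · simp; omega
      · funext k
        cases k <;> simp
        omega
  refine Run.to (Run.seq (loop l _ _ 0 (by simp [initMem]) (by simp [initMem]))
    (run_move (by simp) _ _)) ?_ (Prod.ext rfl ?_)
  · simp [initMem]; omega
  · funext k
    cases k <;> simp [initMem, tabMem]

/-- The complete decision procedure; it answers whether no accepting node is reachable. -/
def Query.decisionProg (q : Query) : Prog :=
  seq setupProg <| seq q.startProg <| seq (drain .clock (seq (load Ctl.clearSym) q.sweep)) <|
  seq (Query.scan q.acc) <| seq (clear .tabB) <| seq (clear .inp) <|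
  seq (forEach (fun x => clear (.co x)) (List.finRange 24)) (load fun v => ctl !v.flag)

open Polynomial in
/-- The graph queries that are given by formulas are decidable in polynomial time. -/
theorem polyTime_query {α : Type} (enc : α → List Letter) (q : Query) (hq : q.WellScoped)
    (hacc : ∀ x ∈ q.acc.bound, x ∉ tgtVars) :
    Nonempty (Turing.TM2ComputableInPolyTime enc Computability.encodeBool
      fun x => !q.result (enc x)) := by
  refine polyTime_of_run enc _ q.decisionProg (29 * X + 2 +
    (loopTime (q.init.time + 3) 5 + (2 * X ^ 5 + 1) + (X ^ 5 * (q.sweepTime + 2) + 1 +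
    (loopTime (q.acc.time + 4) 5 + (2 * X ^ 5 + 1 + (2 * X + 1 + (24 * (2 * X + 1) + 1 + 1)))))))
    fun x => ?_
  generalize enc x = l
  have hs := run_tableScan (l := l) hq.acc (fun x hx => ⟨hacc x hx, hq.acc_bound x hx⟩)
    ((q.post l)^[(tuples l.length 5).length] (q.initAt l)) [] [] [] (by simp)
  refine Run.to (Run.seq (run_setup l) (Run.seq (run_start hq) (Run.seq
    (run_clock hq _ _ _ rfl) (Run.seq hs (Run.seq (run_clear _ _ _) (Run.seq (run_clear _ _ _)
    (Run.seq (run_clearAll _ _ rfl _ l.length ?_) (Run.load _ _ _)))))))) ?_ (Prod.ext ?_ ?_)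
  · intro x; simp [Mem.setAll, tgtVars, tabMem]
  · simp [Mem.setAll, tgtVars, tabMem, length_tuples, table]
  · rfl
  · funext k
    cases k <;> simp [Mem.setAll, tgtVars, tabMem]

/-! ### Correctness of the saturation -/

/-- An increasing sequence of subsets of a finite set, in which each set determines the next one, is
constant from the cardinality of that set on. -/
theorem subset_of_card_le {α : Type} {T : Finset α} {S : ℕ → Finset α} (hT : ∀ k, S k ⊆ T)
    (hmono : ∀ k, S k ⊆ S (k + 1)) (hdet : ∀ k, S k = S (k + 1) → S (k + 1) = S (k + 2)) {n : ℕ}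
    (hn : T.card ≤ n) (k : ℕ) : S k ⊆ S n := by
  have claim : ∀ n, S n = S (n + 1) ∨ n + 1 ≤ (S (n + 1)).card := by
    intro n
    induction n with
    | zero =>
      by_cases h : S 0 = S 1
      · exact .inl h
      · have := Finset.card_lt_card ((hmono 0).ssubset_of_ne h)
        exact .inr (Nat.one_le_of_lt this)
    | succ n ih =>
      rcases ih with ih | ih
      · exact .inl (hdet n ih)
      · by_cases h : S (n + 1) = S (n + 2)
        · exact .inl h
        · have := Finset.card_lt_card ((hmono (n + 1)).ssubset_of_ne h)
          exact .inr (by omega)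
  have hs : S n = S (n + 1) := by
    refine (claim n).resolve_right fun h => ?_
    have := Finset.card_le_card (hT (n + 1))
    omega
  have hs' : ∀ m, S (n + m) = S (n + m + 1) := by
    intro m
    induction m with
    | zero => exact hs
    | succ m ih => exact hdet _ ih
  have hc : ∀ m, S (n + m) = S n := by
    intro m
    induction m with
    | zero => rfl
    | succ m ih => rw [← ih]; exact (hs' m).symm
  calc S k ⊆ S (n + k) := monotone_nat_of_le_succ (f := S) hmono (Nat.le_add_left k n)
    _ = S n := hc k

/-- The edges of the graph described by a query. -/
def Query.Edge (q : Query) (l : List Letter) (w u : List ℕ) : Prop :=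
  u ∈ tuples l.length 5 ∧ q.edgeAt l w u = true

/-- The iteration in `Query.result` yields the nodes at the end of walks of one fixed length. As the
edge relation is reflexive, these sets grow with the length, so they are all reachable nodes once
the length is the number of nodes. -/
theorem Query.result_iff (hrefl : ∀ u ∈ tuples l.length 5, q.edgeAt l u u = true) :
    q.result l = true ↔ ∃ u ∈ tuples l.length 5, q.initAt l u = true ∧
      ∃ w, Relation.ReflTransGen (q.Edge l) u w ∧ q.accAt l w = true := by
  classical
  have post_iff : ∀ R u, q.post l R u = true ↔
      ∃ w ∈ tuples l.length 5, R w = true ∧ q.edgeAt l w u = true := by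
    simp [Query.post]
  simp only [Query.result, List.any_eq_true, Bool.and_eq_true]
  constructor
  · rintro ⟨w, hw, hR, ha⟩
    suffices H : ∀ k w, w ∈ tuples l.length 5 → (q.post l)^[k] (q.initAt l) w = true →
        ∃ u ∈ tuples l.length 5, q.initAt l u = true ∧ Relation.ReflTransGen (q.Edge l) u w by
      obtain ⟨u, hu, hi, h⟩ := H _ w hw hR
      exact ⟨u, hu, hi, w, h, ha⟩
    intro k
    induction k with
    | zero => exact fun w hw h => ⟨w, hw, h, .refl⟩
    | succ k ih =>
      intro w hw h
      rw [Function.iterate_succ_apply', post_iff] at h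
      obtain ⟨w', hw', h', he⟩ := h
      obtain ⟨u, hu, hi, hr⟩ := ih w' hw' h'
      exact ⟨u, hu, hi, hr.tail ⟨hw, he⟩⟩
  · rintro ⟨u, hu, hi, w, hr, ha⟩
    have hw : w ∈ tuples l.length 5 ∧ ∃ k, (q.post l)^[k] (q.initAt l) w = true := by
      clear ha
      induction hr with
      | refl => exact ⟨hu, 0, hi⟩
      | tail _ he ih =>
        obtain ⟨hw, k, hk⟩ := ih
        refine ⟨he.1, k + 1, ?_⟩
        rw [Function.iterate_succ_apply', post_iff]
        exact ⟨_, hw, hk, he.2⟩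
    obtain ⟨hw, k, hk⟩ := hw
    refine ⟨w, hw, ?_, ha⟩
    let S : ℕ → Finset (List ℕ) := fun k =>
      (tuples l.length 5).toFinset.filter fun u => (q.post l)^[k] (q.initAt l) u = true
    have hmem : ∀ k u, u ∈ S k ↔
        u ∈ tuples l.length 5 ∧ (q.post l)^[k] (q.initAt l) u = true := by
      simp [S]
    have hsucc : ∀ k u, u ∈ S (k + 1) ↔ u ∈ tuples l.length 5 ∧
        ∃ w ∈ S k, q.edgeAt l w u = true := by
      intro k u
      simp only [hmem, Function.iterate_succ_apply', post_iff, and_assoc]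
    have := subset_of_card_le (T := (tuples l.length 5).toFinset) (S := S)
      (fun k => Finset.filter_subset _ _)
      (fun k u hu => (hsucc k u).2 ⟨((hmem k u).1 hu).1, u, hu, hrefl u ((hmem k u).1 hu).1⟩)
      (fun k h => by
        ext u
        rw [hsucc, hsucc, ← h])
      (List.toFinset_card_le _) k
    exact ((hmem _ w).1 (this ((hmem k w).2 ⟨hw, hk⟩))).2

/-! ### Plays and runs of the automaton -/

namespace Game

variable {V P M : Type} {G : Game V P}

/-- The vertices of a history, last vertex first. -/
def Hist.verts : {v : V} → G.Hist v → List V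
  | _, .single v => [v]
  | v, .snoc h _ => v :: h.verts

/-- The history of length `k + 1` along an infinite path. -/
def Hist.along (r : ℕ → V) (hr : ∀ k, G.edge (r k) (r (k + 1))) : (k : ℕ) → G.Hist (r k)
  | 0 => .single (r 0)
  | k + 1 => .snoc (along r hr k) (hr k)

theorem Hist.length_verts_along (r : ℕ → V) (hr : ∀ k, G.edge (r k) (r (k + 1))) (k : ℕ) :
    (along r hr k).verts.length = k + 1 := by
  induction k with
  | zero => rfl
  | succ k ih => simp [along, verts, ih]

theorem Hist.verts_along_eq_iff (r r' : ℕ → V) (hr : ∀ k, G.edge (r k) (r (k + 1)))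
    (hr' : ∀ k, G.edge (r' k) (r' (k + 1))) (k : ℕ) :
    (along r hr k).verts = (along r' hr' k).verts ↔ ∀ i ≤ k, r i = r' i := by
  induction k with
  | zero => simp [along, verts]
  | succ k ih =>
    simp only [along, verts, List.cons.injEq, ih]
    constructor
    · rintro ⟨h₁, h₂⟩ i hi
      rcases Nat.le_succ_iff.1 hi with h | rfl
      exacts [h₂ i h, h₁]
    · exact fun h => ⟨h _ le_rfl, fun i hi => h i (by omega)⟩

theorem profile_protagonist (s : G.Strategy G.protagonist) (t : G.CoStrategy) (j : P)
    (hj : j = G.protagonist) (v : V) (h : G.Hist v) (hv : G.owner v = j) :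
    G.profile s t j v h hv = s v h (hv.trans hj) := by
  subst hj
  simp [profile]

theorem profile_other (s : G.Strategy G.protagonist) (t : G.CoStrategy) (j : P)
    (hj : j ≠ G.protagonist) : G.profile s t j = t j hj := by
  simp [profile, hj]

theorem play_eq_along (f : ∀ j : P, G.Strategy j) (r : ℕ → V)
    (hr : ∀ k, G.edge (r k) (r (k + 1))) (h0 : r 0 = G.init)
    (h : ∀ k, (f (G.owner (r k)) (r k) (Hist.along r hr k) rfl).1 = r (k + 1)) (k : ℕ) :
    G.play f k = ⟨r k, Hist.along r hr k⟩ := by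
  induction k with
  | zero =>
    change (⟨G.init, .single G.init⟩ : (v : V) × G.Hist v) = ⟨r 0, .single (r 0)⟩
    rw [h0]
  | succ k ih =>
    have key : ∀ (w : {w : V // G.edge (r k) w}), w.1 = r (k + 1) →
        (⟨w.1, Hist.snoc (Hist.along r hr k) w.2⟩ : (v : V) × G.Hist v) =
          ⟨r (k + 1), Hist.along r hr (k + 1)⟩ := by
      rintro ⟨w, hw⟩ rfl
      rfl
    have key' : ∀ c : (v : V) × G.Hist v, c = ⟨r k, Hist.along r hr k⟩ →
        (⟨(f (G.owner c.1) c.1 c.2 rfl).1, Hist.snoc c.2 (f (G.owner c.1) c.1 c.2 rfl).2⟩ :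
          (v : V) × G.Hist v) = ⟨r (k + 1), Hist.along r hr (k + 1)⟩ := by
      rintro _ rfl
      exact key _ (h k)
    exact key' _ ih

end Game

namespace ParamAutomaton

variable {V P M : Type} {G : Game V P} (A : ParamAutomaton G M)

/-- One round of the game, seen from the automaton: memory state and counter value together with the
current vertex. -/
def Round (c d : (M × ℕ) × V) : Prop :=
  G.edge c.2 d.2 ∧ d.1 = A.update c.1.1 c.2 c.1.2 ∧
    ∀ h : G.owner c.2 = G.protagonist, d.2 = A.move c.1.1 ⟨c.2, h⟩ c.1.2

/-- The infinite runs of a relation. -/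
def _root_.SafetyReach.IsRun {α : Type} (R : α → α → Prop) (s : ℕ → α) : Prop :=
  ∀ k, R (s k) (s (k + 1))

/-- Two infinite paths can be outcomes of one profile of the other players: they do not separate at
a vertex of one of those. -/
def Coupled (G : Game V P) (r r' : ℕ → V) : Prop :=
  ∀ j, (∀ i ≤ j, r i = r' i) → G.owner (r j) ≠ G.protagonist → r (j + 1) = r' (j + 1)

/-- From the configurations `c` and `c'`, coupled runs are possible such that the first one has a
larger payoff. -/
def Separates (c c' : (M × ℕ) × V) : Prop :=
  ∃ s s', IsRun A.Round s ∧ IsRun A.Round s' ∧ s 0 = c ∧ s' 0 = c' ∧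
    Coupled G (fun k => (s k).2) (fun k => (s' k).2) ∧
    G.payoff (fun k => (s' k).2) < G.payoff (fun k => (s k).2)

/-- The run of the automaton along the outcome of a profile. -/
def runOf (n : ℕ) (f : ∀ j : P, G.Strategy j) (k : ℕ) : (M × ℕ) × V :=
  (A.config n (G.play f k).2, (G.play f k).1)

theorem isRun_runOf (n : ℕ) (t : G.CoStrategy) :
    IsRun A.Round (A.runOf n (G.profile (A.strategy n) t)) := by
  intro k
  refine ⟨?_, rfl, ?_⟩
  · exact (G.profile (A.strategy n) t _ _ (G.play (G.profile (A.strategy n) t) k).2 rfl).2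
  · intro h
    exact congrArg Subtype.val (Game.profile_protagonist _ _ _ h _ _ rfl)

theorem config_along {s : ℕ → (M × ℕ) × V} (hs : IsRun A.Round s) {n : ℕ} (h0 : (s 0).1 = (A.start, n))
    (k : ℕ) : A.config n (Game.Hist.along (fun k => (s k).2) (fun k => (hs k).1) k) = (s k).1 := by
  induction k with
  | zero => exact h0.symm
  | succ k ih =>
    rw [Game.Hist.along, config, ih]
    exact ((hs k).2.1).symm

/-- Two strategies of the automaton fail to be ordered if and only if there are coupled runs with
payoffs in the wrong order: strategies depend on the whole history, so that the other players can
follow both runs by a single profile as long as these separate at a vertex of the protagonist. -/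
theorem not_weaklyDominated_iff (n n' : ℕ) :
    ¬ G.WeaklyDominated (A.strategy n) (A.strategy n') ↔
      A.Separates ((A.start, n), G.init) ((A.start, n'), G.init) := by
  classical
  constructor
  · intro h
    simp only [Game.WeaklyDominated, not_forall, not_le] at h
    obtain ⟨t, ht⟩ := h
    refine ⟨_, _, A.isRun_runOf n t, A.isRun_runOf n' t, rfl, rfl, ?_, ht⟩
    intro j hj hown
    have hplay : ∀ i ≤ j, G.play (G.profile (A.strategy n) t) i =
        G.play (G.profile (A.strategy n') t) i := by
      intro i hi
      induction i with
      | zero => rfl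
      | succ i ih =>
        specialize ih (by omega)
        have hv := hj (i + 1) hi
        simp only [runOf, Game.play] at hv ⊢
        have key : ∀ (c c' : (v : V) × G.Hist v) (w : {w // G.edge c.1 w})
            (w' : {w // G.edge c'.1 w}), c = c' → w.1 = w'.1 →
            (⟨w.1, Game.Hist.snoc c.2 w.2⟩ : (v : V) × G.Hist v) =
              ⟨w'.1, Game.Hist.snoc c'.2 w'.2⟩ := by
          rintro c _ ⟨w, hw⟩ ⟨w', hw'⟩ rfl rfl
          rfl
        exact key _ _ _ _ ih hv
    have key : ∀ (c c' : (v : V) × G.Hist v), c = c' → G.owner c.1 ≠ G.protagonist →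
        (G.profile (A.strategy n) t (G.owner c.1) c.1 c.2 rfl).1 =
        (G.profile (A.strategy n') t (G.owner c'.1) c'.1 c'.2 rfl).1 := by
      rintro c _ rfl hc
      rw [Game.profile_other _ _ _ hc, Game.profile_other _ _ _ hc]
    exact key _ _ (hplay j le_rfl) hown
  · rintro ⟨s, s', hs, hs', h0, h0', hc, hp⟩ hdom
    let r : ℕ → V := fun k => (s k).2
    let r' : ℕ → V := fun k => (s' k).2
    have hr : ∀ k, G.edge (r k) (r (k + 1)) := fun k => (hs k).1
    have hr' : ∀ k, G.edge (r' k) (r' (k + 1)) := fun k => (hs' k).1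
    -- The other players follow both paths as long as the history is a prefix of one of them.
    let t : G.CoStrategy := fun j _ v h _ =>
      if H : ∃ k, r k = v ∧ h.verts = (Game.Hist.along r hr k).verts then
        ⟨r (H.choose + 1), by
          have := hr H.choose
          rwa [H.choose_spec.1] at this⟩
      else if H : ∃ k, r' k = v ∧ h.verts = (Game.Hist.along r' hr' k).verts then
        ⟨r' (H.choose + 1), by
          have := hr' H.choose
          rwa [H.choose_spec.1] at this⟩
      else ⟨(G.exists_succ v).choose, (G.exists_succ v).choose_spec⟩
    have ht : ∀ j hj k hv, (t j hj (r k) (Game.Hist.along r hr k) hv).1 = r (k + 1) := by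
      intro j hj k hv
      have H : ∃ i, r i = r k ∧ (Game.Hist.along r hr k).verts = (Game.Hist.along r hr i).verts :=
        ⟨k, rfl, rfl⟩
      have hk : H.choose = k := by
        have := congrArg List.length H.choose_spec.2
        rw [Game.Hist.length_verts_along, Game.Hist.length_verts_along] at this
        omega
      simp only [t, dif_pos H, hk]
    have ht' : ∀ j hj k hv, (t j hj (r' k) (Game.Hist.along r' hr' k) hv).1 = r' (k + 1) := by
      intro j hj k hv
      by_cases H : ∃ i, r i = r' k ∧
        (Game.Hist.along r' hr' k).verts = (Game.Hist.along r hr i).verts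
      · have hk : H.choose = k := by
          have := congrArg List.length H.choose_spec.2
          rw [Game.Hist.length_verts_along, Game.Hist.length_verts_along] at this
          omega
        have hv' := H.choose_spec.2
        rw [hk] at hv'
        have hpre := (Game.Hist.verts_along_eq_iff _ _ _ _ _).1 hv'.symm
        have hown : G.owner (r k) ≠ G.protagonist := by
          rw [hpre k le_rfl, hv]; exact hj
        simp only [t, dif_pos H, hk]
        exact hc k hpre hown
      · have H' : ∃ i, r' i = r' k ∧
            (Game.Hist.along r' hr' k).verts = (Game.Hist.along r' hr' i).verts := ⟨k, rfl, rfl⟩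
        have hk : H'.choose = k := by
          have := congrArg List.length H'.choose_spec.2
          rw [Game.Hist.length_verts_along, Game.Hist.length_verts_along] at this
          omega
        simp only [t, dif_neg H, dif_pos H', hk]
    have out : ∀ (n : ℕ) (s : ℕ → (M × ℕ) × V) (hs : IsRun A.Round s), s 0 = ((A.start, n), G.init) →
        (∀ j hj k hv, (t j hj (s k).2 (Game.Hist.along (fun k => (s k).2) (fun k => (hs k).1) k)
          hv).1 = (s (k + 1)).2) →
        G.outcome (G.profile (A.strategy n) t) = fun k => (s k).2 := by
      intro n s hs h0 ht
      funext k
      rw [Game.outcome, Game.play_eq_along _ (fun k => (s k).2) (fun k => (hs k).1)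
        (congrArg Prod.snd h0)]
      intro k
      by_cases hown : G.owner (s k).2 = G.protagonist
      · rw [Game.profile_protagonist _ _ _ hown, strategy]
        have hm := (hs k).2.2 hown
        rw [← A.config_along hs (congrArg Prod.fst h0) k] at hm
        exact hm.symm
      · rw [Game.profile_other _ _ _ hown]
        exact ht _ hown k rfl
    have := hdom t
    rw [out n s hs h0 ht, out n' s' hs' h0' ht'] at this
    exact absurd hp (not_lt.2 this)

/-- Dominance is transitive, so consecutive counter values suffice. -/
theorem realizesChain_iff : A.RealizesChain ↔
    ∀ n, ¬ A.Separates ((A.start, n), G.init) ((A.start, n + 1), G.init) := by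
  simp only [← not_weaklyDominated_iff, not_not]
  constructor
  · exact fun h n => h n (n + 1) n.lt_succ_self
  · intro h k l hkl t
    exact monotone_nat_of_le_succ
      (f := fun n => G.payoff (G.outcome (G.profile (A.strategy n) t))) (fun n => h n t) hkl.le

end ParamAutomaton

open Relation

/-! ### Payoffs of infinite paths -/

namespace Game

variable {V P : Type} {G : Game V P}

theorem payoff_eq_of_endsIn {r : ℕ → V} {l : V} (hl : l ∈ G.leaves) (h : EndsIn r l) :
    G.payoff r = G.leafPayoff ⟨l, hl⟩ := by
  have H : ∃ l : G.leaves, EndsIn r l.1 := ⟨⟨l, hl⟩, h⟩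
  have huniq : H.choose = ⟨l, hl⟩ := by
    obtain ⟨N, hN⟩ := h
    obtain ⟨N', hN'⟩ := H.choose_spec
    exact Subtype.ext ((hN' (max N N') (le_max_right _ _)).symm.trans (hN _ (le_max_left _ _)))
  rw [payoff, dif_pos H, huniq]

theorem payoff_eq_zero {r : ℕ → V} (h : ¬ ∃ l : G.leaves, EndsIn r l.1) : G.payoff r = 0 := by
  rw [payoff, dif_neg h]

theorem endsIn_add_iff {r : ℕ → V} {l : V} (n : ℕ) : EndsIn (fun k => r (n + k)) l ↔ EndsIn r l := by
  constructor
  · rintro ⟨N, hN⟩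
    refine ⟨n + N, fun k hk => ?_⟩
    have := hN (k - n) (by omega)
    dsimp only at this
    rwa [show n + (k - n) = k by omega] at this
  · rintro ⟨N, hN⟩
    exact ⟨N, fun k hk => hN _ (by omega)⟩

theorem payoff_add (r : ℕ → V) (n : ℕ) : G.payoff (fun k => r (n + k)) = G.payoff r := by
  by_cases H : ∃ l : G.leaves, EndsIn r l.1
  · obtain ⟨l, hl⟩ := H
    rw [payoff_eq_of_endsIn l.2 hl, payoff_eq_of_endsIn l.2 ((endsIn_add_iff n).2 hl)]
  · rw [payoff_eq_zero H, payoff_eq_zero]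
    rintro ⟨l, hl⟩
    exact H ⟨l, (endsIn_add_iff n).1 hl⟩

theorem eq_of_leaf {r : ℕ → V} (hr : ∀ k, G.edge (r k) (r (k + 1))) {n : ℕ} (h : r n ∈ G.leaves)
    (k : ℕ) (hk : n ≤ k) : r k = r n := by
  induction k, hk using Nat.le_induction with
  | base => rfl
  | succ k _ ih =>
    have := hr k
    rw [ih] at this
    exact (G.leaf_edge _ h _).1 this

end Game

/-- Prepend an element to a sequence. -/
def consSeq {α : Type} (a : α) (s : ℕ → α) : ℕ → α
  | 0 => a
  | k + 1 => s k

theorem isRun_consSeq {α : Type} {R : α → α → Prop} {a : α} {s : ℕ → α} (hs : IsRun R s)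
    (h : R a (s 0)) : IsRun R (consSeq a s)
  | 0 => h
  | k + 1 => hs k

namespace ParamAutomaton

variable {V P M : Type} {G : Game V P} (A : ParamAutomaton G M)

theorem payoff_consSeq (c : (M × ℕ) × V) (s : ℕ → (M × ℕ) × V) :
    G.payoff (fun k => (consSeq c s k).2) = G.payoff fun k => (s k).2 := by
  rw [← Game.payoff_add _ 1]
  congr 1
  funext k
  rw [add_comm 1 k]
  rfl

/-! ### The automaton without its counter -/

/-- The possible moves at counter value `0` for `c = 0`, and at all positive counter values for `c =
1`: an automaton cannot distinguish those. -/
def Edge (c : ℕ) (x y : M × V) : Prop :=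
  G.edge x.2 y.2 ∧ y.1 = (A.update x.1 x.2 c).1 ∧
    ∀ h : G.owner x.2 = G.protagonist, y.2 = A.move x.1 ⟨x.2, h⟩ c

theorem update_snd_zero (m : M) (v : V) : (A.update m v 0).2 = 0 := by
  by_cases hm : m ∈ A.counterAccess
  · obtain ⟨m', h⟩ := A.update_zero m hm v
    rw [h]
  · obtain ⟨m', h⟩ := A.update_free m hm v
    rw [h]

open Classical in
theorem update_succ (m : M) (v : V) (c : ℕ) :
    A.update m v (c + 1) = ((A.update m v 1).1, if m ∈ A.counterAccess then c else c + 1) := by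
  by_cases hm : m ∈ A.counterAccess
  · obtain ⟨m', h⟩ := A.update_pos m hm v
    rw [h _ c.succ_pos, h 1 one_pos, if_pos hm]
    rfl
  · obtain ⟨m', h⟩ := A.update_free m hm v
    rw [h, h, if_neg hm]

theorem move_succ (m : M) (v : {v : V // G.owner v = G.protagonist}) (c : ℕ) :
    A.move m v (c + 1) = A.move m v 1 := by
  by_cases hm : m ∈ A.counterAccess
  · obtain ⟨v', h⟩ := A.move_pos m hm v
    rw [h _ c.succ_pos, h 1 one_pos]
  · obtain ⟨v', h⟩ := A.move_free m hm v
    rw [h, h]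

variable {A}

theorem round_zero_iff {m : M} {v : V} {d : (M × ℕ) × V} :
    A.Round ((m, 0), v) d ↔ A.Edge 0 (m, v) (d.1.1, d.2) ∧ d.1.2 = 0 := by
  rw [Round, Edge, Prod.ext_iff, A.update_snd_zero]
  tauto

open Classical in
theorem round_succ_iff {m : M} {v : V} {c : ℕ} {d : (M × ℕ) × V} :
    A.Round ((m, c + 1), v) d ↔
      A.Edge 1 (m, v) (d.1.1, d.2) ∧ d.1.2 = if m ∈ A.counterAccess then c else c + 1 := by
  rw [Round, Edge, Prod.ext_iff, A.update_succ]
  simp only [A.move_succ]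
  tauto

theorem edge_free {m : M} (hm : m ∉ A.counterAccess) {v : V} {y : M × V} :
    A.Edge 0 (m, v) y ↔ A.Edge 1 (m, v) y := by
  obtain ⟨m', h⟩ := A.update_free m hm v
  rw [Edge, Edge, h 0, h 1]
  refine and_congr_right fun _ => and_congr_right fun _ => forall_congr' fun hv => ?_
  obtain ⟨v', h'⟩ := A.move_free m hm ⟨v, hv⟩
  rw [h', h']

theorem Edge.fst_eq {c : ℕ} {x y z : M × V} (h : A.Edge c x y) (h' : A.Edge c x z) : y.1 = z.1 :=
  h.2.1.trans h'.2.1.symm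

theorem Edge.snd_eq {c : ℕ} {x y z : M × V} (h : A.Edge c x y) (h' : A.Edge c x z)
    (hx : G.owner x.2 = G.protagonist) : y.2 = z.2 :=
  (h.2.2 hx).trans (h'.2.2 hx).symm

variable (A)

theorem exists_edge (c : ℕ) (x : M × V) : ∃ y, A.Edge c x y := by
  by_cases h : G.owner x.2 = G.protagonist
  · exact ⟨(_, A.move x.1 ⟨x.2, h⟩ c), A.move_edge x.1 ⟨x.2, h⟩ c, rfl, fun _ => rfl⟩
  · obtain ⟨w, hw⟩ := G.exists_succ x.2
    exact ⟨(_, w), hw, rfl, fun h' => absurd h' h⟩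

/-- The payoff `z` is possible from `x` at counter value `0`. -/
def Attains (x : M × V) (z : ℤ) : Prop :=
  ∃ s, IsRun (A.Edge 0) s ∧ s 0 = x ∧ G.payoff (fun k => (s k).2) = z

variable {A}

/-- A set in which every element has a successor supports an infinite run. -/
theorem _root_.SafetyReach.exists_isRun {α : Type} {R : α → α → Prop} (p : α → Prop)
    (h : ∀ a, p a → ∃ b, R a b ∧ p b) {a : α} (ha : p a) :
    ∃ s, IsRun R s ∧ s 0 = a ∧ ∀ k, p (s k) := by
  choose f hf using h
  let s : ℕ → {a // p a} := fun k => (fun b => ⟨f b.1 b.2, (hf b.1 b.2).2⟩)^[k] ⟨a, ha⟩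
  refine ⟨fun k => (s k).1, fun k => ?_, rfl, fun k => (s k).2⟩
  simp only [s, Function.iterate_succ_apply']
  exact (hf _ _).1

theorem Attains.cons {x y : M × V} {z : ℤ} (h : A.Edge 0 x y) (hy : A.Attains y z) :
    A.Attains x z := by
  obtain ⟨s, hs, rfl, rfl⟩ := hy
  refine ⟨consSeq x s, isRun_consSeq hs h, rfl, ?_⟩
  rw [← Game.payoff_add _ 1]
  congr 1
  funext k
  rw [add_comm 1 k]
  rfl

theorem attains_leaf (x : M × V) (hx : x.2 ∈ G.leaves) : A.Attains x (G.leafPayoff ⟨x.2, hx⟩) := by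
  obtain ⟨s, hs, rfl, -⟩ := exists_isRun (R := A.Edge 0) (fun _ => True)
    (fun a _ => (A.exists_edge 0 a).imp fun _ h => ⟨h, trivial⟩) (a := x) trivial
  refine ⟨s, hs, rfl, Game.payoff_eq_of_endsIn hx ⟨0, ?_⟩⟩
  exact Game.eq_of_leaf (r := fun k => (s k).2) (fun k => (hs k).1) hx

/-- A cycle outside the leaves makes the payoff `0` possible. -/
theorem attains_zero {x y : M × V} (hx : x.2 ∉ G.leaves) (h : A.Edge 0 x y)
    (hy : ReflTransGen (A.Edge 0) y x) : A.Attains x 0 := by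
  have leaf : ∀ {a b : M × V}, ReflTransGen (A.Edge 0) a b → a.2 ∈ G.leaves → b.2 = a.2 := by
    intro a b hab ha
    induction hab with
    | refl => rfl
    | tail _ he ih =>
      have := he.1
      rw [ih] at this
      exact (G.leaf_edge _ ha _).1 this
  -- The run stays in the set of all elements from which `x` is reachable.
  obtain ⟨s, hs, rfl, hp⟩ := exists_isRun (R := A.Edge 0)
    (fun a => ReflTransGen (A.Edge 0) a x) (fun a ha => by
      rcases ha.cases_head with rfl | ⟨b, hb, hbx⟩
      exacts [⟨y, h, hy⟩, ⟨b, hb, hbx⟩]) (ReflTransGen.refl (a := x))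
  refine ⟨s, hs, rfl, Game.payoff_eq_zero ?_⟩
  rintro ⟨l, N, hN⟩
  have hl : (s N).2 ∈ G.leaves := Set.mem_of_eq_of_mem (hN N le_rfl) l.2
  exact hx (leaf (hp N) hl ▸ hl)

/-- The possible payoffs at counter value `0`: those of the reachable leaves, and `0` if a cycle
outside the leaves is reachable. -/
theorem Attains.exists_leaf_or_cycle [Finite M] [Finite V] {x : M × V} {z : ℤ} (h : A.Attains x z) :
    (∃ (y : M × V) (hy : y.2 ∈ G.leaves), ReflTransGen (A.Edge 0) x y ∧ z = G.leafPayoff ⟨y.2, hy⟩) ∨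
    (z = 0 ∧ ∃ y : M × V, y.2 ∉ G.leaves ∧ ReflTransGen (A.Edge 0) x y ∧
      TransGen (A.Edge 0) y y) := by
  obtain ⟨s, hs, rfl, rfl⟩ := h
  have reach : ∀ i j, ReflTransGen (A.Edge 0) (s i) (s (i + j)) := by
    intro i j
    induction j with
    | zero => exact .refl
    | succ j ih => exact ih.tail (hs _)
  by_cases H : ∃ k, (s k).2 ∈ G.leaves
  · obtain ⟨k, hk⟩ := H
    refine .inl ⟨s k, hk, by simpa using reach 0 k, Game.payoff_eq_of_endsIn hk ⟨k, ?_⟩⟩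
    exact Game.eq_of_leaf (r := fun k => (s k).2) (fun k => (hs k).1) hk
  · push Not at H
    refine .inr ⟨Game.payoff_eq_zero ?_, ?_⟩
    · rintro ⟨l, N, hN⟩
      exact H N (Set.mem_of_eq_of_mem (hN N le_rfl) l.2)
    · obtain ⟨i, j, hij, he⟩ := Finite.exists_ne_map_eq_of_infinite s
      wlog hlt : i < j generalizing i j
      · exact this j i hij.symm he.symm (by omega)
      refine ⟨s i, H i, by simpa using reach 0 i, ?_⟩
      have := TransGen.head' (hs i) (reach (i + 1) (j - (i + 1)))
      rwa [show i + 1 + (j - (i + 1)) = j by omega, ← he] at this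

theorem Attains.exists_run {x : M × V} {z : ℤ} (h : A.Attains x z) :
    ∃ s, IsRun A.Round s ∧ s 0 = ((x.1, 0), x.2) ∧ G.payoff (fun k => (s k).2) = z := by
  obtain ⟨s, hs, rfl, rfl⟩ := h
  exact ⟨fun k => (((s k).1, 0), (s k).2), fun k => round_zero_iff.2 ⟨hs k, rfl⟩, rfl, rfl⟩

/-- Prepend one round to two runs, which need to be coupled only if that round does not separate
them. -/
theorem separates_cons {c c' : (M × ℕ) × V} {s s' : ℕ → (M × ℕ) × V} (hs : IsRun A.Round s)
    (hs' : IsRun A.Round s') (h : A.Round c (s 0)) (h' : A.Round c' (s' 0))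
    (hown : G.owner c.2 ≠ G.protagonist → (s 0).2 = (s' 0).2)
    (hc : (s 0).2 = (s' 0).2 → Coupled G (fun k => (s k).2) (fun k => (s' k).2))
    (hp : G.payoff (fun k => (s' k).2) < G.payoff (fun k => (s k).2)) : A.Separates c c' := by
  refine ⟨consSeq c s, consSeq c' s', isRun_consSeq hs h, isRun_consSeq hs' h', rfl, rfl, ?_, ?_⟩
  · intro j hj ho
    cases j with
    | zero => exact hown ho
    | succ j =>
      refine hc (hj 1 (by omega)) j (fun i hi => hj (i + 1) (by omega)) ho
  · rwa [payoff_consSeq, payoff_consSeq]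

theorem Separates.cons {c c' d d' : (M × ℕ) × V} (H : A.Separates d d')
    (h : A.Round c d) (h' : A.Round c' d') (hd : d.2 = d'.2) : A.Separates c c' := by
  obtain ⟨s, s', hs, hs', rfl, rfl, hc, hp⟩ := H
  exact separates_cons hs hs' h h' (fun _ => hd) (fun _ => hc) hp

theorem separates_of_attains {c c' : (M × ℕ) × V} {x y : M × V} {z z' : ℤ}
    (h : A.Round c ((x.1, 0), x.2)) (h' : A.Round c' ((y.1, 0), y.2))
    (hown : G.owner c.2 = G.protagonist) (hne : x.2 ≠ y.2) (hx : A.Attains x z)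
    (hy : A.Attains y z') (hz : z' < z) : A.Separates c c' := by
  obtain ⟨s, hs, h0, rfl⟩ := hx.exists_run
  obtain ⟨s', hs', h0', rfl⟩ := hy.exists_run
  refine separates_cons hs hs' (h0 ▸ h) (h0' ▸ h') (fun ho => absurd hown ho) (fun he => ?_) hz
  rw [h0, h0'] at he
  exact absurd he hne

/-! ### The graph of counterexamples -/

/-- The nodes of a finite graph that traces pairs of plays for consecutive counter values. `before`:
the counter values are positive, or have not been tested at `0`; both plays are in the same state.
`tied`: both counters are `0`, the memory states differ, but the histories still coincide. `split`:
the histories have separated. `loop p x`: from `x`, a way back to `p` is sought. -/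
inductive Node (M V : Type)
  | before (x : M × V)
  | tied (a b : M) (v : V)
  | split (x y : M × V)
  | loop (p x : M × V)

/-- The edges of the graph of counterexamples. Two plays in the same state have counter values that
differ by one, and they part at a counter-access state in which these values are `0` and `1`. After
a separation of the histories the plays are independent of each other, so they move one at a time.
-/
inductive Trace (A : ParamAutomaton G M) : Node M V → Node M V → Prop
  | before {x y} : A.Edge 1 x y → Trace A (.before x) (.before y)
  | beforeTied {x a b w} : x.1 ∈ A.counterAccess → A.Edge 0 x (a, w) → A.Edge 1 x (b, w) →
      Trace A (.before x) (.tied a b w)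
  | beforeSplit {x y z} : x.1 ∈ A.counterAccess → G.owner x.2 = G.protagonist → A.Edge 0 x y →
      A.Edge 1 x z → y.2 ≠ z.2 → Trace A (.before x) (.split y z)
  | tied {a b v a' b' w} : A.Edge 0 (a, v) (a', w) → A.Edge 0 (b, v) (b', w) →
      Trace A (.tied a b v) (.tied a' b' w)
  | tiedSplit {a b v y z} : G.owner v = G.protagonist → A.Edge 0 (a, v) y → A.Edge 0 (b, v) z →
      y.2 ≠ z.2 → Trace A (.tied a b v) (.split y z)
  | splitLeft {x x' y} : A.Edge 0 x x' → Trace A (.split x y) (.split x' y)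
  | splitRight {x y y'} : A.Edge 0 y y' → Trace A (.split x y) (.split x y')
  | loopLeft {x y z} (hy : y.2 ∈ G.leaves) : x.2 ∉ G.leaves → G.leafPayoff ⟨y.2, hy⟩ < 0 →
      A.Edge 0 x z → Trace A (.split x y) (.loop x z)
  | loopRight {x y z} (hx : x.2 ∈ G.leaves) : y.2 ∉ G.leaves → 0 < G.leafPayoff ⟨x.2, hx⟩ →
      A.Edge 0 y z → Trace A (.split x y) (.loop y z)
  | loop {p x y} : A.Edge 0 x y → Trace A (.loop p x) (.loop p y)

/-- The nodes at which the payoffs of the two plays are found to be in the wrong order: at two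
leaves, or if one play is at a leaf and the other one can avoid all leaves by a cycle. -/
inductive Bad (A : ParamAutomaton G M) : Node M V → Prop
  | split {x y} (hx : x.2 ∈ G.leaves) (hy : y.2 ∈ G.leaves) :
      G.leafPayoff ⟨y.2, hy⟩ < G.leafPayoff ⟨x.2, hx⟩ → Bad A (.split x y)
  | loop {p} : Bad A (.loop p p)

/-- What a node of the graph of counterexamples says about runs if a bad node is reachable from it.
-/
def Meaning (A : ParamAutomaton G M) : Node M V → Prop
  | .before x => ∃ c, A.Separates ((x.1, c), x.2) ((x.1, c + 1), x.2)
  | .tied a b v => A.Separates ((a, 0), v) ((b, 0), v)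
  | .split x y => ∃ z z', A.Attains x z ∧ A.Attains y z' ∧ z' < z
  | .loop p x => ReflTransGen (A.Edge 0) x p

theorem Trace.meaning {s t : Node M V} (h : Trace A s t) (ht : Meaning A t) : Meaning A s := by
  classical
  cases h with
  | @before x y h =>
    obtain ⟨c, hc⟩ := ht
    by_cases hx : x.1 ∈ A.counterAccess
    · exact ⟨c + 1, hc.cons (round_succ_iff.2 ⟨h, by simp [hx]⟩)
        (round_succ_iff.2 ⟨h, by simp [hx]⟩) rfl⟩
    · refine ⟨c, hc.cons ?_ (round_succ_iff.2 ⟨h, by simp [hx]⟩) rfl⟩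
      cases c with
      | zero => exact round_zero_iff.2 ⟨(edge_free hx).2 h, rfl⟩
      | succ c => exact round_succ_iff.2 ⟨h, by simp [hx]⟩
  | @beforeTied x a b w hx h₀ h₁ =>
    exact ⟨0, Separates.cons ht (round_zero_iff.2 ⟨h₀, rfl⟩)
      (round_succ_iff.2 ⟨h₁, by simp [hx]⟩) rfl⟩
  | @beforeSplit x y z hx ho h₀ h₁ hne =>
    obtain ⟨_, _, hy, hz, hlt⟩ := ht
    exact ⟨0, separates_of_attains (round_zero_iff.2 ⟨h₀, rfl⟩)
      (round_succ_iff.2 ⟨h₁, by simp [hx]⟩) ho hne hy hz hlt⟩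
  | tied h₀ h₁ =>
    exact Separates.cons ht (round_zero_iff.2 ⟨h₀, rfl⟩) (round_zero_iff.2 ⟨h₁, rfl⟩) rfl
  | tiedSplit ho h₀ h₁ hne =>
    obtain ⟨_, _, hy, hz, hlt⟩ := ht
    exact separates_of_attains (round_zero_iff.2 ⟨h₀, rfl⟩) (round_zero_iff.2 ⟨h₁, rfl⟩) ho hne
      hy hz hlt
  | splitLeft h =>
    obtain ⟨z, z', hx, hy, hlt⟩ := ht
    exact ⟨z, z', hx.cons h, hy, hlt⟩
  | splitRight h =>
    obtain ⟨z, z', hx, hy, hlt⟩ := ht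
    exact ⟨z, z', hx, hy.cons h, hlt⟩
  | loopLeft hy hx hlt h => exact ⟨0, _, attains_zero hx h ht, attains_leaf _ hy, hlt⟩
  | loopRight hx hy hlt h => exact ⟨_, 0, attains_leaf _ hx, attains_zero hy h ht, hlt⟩
  | loop h => exact ReflTransGen.head h ht

theorem Bad.meaning {t : Node M V} (h : Bad A t) : Meaning A t := by
  cases h with
  | split hx hy hlt => exact ⟨_, _, attains_leaf _ hx, attains_leaf _ hy, hlt⟩
  | loop => exact .refl

theorem trace_split {x x' y y' : M × V} (hx : ReflTransGen (A.Edge 0) x x')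
    (hy : ReflTransGen (A.Edge 0) y y') : ReflTransGen (Trace A) (.split x y) (.split x' y') :=
  (hx.lift (fun x => Node.split x y) fun _ _ h => .splitLeft h).trans
    (hy.lift (fun y => Node.split x' y) fun _ _ h => .splitRight h)

theorem trace_loop {p x y : M × V} (h : ReflTransGen (A.Edge 0) x y) :
    ReflTransGen (Trace A) (.loop p x) (.loop p y) :=
  h.lift (fun x => Node.loop p x) fun _ _ h => .loop h

/-- Once the plays have separated, payoffs in the wrong order lead to a bad node. -/
theorem exists_bad_of_attains [Finite M] [Finite V] {x y : M × V} {z z' : ℤ} (hx : A.Attains x z)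
    (hy : A.Attains y z') (hlt : z' < z) : ∃ t, ReflTransGen (Trace A) (.split x y) t ∧ Bad A t := by
  rcases hx.exists_leaf_or_cycle with ⟨x', hx', hr, rfl⟩ | ⟨rfl, x', hx', hr, hcyc⟩ <;>
    rcases hy.exists_leaf_or_cycle with ⟨y', hy', hr', rfl⟩ | ⟨rfl, y', hy', hr', hcyc'⟩
  · exact ⟨_, trace_split hr hr', .split hx' hy' hlt⟩
  · obtain ⟨w, hw, hwy⟩ := TransGen.head'_iff.1 hcyc'
    exact ⟨_, ((trace_split hr hr').tail (.loopRight hx' hy' hlt hw)).trans (trace_loop hwy), .loop⟩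
  · obtain ⟨w, hw, hwx⟩ := TransGen.head'_iff.1 hcyc
    exact ⟨_, ((trace_split hr hr').tail (.loopLeft hy' hx' hlt hw)).trans (trace_loop hwx), .loop⟩
  · exact absurd hlt (lt_irrefl _)

/-- A run has counter value `0` from the first position with that value on. -/
theorem attains_of_isRun {s : ℕ → (M × ℕ) × V} (hs : IsRun A.Round s) {n : ℕ} (h0 : (s n).1.2 = 0) :
    A.Attains ((s n).1.1, (s n).2) (G.payoff fun k => (s k).2) := by
  have hz : ∀ k, (s (n + k)).1.2 = 0 ∧
      A.Edge 0 ((s (n + k)).1.1, (s (n + k)).2) ((s (n + (k + 1))).1.1, (s (n + (k + 1))).2) := by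
    intro k
    have step : ∀ k, (s (n + k)).1.2 = 0 →
        A.Edge 0 ((s (n + k)).1.1, (s (n + k)).2) ((s (n + (k + 1))).1.1, (s (n + (k + 1))).2) ∧
          (s (n + (k + 1))).1.2 = 0 := by
      intro k hk
      have := hs (n + k)
      rw [show s (n + k) = (((s (n + k)).1.1, 0), (s (n + k)).2) by rw [← hk]] at this
      exact round_zero_iff.1 this
    induction k with
    | zero => exact ⟨h0, (step 0 h0).1⟩
    | succ k ih =>
      have := (step k ih.1).2
      exact ⟨this, (step (k + 1) this).1⟩
  exact ⟨fun k => ((s (n + k)).1.1, (s (n + k)).2), fun k => (hz k).2, rfl,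
    Game.payoff_add (fun k => (s k).2) n⟩

/-- Coupled runs with payoffs in the wrong order are traced until they separate, and from there on
they are replaced by a path to a bad node. -/
theorem exists_bad_of_separates [Finite M] [Finite V] {m : M} {n : ℕ} {v : V}
    (h : A.Separates ((m, n), v) ((m, n + 1), v)) :
    ∃ t, ReflTransGen (Trace A) (.before (m, v)) t ∧ Bad A t := by
  classical
  obtain ⟨s, s', hs, hs', h0, h0', hc, hp⟩ := h
  have hex : ∃ j, (s (j + 1)).2 ≠ (s' (j + 1)).2 := by
    by_contra H
    push Not at H
    have : (fun k => (s k).2) = fun k => (s' k).2 := by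
      funext k
      cases k with
      | zero => rw [h0, h0']
      | succ k => exact H k
    rw [this] at hp
    exact lt_irrefl _ hp
  obtain ⟨j, hj, hmin⟩ : ∃ j, (s (j + 1)).2 ≠ (s' (j + 1)).2 ∧ ∀ i ≤ j, (s i).2 = (s' i).2 := by
    refine ⟨Nat.find hex, Nat.find_spec hex, fun i hi => ?_⟩
    cases i with
    | zero => rw [h0, h0']
    | succ i => exact not_not.1 (Nat.find_min hex (by omega))
  -- Up to the separation, the counters differ by one or are both zero.
  have inv : ∀ i ≤ j,
      (∃ a c, s i = ((a, c), (s i).2) ∧ s' i = ((a, c + 1), (s i).2) ∧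
        ReflTransGen (Trace A) (.before (m, v)) (.before (a, (s i).2))) ∨
      (∃ a b, s i = ((a, 0), (s i).2) ∧ s' i = ((b, 0), (s i).2) ∧
        ReflTransGen (Trace A) (.before (m, v)) (.tied a b (s i).2)) := by
    intro i
    induction i with
    | zero =>
      intro _
      rw [h0, h0']
      exact .inl ⟨m, n, rfl, rfl, .refl⟩
    | succ i ih =>
      intro hi
      have hv := hmin (i + 1) hi
      have hr := hs i
      have hr' := hs' i
      rcases ih (by omega) with ⟨a, c, h₁, h₂, ht⟩ | ⟨a, b, h₁, h₂, ht⟩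
      · rw [h₂, round_succ_iff] at hr'
        by_cases ha : a ∈ A.counterAccess
        · rcases c with _ | c
          · rw [h₁, round_zero_iff] at hr
            refine .inr ⟨(s (i + 1)).1.1, (s' (i + 1)).1.1, ?_, ?_, ht.tail (.beforeTied ha hr.1 ?_)⟩
            · rw [← hr.2]
            · rw [hv]
              refine Prod.ext (Prod.ext rfl ?_) rfl
              simpa [ha] using hr'.2
            · rw [hv]; exact hr'.1
          · rw [h₁, round_succ_iff] at hr
            refine .inl ⟨(s (i + 1)).1.1, c, ?_, ?_, ht.tail (.before hr.1)⟩
            · refine Prod.ext (Prod.ext rfl ?_) rfl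
              simpa [ha] using hr.2
            · refine Prod.ext (Prod.ext (hr'.1.fst_eq hr.1) ?_) hv.symm
              simpa [ha] using hr'.2
        · have hr₁ : A.Edge 1 (a, (s i).2) ((s (i + 1)).1.1, (s (i + 1)).2) ∧
              (s (i + 1)).1.2 = c := by
            rcases c with _ | c
            · rw [h₁, round_zero_iff] at hr
              exact ⟨(edge_free ha).1 hr.1, hr.2⟩
            · rw [h₁, round_succ_iff, if_neg ha] at hr
              exact hr
          refine .inl ⟨(s (i + 1)).1.1, c, ?_, ?_, ht.tail (.before hr₁.1)⟩
          · rw [← hr₁.2]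
          · refine Prod.ext (Prod.ext (hr'.1.fst_eq hr₁.1) ?_) hv.symm
            simpa [ha] using hr'.2
      · rw [h₁, round_zero_iff] at hr
        rw [h₂, round_zero_iff] at hr'
        refine .inr ⟨(s (i + 1)).1.1, (s' (i + 1)).1.1, ?_, ?_, ht.tail (.tied hr.1 ?_)⟩
        · rw [← hr.2]
        · rw [hv, ← hr'.2]
        · rw [hv]; exact hr'.1
  have hown : G.owner (s j).2 = G.protagonist := by
    by_contra ho
    exact hj (hc j hmin ho)
  have hr := hs j
  have hr' := hs' j
  obtain ⟨ht, hz, hz'⟩ : ReflTransGen (Trace A) (.before (m, v))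
      (.split ((s (j + 1)).1.1, (s (j + 1)).2) ((s' (j + 1)).1.1, (s' (j + 1)).2)) ∧
      (s (j + 1)).1.2 = 0 ∧ (s' (j + 1)).1.2 = 0 := by
    rcases inv j le_rfl with ⟨a, c, h₁, h₂, ht⟩ | ⟨a, b, h₁, h₂, ht⟩
    · rw [h₂, round_succ_iff] at hr'
      by_cases ha : a ∈ A.counterAccess ∧ c = 0
      · obtain ⟨ha, rfl⟩ := ha
        rw [h₁, round_zero_iff] at hr
        exact ⟨ht.tail (.beforeSplit ha hown hr.1 hr'.1 hj), hr.2, by simpa [ha] using hr'.2⟩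
      · refine absurd (Edge.snd_eq (y := ((s (j + 1)).1.1, (s (j + 1)).2)) ?_ hr'.1 hown) hj
        rcases c with _ | c
        · rw [h₁, round_zero_iff, edge_free (by simpa using ha)] at hr
          exact hr.1
        · rw [h₁, round_succ_iff] at hr
          exact hr.1
    · rw [h₁, round_zero_iff] at hr
      rw [h₂, round_zero_iff] at hr'
      exact ⟨ht.tail (.tiedSplit hown hr.1 hr'.1 hj), hr.2, hr'.2⟩
  obtain ⟨t, ht', hb⟩ := exists_bad_of_attains (attains_of_isRun hs hz) (attains_of_isRun hs' hz') hp
  exact ⟨t, ht.trans ht', hb⟩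

/-- The automaton fails to realize a chain if and only if a bad node is reachable in the graph of
counterexamples. -/
theorem not_realizesChain_iff [Finite M] [Finite V] : ¬ A.RealizesChain ↔
    ∃ t, ReflTransGen (Trace A) (.before (A.start, G.init)) t ∧ Bad A t := by
  rw [realizesChain_iff]
  push Not
  constructor
  · rintro ⟨n, h⟩
    exact exists_bad_of_separates h
  · rintro ⟨t, ht, hb⟩
    have : Meaning A (.before (A.start, G.init)) := by
      generalize Node.before (A.start, G.init) = s at ht
      induction ht using ReflTransGen.head_induction_on with
      | refl => exact hb.meaning
      | head h _ ih => exact h.meaning ih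
    exact this

end ParamAutomaton

/-! ### Looking up words in the encoding -/

section
variable {α β : Type} {d : α}

theorem getD_flatMap_append (f : β → List α) (b : ℕ) (vs : List β) (hb : ∀ v ∈ vs, (f v).length = b)
    (L : List α) (k i : ℕ) (hk : k < vs.length) (hi : i < b) :
    (vs.flatMap f ++ L).getD (k * b + i) d = (f vs[k]).getD i d := by
  induction vs generalizing k with
  | nil => simp at hk
  | cons v vs ih =>
    have hv := hb v (by simp)
    rw [List.flatMap_cons, List.append_assoc]
    cases k with
    | zero => rw [List.getD_append _ _ _ _ (by omega)]; simp
    | succ k =>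
      rw [List.getD_append_right _ _ _ _ (by rw [hv, add_mul]; omega), hv,
        show (k + 1) * b + i - b = k * b + i by rw [add_mul]; omega]
      exact ih (fun w hw => hb w (by simp [hw])) k (by simpa using hk)

theorem getD_flatMap_append_add (f : β → List α) (b : ℕ) (vs : List β)
    (hb : ∀ v ∈ vs, (f v).length = b) (L : List α) (i : ℕ) :
    (vs.flatMap f ++ L).getD (vs.length * b + i) d = L.getD i d := by
  have : (vs.flatMap f).length = vs.length * b := by
    rw [List.length_flatMap, List.map_congr_left hb]
    simp
  rw [List.getD_append_right _ _ _ _ (by omega), this, Nat.add_sub_cancel_left]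

theorem getD_finRange_flatMap {n : ℕ} (f : Fin n → List α) (b : ℕ) (hb : ∀ v, (f v).length = b)
    (L : List α) (v : Fin n) (i : ℕ) (hi : i < b) :
    ((List.finRange n).flatMap f ++ L).getD (v * b + i) d = (f v).getD i d := by
  rw [getD_flatMap_append f b _ (fun v _ => hb v) L v i (by simp) hi]
  simp

theorem getD_finRange_flatMap_add {n : ℕ} (f : Fin n → List α) (b : ℕ) (hb : ∀ v, (f v).length = b)
    (L : List α) (i : ℕ) :
    ((List.finRange n).flatMap f ++ L).getD (n * b + i) d = L.getD i d := by
  have := getD_flatMap_append_add (d := d) f b (List.finRange n) (fun v _ => hb v) L i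
  rwa [List.length_finRange] at this

theorem getD_finRange_map {n : ℕ} (f : Fin n → α) (L : List α) (v : Fin n) :
    ((List.finRange n).map f ++ L).getD v d = f v := by
  rw [List.getD_append _ _ _ _ (by simp)]
  simp

theorem getD_finRange_map_add {n : ℕ} (f : Fin n → α) (L : List α) (i : ℕ) :
    ((List.finRange n).map f ++ L).getD (n + i) d = L.getD i d := by
  rw [List.getD_append_right _ _ _ _ (by simp)]
  simp

end

theorem bitAt_word (w : List Bool) (L : List Letter) (i j : ℕ) :
    bitAt (w.map some ++ none :: L) i j = if i = 0 then w.getD j false else bitAt L (i - 1) j := by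
  induction w generalizing j with
  | nil => cases i <;> simp [bitAt]
  | cons a w ih =>
    rcases i with _ | i
    · rcases j with _ | j
      · simp [bitAt]
      · simpa [bitAt] using ih j
    · simpa [bitAt] using ih j

/-- The letters `none` separate the words, so that words and their bits can be looked up. -/
theorem bitAt_flatMap (ws : List (List Bool)) (i j : ℕ) :
    bitAt (ws.flatMap fun w => w.map some ++ [none]) i j = (ws.getD i []).getD j false := by
  induction ws generalizing i with
  | nil => simp [bitAt]
  | cons w ws ih =>
    rw [List.flatMap_cons, List.append_assoc, List.singleton_append, bitAt_word]
    cases i <;> simp [ih]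

theorem lt_length_of_bitAt {l : List Letter} {i j : ℕ} (h : bitAt l i j = true) : j < l.length := by
  fun_induction bitAt l i j with
  | case1 => simp at h
  | case2 => simp at h
  | case4 => simp
  | _ => simp_all; try omega

theorem length_getD_lt (ws : List (List Bool)) (i : ℕ) (hi : i < ws.length) :
    (ws.getD i []).length < (ws.flatMap fun w => w.map some ++ [none]).length := by
  induction ws generalizing i with
  | nil => simp at hi
  | cons w ws ih =>
    rw [List.flatMap_cons, List.length_append]
    cases i with
    | zero => simp; omega
    | succ i =>
      have := ih i (by simpa using hi)
      rw [List.getD_cons_succ]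
      omega

theorem natWord_getD (k j : ℕ) : (natWord k).getD j false = decide (j < k) := by
  have : natWord k = List.replicate k true := by
    induction k with
    | zero => rfl
    | succ k ih => exact congrArg (true :: ·) ih
  rw [this]
  by_cases h : j < k
  · simp [h]
  · simp [h, List.getD_eq_getElem?_getD]

theorem length_natWord (k : ℕ) : (natWord k).length = k :=
  Computability.unary_decode_encode_nat k

theorem encodePosNum_getD (p : PosNum) (j : ℕ) :
    (Computability.encodePosNum p).getD j false = (p : ℕ).testBit j := by
  induction p generalizing j with
  | one => cases j <;> simp [Computability.encodePosNum, Nat.testBit_succ]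
  | bit0 p ih =>
    rw [PosNum.cast_bit0, ← two_mul]
    cases j with
    | zero => simp [Computability.encodePosNum]
    | succ j => simpa [Computability.encodePosNum, Nat.testBit_succ] using ih j
  | bit1 p ih =>
    rw [PosNum.cast_bit1, ← two_mul]
    cases j with
    | zero => simp [Computability.encodePosNum]
    | succ j =>
      have : (2 * (p : ℕ) + 1) / 2 = p := by omega
      simpa [Computability.encodePosNum, Nat.testBit_succ, this] using ih j

theorem encodeNat_getD (n j : ℕ) : (Computability.encodeNat n).getD j false = n.testBit j := by
  conv_rhs => rw [← Num.to_of_nat n]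
  rw [Computability.encodeNat]
  cases (n : Num) with
  | zero => simp [Computability.encodeNum]
  | pos p => simpa [Computability.encodeNum] using encodePosNum_getD p j

namespace Input

variable (x : Input)

/-- The vertices of the game of an input. -/
abbrev Vtx : Type := Fin x.numVertices

/-- The memory states of the automaton of an input. -/
abbrev Mst : Type := Fin x.numStates

theorem bitAt_encode (i j : ℕ) : bitAt x.encode i j = (x.words.getD i []).getD j false :=
  bitAt_flatMap _ _ _

open Classical in
/-- The payoff of a leaf, and `0` at the other vertices. -/
noncomputable def pay (v : x.Vtx) : ℤ :=
  if h : v ∈ x.game.leaves then x.game.leafPayoff ⟨v, h⟩ else 0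

theorem word_numVertices : x.words.getD 0 [] = natWord x.numVertices := by
  simp [words]
theorem word_numStates : x.words.getD 2 [] = natWord x.numStates := by
  simp [words]
theorem word_protagonist : x.words.getD 3 [] = natWord x.game.protagonist := by
  simp [words]
theorem word_init : x.words.getD 4 [] = natWord x.game.init := by
  simp [words]
theorem word_start : x.words.getD 5 [] = natWord x.automaton.start := by
  simp [words]

theorem getD_six_add {α : Type} (a b c d e f : α) (L : List α) (i : ℕ) (z : α) :
    ([a, b, c, d, e, f] ++ L).getD (6 + i) z = L.getD i z := by
  rw [List.getD_append_right _ _ _ _ (by simp)]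
  simp

theorem word_owner (v : x.Vtx) : x.words.getD (6 + v) [] = natWord (x.game.owner v) := by
  simp only [words, List.append_assoc]
  rw [getD_six_add, getD_finRange_map]

open Classical in
theorem word_leaf (v : x.Vtx) :
    x.words.getD (6 + (x.numVertices + v)) [] = [decide (v ∈ x.game.leaves)] := by
  simp only [words, List.append_assoc]
  rw [getD_six_add, getD_finRange_map_add, getD_finRange_map]

open Classical in
theorem word_pay (v : x.Vtx) :
    x.words.getD (6 + (x.numVertices + (x.numVertices + v))) [] =
      if h : v ∈ x.game.leaves then intWord (x.game.leafPayoff ⟨v, h⟩) else [] := by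
  simp only [words, List.append_assoc]
  rw [getD_six_add, getD_finRange_map_add, getD_finRange_map_add, getD_finRange_map]

open Classical in
theorem word_edge (v w : x.Vtx) :
    x.words.getD (6 + (x.numVertices + (x.numVertices + (x.numVertices +
      (v * x.numVertices + w))))) [] = [decide (x.game.edge v w)] := by
  simp only [words, List.append_assoc]
  rw [getD_six_add, getD_finRange_map_add, getD_finRange_map_add, getD_finRange_map_add,
    getD_finRange_flatMap _ _ (by simp) _ _ _ w.2]
  simp

open Classical in
theorem word_counterAccess (m : x.Mst) :
    x.words.getD (6 + (x.numVertices + (x.numVertices + (x.numVertices +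
      (x.numVertices * x.numVertices + m))))) [] = [decide (m ∈ x.automaton.counterAccess)] := by
  simp only [words, List.append_assoc]
  rw [getD_six_add, getD_finRange_map_add, getD_finRange_map_add, getD_finRange_map_add,
    getD_finRange_flatMap_add _ _ (by simp), getD_finRange_map]

open Classical in
theorem word_table (m : x.Mst) (v : x.Vtx) (i : ℕ) (hi : i < 4) :
    x.words.getD (6 + (x.numVertices + (x.numVertices + (x.numVertices +
      (x.numVertices * x.numVertices + (x.numStates +
        (m * (x.numVertices * 4) + (v * 4 + i)))))))) [] =
      [natWord (x.automaton.update m v 0).1, natWord (x.automaton.update m v 1).1,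
        if h : x.game.owner v = x.game.protagonist then natWord (x.automaton.move m ⟨v, h⟩ 0) else [],
        if h : x.game.owner v = x.game.protagonist then natWord (x.automaton.move m ⟨v, h⟩ 1)
        else []].getD i [] := by
  simp only [words, List.append_assoc]
  rw [getD_six_add, getD_finRange_map_add, getD_finRange_map_add, getD_finRange_map_add,
    getD_finRange_flatMap_add _ _ (by simp), getD_finRange_map_add]
  have hlen : ∀ m : x.Mst, ((List.finRange x.numVertices).flatMap fun v =>
    [natWord (x.automaton.update m v 0).1, natWord (x.automaton.update m v 1).1,
        if h : x.game.owner v = x.game.protagonist then natWord (x.automaton.move m ⟨v, h⟩ 0) else [],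
        if h : x.game.owner v = x.game.protagonist then natWord (x.automaton.move m ⟨v, h⟩ 1)
        else []]).length = x.numVertices * 4 := by
    intro m; simp
  have hlt : (v : ℕ) * 4 + i < x.numVertices * 4 := by have := v.2; omega
  have h₁ := getD_finRange_flatMap (d := []) _ _ hlen [] m _ hlt
  have h₂ := getD_finRange_flatMap (d := ([] : List Bool)) (fun v : x.Vtx =>
    [natWord (x.automaton.update m v 0).1, natWord (x.automaton.update m v 1).1,
        if h : x.game.owner v = x.game.protagonist then natWord (x.automaton.move m ⟨v, h⟩ 0) else [],
        if h : x.game.owner v = x.game.protagonist then natWord (x.automaton.move m ⟨v, h⟩ 1)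
        else []]) 4 (by simp) [] v i hi
  rw [List.append_nil] at h₁ h₂
  rw [h₁, h₂]

theorem length_words_pos : 6 ≤ x.words.length := by
  simp [words]

theorem word_length_lt {i : ℕ} (hi : i < 6) : (x.words.getD i []).length < x.encode.length :=
  length_getD_lt _ _ (hi.trans_le x.length_words_pos)

theorem numVertices_lt : x.numVertices < x.encode.length := by
  have := x.word_length_lt (i := 0) (by norm_num)
  rwa [word_numVertices, length_natWord] at this

theorem numStates_lt : x.numStates < x.encode.length := by
  have := x.word_length_lt (i := 2) (by norm_num)
  rwa [word_numStates, length_natWord] at this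

theorem numPlayers_lt : x.numPlayers < x.encode.length := by
  have := length_getD_lt x.words 1 (by have := x.length_words_pos; omega)
  have h : x.words.getD 1 [] = natWord x.numPlayers := by simp [words]
  rwa [h, length_natWord] at this

theorem six_le_length : 6 ≤ x.encode.length := by
  refine x.length_words_pos.trans ?_
  rw [encode]
  induction x.words with
  | nil => simp
  | cons w ws ih => simp at ih ⊢; omega

theorem bitAt_pay_zero (v : x.Vtx) :
    bitAt x.encode (6 + (x.numVertices + (x.numVertices + v))) 0 = decide (x.pay v < 0) := by
  rw [bitAt_encode, word_pay, pay]
  split_ifs <;> simp [intWord]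

theorem bitAt_pay_succ (v : x.Vtx) (j : ℕ) :
    bitAt x.encode (6 + (x.numVertices + (x.numVertices + v))) (1 + j) =
      (x.pay v).natAbs.testBit j := by
  rw [bitAt_encode, word_pay, pay, add_comm 1 j]
  split_ifs
  · rw [intWord, List.getD_cons_succ, encodeNat_getD]
  · simp

end Input

/-! ### Formulas for the graph of counterexamples -/

namespace Fm

/-- Disjunction. -/
def or (φ ψ : Fm) : Fm := neg (and (neg φ) (neg ψ))

/-- Equivalence. -/
def iff (φ ψ : Fm) : Fm := or (and φ ψ) (and (neg φ) (neg ψ))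

/-- Universal quantification. -/
def all (x : Var) (φ : Fm) : Fm := neg (ex x (neg φ))

/-- Equality of terms. -/
def eq (a b : Tm) : Fm := and (neg (lt a b)) (neg (lt b a))

variable {l : List Letter} {ρ : Var → ℕ}

theorem eval_bit {a b : Tm} : (bit a b).eval l ρ = bitAt l (a.val ρ) (b.val ρ) := rfl

theorem eval_lt {a b : Tm} : (lt a b).eval l ρ = true ↔ a.val ρ < b.val ρ := by
  simp [eval]

theorem eval_neg {φ : Fm} : (neg φ).eval l ρ = true ↔ ¬ φ.eval l ρ = true := by
  simp [eval]

theorem eval_and {φ ψ : Fm} :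
    (and φ ψ).eval l ρ = true ↔ φ.eval l ρ = true ∧ ψ.eval l ρ = true := by
  simp [eval]

theorem eval_or {φ ψ : Fm} :
    (or φ ψ).eval l ρ = true ↔ φ.eval l ρ = true ∨ ψ.eval l ρ = true := by
  rw [or, eval_neg, eval_and, eval_neg, eval_neg]
  tauto

theorem eval_iff {φ ψ : Fm} :
    (iff φ ψ).eval l ρ = true ↔ (φ.eval l ρ = true ↔ ψ.eval l ρ = true) := by
  rw [iff, eval_or, eval_and, eval_and, eval_neg, eval_neg]
  tauto

theorem eval_ex {x : Var} {φ : Fm} :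
    (ex x φ).eval l ρ = true ↔ ∃ i < l.length, φ.eval l (update ρ x i) = true := by
  simp [eval]

theorem eval_all {x : Var} {φ : Fm} :
    (all x φ).eval l ρ = true ↔ ∀ i < l.length, φ.eval l (update ρ x i) = true := by
  rw [all, eval_neg, eval_ex]
  simp only [eval_neg]
  push Not
  rfl

theorem eval_eq {a b : Tm} : (eq a b).eval l ρ = true ↔ a.val ρ = b.val ρ := by
  rw [eq, eval_and, eval_neg, eval_neg, eval_lt, eval_lt]
  omega

/-- The word with address `t` is the number in register `r`, in unary. -/
def wordIs (t : Tm) (r : Var) : Fm := all 12 (iff (bit t (.var 12)) (lt (.var 12) (.var r)))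

theorem eval_wordIs {t : Tm} {r : Var} {k : ℕ} (ht : ∀ j, t.val (update ρ 12 j) = t.val ρ)
    (hr : r ≠ 12) (hk : k ≤ l.length) (hρ : ρ r ≤ l.length)
    (hw : ∀ j, bitAt l (t.val ρ) j = decide (j < k)) :
    (wordIs t r).eval l ρ = true ↔ ρ r = k := by
  simp only [wordIs, eval_all, eval_iff, eval_lt, eval_bit, ht, Tm.val, hw, Function.update_self,
    Function.update_of_ne hr, decide_eq_true_eq]
  constructor
  · intro h
    rcases lt_trichotomy (ρ r) k with h' | h' | h'
    · have := h (ρ r) (by omega)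
      omega
    · exact h'
    · have := h k (by omega)
      omega
  · rintro h j -
    rw [h]

end Fm

open Fm

/-- The address of the owner of the vertex in register `v`, as a position in the list of words of
the input. In this and the following addresses, registers `10` and `11` hold the numbers of vertices
and of memory states. -/
def ownerAddr (v : Var) : Tm := .add (.const 6) (.var v)

/-- The address of the bit telling whether the vertex in register `v` is a leaf. -/
def leafAddr (v : Var) : Tm := .add (.const 6) (.add (.var 10) (.var v))

/-- The address of the payoff at the vertex in register `v`. -/
def payAddr (v : Var) : Tm := .add (.const 6) (.add (.var 10) (.add (.var 10) (.var v)))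

/-- The address of the bit telling whether there is an edge from `v` to `w`. -/
def edgeAddr (v w : Var) : Tm :=
  .add (.const 6) (.add (.var 10) (.add (.var 10) (.add (.var 10) (.add (.mul v 10) (.var w)))))

/-- The address of the bit telling whether the state in register `a` has access to the counter. -/
def counterAddr (a : Var) : Tm :=
  .add (.const 6) (.add (.var 10) (.add (.var 10) (.add (.var 10) (.add (.mul 10 10) (.var a)))))

/-- The address of the `i`-th entry of the table of the automaton, in state `a` at vertex `v`:
updates at counter values `0` and `1` for `i = 0, 1`, moves at these values for `i = 2, 3`. -/
def tableAddr (a v : Var) (i : ℕ) : Tm :=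
  .add (.const 6) (.add (.var 10) (.add (.var 10) (.add (.var 10) (.add (.mul 10 10) (.add (.var 11)
    (.add (.add (.add (.mul a 10) (.mul a 10)) (.add (.mul a 10) (.mul a 10)))
      (.add (.add (.add (.var v) (.var v)) (.add (.var v) (.var v))) (.const i))))))))

/-- The vertex in register `v` belongs to the protagonist. -/
def isProt (v : Var) : Fm := .all 12 (.iff (.bit (.const 3) (.var 12)) (.bit (ownerAddr v) (.var 12)))

/-- The vertex in register `v` is a leaf. -/
def isLeaf (v : Var) : Fm := .bit (leafAddr v) (.const 0)

/-- The memory state in register `a` has access to the counter. -/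
def isCounter (a : Var) : Fm := .bit (counterAddr a) (.const 0)

/-- The relation `ParamAutomaton.Edge c` from the configuration in `a` and `v` to that in `a'` and
`v'`. -/
def edgeFm (c : ℕ) (a v a' v' : Var) : Fm :=
  .and (.lt (.var v') (.var 10)) <| .and (.bit (edgeAddr v v') (.const 0)) <|
  .and (wordIs (tableAddr a v c) a') (.or (.neg (isProt v)) (wordIs (tableAddr a v (c + 2)) v'))

/-- The bit number `t` of the absolute value of the payoff at the vertex in register `v`. -/
def payBit (v : Var) (t : Tm) : Fm := .bit (payAddr v) (.add (.const 1) t)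

/-- The payoff at the vertex in register `v` is negative. The payoff at a vertex that is not a leaf
is an empty word, which is read as `0`. -/
def payNeg (v : Var) : Fm := .bit (payAddr v) (.const 0)

/-- The payoff at the vertex in register `v` is positive. -/
def payPos (v : Var) : Fm := .and (.neg (payNeg v)) (.ex 12 (payBit v (.var 12)))

/-- The payoff at the vertex in register `v` has a smaller absolute value than that in register `w`.
-/
def absLt (v w : Var) : Fm :=
  .ex 13 <| .and (.neg (payBit v (.var 13))) <| .and (payBit w (.var 13)) <|
  .all 12 <| .or (.neg (.lt (.var 13) (.var 12))) (.iff (payBit v (.var 12)) (payBit w (.var 12)))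

/-- The payoff at the vertex in register `v` is smaller than that in register `w`. -/
def payLt (v w : Var) : Fm :=
  .or (.and (payNeg v) (.neg (payNeg w)))
    (.or (.and (.neg (payNeg v)) (.and (.neg (payNeg w)) (absLt v w)))
      (.and (payNeg v) (.and (payNeg w) (absLt w v))))

/-- The formula `φ` with the sizes of the game and the automaton in registers `10` and `11`. -/
def withSizes (φ : Fm) : Fm :=
  .ex 10 <| .ex 11 <| .and (wordIs (.const 0) 10) <| .and (wordIs (.const 2) 11) φ

/-- The most significant bit at which two numbers differ decides their order. -/
theorem lt_iff_testBit {a b : ℕ} : a < b ↔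
    ∃ i, a.testBit i = false ∧ b.testBit i = true ∧ ∀ j, i < j → a.testBit j = b.testBit j := by
  constructor
  · intro h
    obtain ⟨i, hi, hj⟩ := Nat.exists_most_significant_bit (n := a ^^^ b) (by
      intro h0
      rw [Nat.xor_eq_zero_iff] at h0
      omega)
    have heq : ∀ j, i < j → a.testBit j = b.testBit j := by
      intro j hij
      have := hj j hij
      rw [Nat.testBit_xor] at this
      simpa using this
    rw [Nat.testBit_xor] at hi
    cases ha : a.testBit i with
    | false => exact ⟨i, ha, by simpa [ha] using hi, heq⟩
    | true =>
      have hb : b.testBit i = false := by simpa [ha] using hi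
      have := Nat.lt_of_testBit i hb ha fun j hij => (heq j hij).symm
      omega
  · rintro ⟨i, ha, hb, h⟩
    exact Nat.lt_of_testBit i ha hb h

section

variable {x : Input} {ρ : Var → ℕ}

/-- The registers `10` and `11` hold the numbers of vertices and of memory states. -/
def Sized (x : Input) (ρ : Var → ℕ) : Prop := ρ 10 = x.numVertices ∧ ρ 11 = x.numStates

theorem eval_withSizes {φ : Fm} : (withSizes φ).eval x.encode ρ = true ↔
    φ.eval x.encode (update (update ρ 10 x.numVertices) 11 x.numStates) = true := by
  have hn := x.numVertices_lt
  have hm := x.numStates_lt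
  have h₁ : ∀ i < x.encode.length, ∀ j < x.encode.length,
      ((wordIs (.const 0) 10).eval x.encode (update (update ρ 10 i) 11 j) = true ↔
        i = x.numVertices) := by
    intro i hi j hj
    rw [eval_wordIs (k := x.numVertices) (fun _ => rfl) (by decide) hn.le]
    · simp
    · simpa using hi.le
    · intro j; simp only [Tm.val]; rw [x.bitAt_encode, x.word_numVertices, natWord_getD]
  have h₂ : ∀ i < x.encode.length, ∀ j < x.encode.length,
      ((wordIs (.const 2) 11).eval x.encode (update (update ρ 10 i) 11 j) = true ↔
        j = x.numStates) := by
    intro i hi j hj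
    rw [eval_wordIs (k := x.numStates) (fun _ => rfl) (by decide) hm.le]
    · simp
    · simpa using hj.le
    · intro j; simp only [Tm.val]; rw [x.bitAt_encode, x.word_numStates, natWord_getD]
  simp only [withSizes, eval_ex, eval_and]
  constructor
  · rintro ⟨i, hi, j, hj, h, h', h''⟩
    rwa [(h₁ i hi j hj).1 h, (h₂ i hi j hj).1 h'] at h''
  · exact fun h => ⟨_, hn, _, hm, (h₁ _ hn _ hm).2 rfl, (h₂ _ hn _ hm).2 rfl, h⟩

theorem eval_isProt {v : Var} (hv : v ≠ 12) {v₀ : x.Vtx} (h : ρ v = v₀) :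
    (isProt v).eval x.encode ρ = true ↔ x.game.owner v₀ = x.game.protagonist := by
  have hp := x.numPlayers_lt
  simp only [isProt, eval_all, eval_iff, eval_bit, ownerAddr, Tm.val, Function.update_self,
    Function.update_of_ne hv, h, x.bitAt_encode, x.word_protagonist, x.word_owner, natWord_getD,
    decide_eq_true_eq]
  constructor
  · intro H
    apply Fin.ext
    rcases lt_trichotomy (x.game.owner v₀ : ℕ) x.game.protagonist with h' | h' | h'
    · have := H (x.game.owner v₀) (by omega)
      omega
    · exact h'
    · have := H x.game.protagonist (by omega)
      omega
  · rintro H j -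
    rw [H]

theorem eval_isLeaf (hs : Sized x ρ) {v : Var} {v₀ : x.Vtx} (h : ρ v = v₀) :
    (isLeaf v).eval x.encode ρ = true ↔ v₀ ∈ x.game.leaves := by
  simp only [isLeaf, eval_bit, leafAddr, Tm.val, h, hs.1, x.bitAt_encode, x.word_leaf]
  simp

theorem eval_isCounter (hs : Sized x ρ) {a : Var} {a₀ : x.Mst} (h : ρ a = a₀) :
    (isCounter a).eval x.encode ρ = true ↔ a₀ ∈ x.automaton.counterAccess := by
  simp only [isCounter, eval_bit, counterAddr, Tm.val, h, hs.1, x.bitAt_encode,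
    x.word_counterAccess]
  simp

theorem val_tableAddr (hs : Sized x ρ) {a v : Var} {a₀ : x.Mst} {v₀ : x.Vtx} (ha : ρ a = a₀)
    (hv : ρ v = v₀) (i : ℕ) : (tableAddr a v i).val ρ =
      6 + (x.numVertices + (x.numVertices + (x.numVertices +
      (x.numVertices * x.numVertices + (x.numStates +
        (a₀ * (x.numVertices * 4) + (v₀ * 4 + i))))))) := by
  simp only [tableAddr, Tm.val, hs.1, hs.2, ha, hv]
  ring

theorem eval_edgeFm (hs : Sized x ρ) (hle : ∀ y, ρ y ≤ x.encode.length) {c : ℕ} (hc : c < 2)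
    {a v a' v' : Var} (ha : a ≠ 12) (hv : v ≠ 12) (ha' : a' ≠ 12) (hv' : v' ≠ 12)
    {z : x.Mst × x.Vtx} (h₁ : ρ a = z.1) (h₂ : ρ v = z.2) :
    (edgeFm c a v a' v').eval x.encode ρ = true ↔
      ∃ y : x.Mst × x.Vtx, ρ a' = y.1 ∧ ρ v' = y.2 ∧ x.automaton.Edge c z y := by
  have hn := x.numVertices_lt
  have hm := x.numStates_lt
  have hupd : (wordIs (tableAddr a v c) a').eval x.encode ρ = true ↔
      ρ a' = (x.automaton.update z.1 z.2 c).1 := by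
    refine eval_wordIs ?_ ha' ?_ (hle _) ?_
    · intro j; simp [tableAddr, Tm.val, ha, hv]
    · have := (x.automaton.update z.1 z.2 c).1.2; omega
    · intro j
      rw [val_tableAddr hs h₁ h₂, x.bitAt_encode, x.word_table _ _ _ (by omega), ← natWord_getD]
      interval_cases c <;> rfl
  have hmov : ∀ h : x.game.owner z.2 = x.game.protagonist,
      ((wordIs (tableAddr a v (c + 2)) v').eval x.encode ρ = true ↔
      ρ v' = x.automaton.move z.1 ⟨z.2, h⟩ c) := by
    intro h
    refine eval_wordIs ?_ hv' ?_ (hle _) ?_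
    · intro j; simp [tableAddr, Tm.val, ha, hv]
    · have := (x.automaton.move z.1 ⟨z.2, h⟩ c).2; omega
    · intro j
      rw [val_tableAddr hs h₁ h₂, x.bitAt_encode, x.word_table _ _ _ (by omega), ← natWord_getD]
      interval_cases c <;> simp [h]
  have hedge : ∀ w : x.Vtx, ρ v' = w →
      (bitAt x.encode ((edgeAddr v v').val ρ) 0 = true ↔ x.game.edge z.2 w) := by
    intro w hw
    simp only [edgeAddr, Tm.val, h₂, hw, hs.1, x.bitAt_encode, x.word_edge]
    simp
  simp only [edgeFm, eval_and, eval_or, eval_neg, eval_lt, eval_bit, Tm.val, hupd,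
    eval_isProt hv h₂, hs.1]
  constructor
  · rintro ⟨h, he, hu, hmo⟩
    refine ⟨((x.automaton.update z.1 z.2 c).1, ⟨ρ v', h⟩), hu, rfl, (hedge _ rfl).1 he, rfl, ?_⟩
    intro hp
    exact Fin.ext ((hmov hp).1 (hmo.resolve_left (not_not.2 hp)))
  · rintro ⟨y, hy₁, hy₂, he, hu, hmo⟩
    refine ⟨by rw [hy₂]; exact y.2.2, (hedge _ hy₂).2 he, by rw [hy₁, hu], ?_⟩
    by_cases hp : x.game.owner z.2 = x.game.protagonist
    · exact .inr ((hmov hp).2 (by rw [hy₂, hmo hp]))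
    · exact .inl hp

theorem eval_payNeg (hs : Sized x ρ) {v : Var} {v₀ : x.Vtx} (h : ρ v = v₀) :
    (payNeg v).eval x.encode ρ = true ↔ x.pay v₀ < 0 := by
  simp [payNeg, eval_bit, payAddr, Tm.val, h, hs.1, x.bitAt_pay_zero]

theorem eval_payBit (hs : Sized x ρ) {v : Var} {v₀ : x.Vtx} (h : ρ v = v₀) (t : Tm) :
    (payBit v t).eval x.encode ρ = (x.pay v₀).natAbs.testBit (t.val ρ) := by
  simp only [payBit, eval_bit, payAddr, Tm.val, h, hs.1, x.bitAt_pay_succ]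

theorem lt_length_of_testBit {v : x.Vtx} {i : ℕ} (h : (x.pay v).natAbs.testBit i = true) :
    i < x.encode.length := by
  rw [← x.bitAt_pay_succ] at h
  have := lt_length_of_bitAt h
  omega

theorem Sized.update (hs : Sized x ρ) {y : Var} (h₁ : y ≠ 10) (h₂ : y ≠ 11) (i : ℕ) :
    Sized x (Function.update ρ y i) := by
  simpa [Sized, h₁.symm, h₂.symm] using hs

theorem eval_payPos (hs : Sized x ρ) {v : Var} (hv : v ≠ 12) {v₀ : x.Vtx} (h : ρ v = v₀) :
    (payPos v).eval x.encode ρ = true ↔ 0 < x.pay v₀ := by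
  have hb : ∀ i, (payBit v (.var 12)).eval x.encode (update ρ 12 i) =
      (x.pay v₀).natAbs.testBit i := by
    intro i
    rw [eval_payBit (hs.update (by decide) (by decide) i) (by simpa [hv] using h)]
    simp [Tm.val]
  simp only [payPos, eval_and, eval_neg, eval_payNeg hs h, eval_ex, hb]
  constructor
  · rintro ⟨h₁, i, -, hi⟩
    refine lt_of_le_of_ne (not_lt.1 h₁) fun h0 => ?_
    simp [← h0] at hi
  · intro h0
    obtain ⟨i, hi⟩ := Nat.exists_testBit_of_ne_zero (by omega : (x.pay v₀).natAbs ≠ 0)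
    exact ⟨by omega, i, lt_length_of_testBit hi, hi⟩

theorem eval_absLt (hs : Sized x ρ) {v w : Var} (hv : v ≠ 12 ∧ v ≠ 13) (hw : w ≠ 12 ∧ w ≠ 13)
    {v₀ w₀ : x.Vtx} (h : ρ v = v₀) (h' : ρ w = w₀) :
    (absLt v w).eval x.encode ρ = true ↔ (x.pay v₀).natAbs < (x.pay w₀).natAbs := by
  have hs' := fun i => hs.update (y := 13) (by decide) (by decide) i
  have hs'' := fun i j => (hs' i).update (y := 12) (by decide) (by decide) j
  have b₁ : ∀ i, (payBit v (.var 13)).eval x.encode (update ρ 13 i) =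
      (x.pay v₀).natAbs.testBit i := by
    intro i
    rw [eval_payBit (hs' i) (by simpa [hv] using h)]
    simp [Tm.val]
  have b₂ : ∀ i, (payBit w (.var 13)).eval x.encode (update ρ 13 i) =
      (x.pay w₀).natAbs.testBit i := by
    intro i
    rw [eval_payBit (hs' i) (by simpa [hw] using h')]
    simp [Tm.val]
  have b₃ : ∀ i j, (payBit v (.var 12)).eval x.encode (update (update ρ 13 i) 12 j) =
      (x.pay v₀).natAbs.testBit j := by
    intro i j
    rw [eval_payBit (hs'' i j) (by simpa [hv] using h)]
    simp [Tm.val]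
  have b₄ : ∀ i j, (payBit w (.var 12)).eval x.encode (update (update ρ 13 i) 12 j) =
      (x.pay w₀).natAbs.testBit j := by
    intro i j
    rw [eval_payBit (hs'' i j) (by simpa [hw] using h')]
    simp [Tm.val]
  have b₅ : ∀ i j, (Tm.var 13).val (update (update ρ 13 i) 12 j) = i := by
    intro i j; simp [Tm.val]
  have b₆ : ∀ i j, (Tm.var 12).val (update (update ρ 13 i) 12 j) = j := by
    intro i j; simp [Tm.val]
  simp only [absLt, eval_ex, eval_and, eval_neg, eval_all, eval_or, eval_lt, eval_iff, b₁, b₂, b₃, b₄,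
    b₅, b₆, lt_iff_testBit (a := (x.pay v₀).natAbs)]
  constructor
  · rintro ⟨i, -, h₁, h₂, h₃⟩
    refine ⟨i, by simpa using h₁, h₂, fun j hij => ?_⟩
    by_cases hj : j < x.encode.length
    · rw [Bool.eq_iff_iff]
      exact (h₃ j hj).resolve_left (not_not.2 hij)
    · -- Both payoffs have fewer bits than the input has letters.
      have e₁ : (x.pay v₀).natAbs.testBit j = false :=
        Bool.eq_false_iff.2 fun h => hj (lt_length_of_testBit h)
      have e₂ : (x.pay w₀).natAbs.testBit j = false :=
        Bool.eq_false_iff.2 fun h => hj (lt_length_of_testBit h)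
      rw [e₁, e₂]
  · rintro ⟨i, h₁, h₂, h₃⟩
    refine ⟨i, lt_length_of_testBit h₂, by simpa using h₁, h₂, fun j _ => ?_⟩
    by_cases hij : i < j
    · exact .inr (by rw [h₃ j hij])
    · exact .inl hij

theorem eval_payLt (hs : Sized x ρ) {v w : Var} (hv : v ≠ 12 ∧ v ≠ 13) (hw : w ≠ 12 ∧ w ≠ 13)
    {v₀ w₀ : x.Vtx} (h : ρ v = v₀) (h' : ρ w = w₀) :
    (payLt v w).eval x.encode ρ = true ↔ x.pay v₀ < x.pay w₀ := by
  simp only [payLt, eval_or, eval_and, eval_neg, eval_payNeg hs h, eval_payNeg hs h',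
    eval_absLt hs hv hw h h', eval_absLt hs hw hv h' h]
  omega

end

open ParamAutomaton

/-! ### The query for counterexamples -/

namespace Fm

/-- Conjunction of a list of formulas. -/
def conj : List Fm → Fm
  | [] => eq (.const 0) (.const 0)
  | φ :: L => and φ (conj L)

/-- Disjunction of a list of formulas. -/
def disj : List Fm → Fm
  | [] => lt (.const 0) (.const 0)
  | φ :: L => or φ (disj L)

/-- The register `r` contains the number `k`. -/
def isConst (r : Var) (k : ℕ) : Fm := eq (.var r) (.const k)

/-- The registers `r` and `s` have the same content. -/
def same (r s : Var) : Fm := eq (.var r) (.var s)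

variable {l : List Letter} {ρ : Var → ℕ}

theorem eval_conj_nil : (conj []).eval l ρ = true ↔ True := by
  simp [conj, eval_eq, Tm.val]

theorem eval_conj_cons {φ : Fm} {L : List Fm} :
    (conj (φ :: L)).eval l ρ = true ↔ φ.eval l ρ = true ∧ (conj L).eval l ρ = true := eval_and

theorem eval_disj_nil : (disj []).eval l ρ = true ↔ False := by
  simp [disj, eval_lt, Tm.val]

theorem eval_disj_cons {φ : Fm} {L : List Fm} :
    (disj (φ :: L)).eval l ρ = true ↔ φ.eval l ρ = true ∨ (disj L).eval l ρ = true := eval_or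

theorem eval_isConst {r : Var} {k : ℕ} : (isConst r k).eval l ρ = true ↔ ρ r = k := eval_eq

theorem eval_same {r s : Var} : (same r s).eval l ρ = true ↔ ρ r = ρ s := eval_eq

end Fm

/-- A node of the graph of counterexamples as a tuple of numbers: its kind, and two configurations
of the automaton without its counter. In a tied node the second one lacks its vertex. -/
def ParamAutomaton.Node.code {m n : ℕ} : Node (Fin m) (Fin n) → List ℕ
  | .before x => [0, x.1, x.2, 0, 0]
  | .tied a b v => [1, a, v, b, 0]
  | .split x y => [2, x.1, x.2, y.1, y.2]
  | .loop p x => [3, p.1, p.2, x.1, x.2]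

/-- The relation `Trace` between the tuple in registers `0` to `4` and the one in registers `5` to
`9`. The first formula makes it reflexive. -/
def traceFm : Fm := disj [
  conj [same 5 0, same 6 1, same 7 2, same 8 3, same 9 4],
  conj [isConst 0 0, isConst 5 0, edgeFm 1 1 2 6 7, isConst 8 0, isConst 9 0],
  conj [isConst 0 0, isConst 5 1, isCounter 1, edgeFm 0 1 2 6 7, edgeFm 1 1 2 8 7, isConst 9 0],
  conj [isConst 0 0, isConst 5 2, isCounter 1, isProt 2, edgeFm 0 1 2 6 7, edgeFm 1 1 2 8 9,
    neg (same 7 9)],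
  conj [isConst 0 1, isConst 5 1, edgeFm 0 1 2 6 7, edgeFm 0 3 2 8 7, isConst 9 0],
  conj [isConst 0 1, isConst 5 2, isProt 2, edgeFm 0 1 2 6 7, edgeFm 0 3 2 8 9, neg (same 7 9)],
  conj [isConst 0 2, isConst 5 2, edgeFm 0 1 2 6 7, same 8 3, same 9 4],
  conj [isConst 0 2, isConst 5 2, same 6 1, same 7 2, edgeFm 0 3 4 8 9],
  conj [isConst 0 2, isConst 5 3, neg (isLeaf 2), payNeg 4, same 6 1, same 7 2, edgeFm 0 1 2 8 9],
  conj [isConst 0 2, isConst 5 3, neg (isLeaf 4), payPos 2, same 6 3, same 7 4, edgeFm 0 3 4 8 9],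
  conj [isConst 0 3, isConst 5 3, same 6 1, same 7 2, edgeFm 0 3 4 8 9]]

/-- The nodes of `Bad`. -/
def badFm : Fm := disj [
  conj [isConst 0 2, isLeaf 2, isLeaf 4, payLt 4 2],
  conj [isConst 0 3, same 1 3, same 2 4]]

/-- The query for a path in the graph of counterexamples from the initial configuration to a bad
node. -/
def chainQuery : Query where
  init := conj [isConst 5 0, wordIs (.const 5) 6, wordIs (.const 4) 7, isConst 8 0, isConst 9 0]
  edge := withSizes traceFm
  acc := withSizes badFm

theorem chainQuery_wellScoped : chainQuery.WellScoped := by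
  constructor <;> decide

section

variable {x : Input} {ρ : Var → ℕ}

theorem Input.pay_of_mem {v : x.Vtx} (h : v ∈ x.game.leaves) :
    x.pay v = x.game.leafPayoff ⟨v, h⟩ := dif_pos h

theorem Input.mem_leaves_of_pay_ne_zero {v : x.Vtx} (h : x.pay v ≠ 0) : v ∈ x.game.leaves := by
  by_contra h'
  exact h (dif_neg h')

theorem eval_traceFm (hs : Sized x ρ) (hle : ∀ y, ρ y ≤ x.encode.length)
    {s : Node x.Mst x.Vtx} (hsrc : [ρ 0, ρ 1, ρ 2, ρ 3, ρ 4] = s.code) :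
    traceFm.eval x.encode ρ = true ↔ [ρ 5, ρ 6, ρ 7, ρ 8, ρ 9] = s.code ∨
      ∃ s', Trace x.automaton s s' ∧ [ρ 5, ρ 6, ρ 7, ρ 8, ρ 9] = s'.code := by
  simp only [traceFm, eval_disj_cons, eval_disj_nil, eval_conj_cons, eval_conj_nil, eval_isConst,
    eval_same, eval_neg, and_true, or_false]
  have e : ∀ {c : ℕ} {a v : Var} (z : x.Mst × x.Vtx), c < 2 → a ≠ 12 → v ≠ 12 → ρ a = z.1 →
      ρ v = z.2 → ∀ {a' v' : Var}, a' ≠ 12 → v' ≠ 12 →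
      ((edgeFm c a v a' v').eval x.encode ρ = true ↔
        ∃ y : x.Mst × x.Vtx, ρ a' = y.1 ∧ ρ v' = y.2 ∧ x.automaton.Edge c z y) :=
    fun z hc ha hv h₁ h₂ _ _ ha' hv' => eval_edgeFm hs hle hc ha hv ha' hv' h₁ h₂
  refine or_congr (by simp only [← hsrc, List.cons.injEq, and_true]) ?_
  cases s with
  | before z =>
    simp only [Node.code, List.cons.injEq, and_true] at hsrc
    obtain ⟨h0, h1, h2, h3, h4⟩ := hsrc
    have e₀ := @e 0 1 2 z (by decide) (by decide) (by decide) h1 h2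
    have e₁ := @e 1 1 2 z (by decide) (by decide) (by decide) h1 h2
    rw [e₀ (by decide) (by decide), e₁ (by decide) (by decide), e₁ (by decide) (by decide),
      e₁ (by decide) (by decide), eval_isCounter hs h1, eval_isProt (by decide) h2, h0]
    simp only [true_and, OfNat.zero_ne_ofNat, zero_ne_one, false_and, or_false]
    constructor
    · rintro (⟨h5, ⟨y, h6, h7, he⟩, h8, h9⟩ |
        ⟨h5, hc, ⟨y, h6, h7, he⟩, ⟨y', h8, h7', he'⟩, h9⟩ |
        ⟨h5, hc, hp, ⟨y, h6, h7, he⟩, ⟨y', h8, h9, he'⟩, hne⟩)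
      · exact ⟨_, .before he, by simp [Node.code, *]⟩
      · have hy : y.2 = y'.2 := Fin.ext (h7.symm.trans h7')
        refine ⟨_, .beforeTied (a := y.1) (b := y'.1) (w := y'.2) hc ?_ he', ?_⟩
        · rwa [← hy]
        · simp [Node.code, h5, h6, h7', h8, h9]
      · refine ⟨_, .beforeSplit hc hp he he' ?_, by simp [Node.code, *]⟩
        intro h
        exact hne (by rw [h7, h9, h])
    · rintro ⟨s', h, hcode⟩
      cases h with
      | before he =>
        simp only [Node.code, List.cons.injEq, and_true] at hcode
        exact .inl ⟨hcode.1, ⟨_, hcode.2.1, hcode.2.2.1, he⟩, hcode.2.2.2⟩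
      | beforeTied hc he he' =>
        simp only [Node.code, List.cons.injEq, and_true] at hcode
        obtain ⟨h5, h6, h7, h8, h9⟩ := hcode
        exact .inr (.inl ⟨h5, hc, ⟨_, h6, h7, he⟩, ⟨_, h8, h7, he'⟩, h9⟩)
      | beforeSplit hc hp he he' hne =>
        simp only [Node.code, List.cons.injEq, and_true] at hcode
        obtain ⟨h5, h6, h7, h8, h9⟩ := hcode
        exact .inr (.inr ⟨h5, hc, hp, ⟨_, h6, h7, he⟩, ⟨_, h8, h9, he'⟩,
          fun h => hne (Fin.ext (by rw [← h7, ← h9, h]))⟩)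
  | tied a b v =>
    simp only [Node.code, List.cons.injEq, and_true] at hsrc
    obtain ⟨h0, h1, h2, h3, h4⟩ := hsrc
    have e₀ := @e 0 1 2 (a, v) (by decide) (by decide) (by decide) h1 h2
    have e₁ := @e 0 3 2 (b, v) (by decide) (by decide) (by decide) h3 h2
    rw [h0]
    simp only [true_and, OfNat.one_ne_ofNat, one_ne_zero, false_and, or_false, false_or]
    rw [e₀ (by decide) (by decide), e₁ (by decide) (by decide),
      e₁ (by decide) (by decide), eval_isProt (by decide) h2]
    constructor
    · rintro (⟨h5, ⟨y, h6, h7, he⟩, ⟨y', h8, h7', he'⟩, h9⟩ |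
        ⟨h5, hp, ⟨y, h6, h7, he⟩, ⟨y', h8, h9, he'⟩, hne⟩)
      · have hy : y.2 = y'.2 := Fin.ext (h7.symm.trans h7')
        refine ⟨_, .tied (a' := y.1) (b' := y'.1) (w := y'.2) ?_ he', ?_⟩
        · rwa [← hy]
        · simp [Node.code, h5, h6, h7', h8, h9]
      · refine ⟨_, .tiedSplit hp he he' ?_, by simp [Node.code, *]⟩
        intro h
        exact hne (by rw [h7, h9, h])
    · rintro ⟨s', h, hcode⟩
      cases h with
      | tied he he' =>
        simp only [Node.code, List.cons.injEq, and_true] at hcode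
        obtain ⟨h5, h6, h7, h8, h9⟩ := hcode
        exact .inl ⟨h5, ⟨_, h6, h7, he⟩, ⟨_, h8, h7, he'⟩, h9⟩
      | tiedSplit hp he he' hne =>
        simp only [Node.code, List.cons.injEq, and_true] at hcode
        obtain ⟨h5, h6, h7, h8, h9⟩ := hcode
        exact .inr ⟨h5, hp, ⟨_, h6, h7, he⟩, ⟨_, h8, h9, he'⟩,
          fun h => hne (Fin.ext (by rw [← h7, ← h9, h]))⟩
  | split y z =>
    simp only [Node.code, List.cons.injEq, and_true] at hsrc
    obtain ⟨h0, h1, h2, h3, h4⟩ := hsrc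
    have e₀ := @e 0 1 2 y (by decide) (by decide) (by decide) h1 h2
    have e₁ := @e 0 3 4 z (by decide) (by decide) (by decide) h3 h4
    rw [h0]
    simp only [true_and, OfNat.ofNat_ne_one, OfNat.ofNat_ne_zero, Nat.reduceEqDiff, false_and,
      or_false, false_or]
    rw [e₀ (by decide) (by decide), e₀ (by decide) (by decide), e₁ (by decide) (by decide),
      eval_isLeaf hs h2, eval_isLeaf hs h4, eval_payNeg hs h4, eval_payPos hs (by decide) h2,
      h1, h2, h3, h4]
    constructor
    · rintro (⟨h5, ⟨y', h6, h7, he⟩, h8, h9⟩ | ⟨h5, h6, h7, z', h8, h9, he⟩ |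
        ⟨h5, hl, hp, h6, h7, y', h8, h9, he⟩ | ⟨h5, hl, hp, h6, h7, z', h8, h9, he⟩)
      · exact ⟨_, .splitLeft he, by simp [Node.code, *]⟩
      · exact ⟨_, .splitRight he, by simp [Node.code, *]⟩
      · have hz := Input.mem_leaves_of_pay_ne_zero hp.ne
        exact ⟨_, .loopLeft hz hl (Input.pay_of_mem hz ▸ hp) he, by simp [Node.code, *]⟩
      · have hy := Input.mem_leaves_of_pay_ne_zero hp.ne'
        exact ⟨_, .loopRight hy hl (Input.pay_of_mem hy ▸ hp) he, by simp [Node.code, *]⟩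
    · rintro ⟨s', h, hcode⟩
      cases h with
      | splitLeft he =>
        simp only [Node.code, List.cons.injEq, and_true] at hcode
        obtain ⟨h5, h6, h7, h8, h9⟩ := hcode
        exact .inl ⟨h5, ⟨_, h6, h7, he⟩, h8, h9⟩
      | splitRight he =>
        simp only [Node.code, List.cons.injEq, and_true] at hcode
        obtain ⟨h5, h6, h7, h8, h9⟩ := hcode
        exact .inr (.inl ⟨h5, h6, h7, _, h8, h9, he⟩)
      | loopLeft hz hl hp he =>
        simp only [Node.code, List.cons.injEq, and_true] at hcode
        obtain ⟨h5, h6, h7, h8, h9⟩ := hcode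
        exact .inr (.inr (.inl ⟨h5, hl, Input.pay_of_mem hz ▸ hp, h6, h7, _, h8, h9, he⟩))
      | loopRight hy hl hp he =>
        simp only [Node.code, List.cons.injEq, and_true] at hcode
        obtain ⟨h5, h6, h7, h8, h9⟩ := hcode
        exact .inr (.inr (.inr ⟨h5, hl, Input.pay_of_mem hy ▸ hp, h6, h7, _, h8, h9, he⟩))
  | loop p y =>
    simp only [Node.code, List.cons.injEq, and_true] at hsrc
    obtain ⟨h0, h1, h2, h3, h4⟩ := hsrc
    rw [h0]
    simp only [true_and, OfNat.ofNat_ne_one, OfNat.ofNat_ne_zero, Nat.reduceEqDiff, false_and,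
      false_or]
    rw [e (c := 0) (a := 3) (v := 4) y (by decide) (by decide) (by decide) h3 h4
      (by decide) (by decide), h1, h2]
    constructor
    · rintro ⟨h5, h6, h7, y', h8, h9, he⟩
      exact ⟨_, .loop he, by simp [Node.code, *]⟩
    · rintro ⟨s', h, hcode⟩
      cases h with
      | loop he =>
        simp only [Node.code, List.cons.injEq, and_true] at hcode
        obtain ⟨h5, h6, h7, h8, h9⟩ := hcode
        exact ⟨h5, h6, h7, _, h8, h9, he⟩

theorem eval_badFm (hs : Sized x ρ) {s : Node x.Mst x.Vtx}
    (hsrc : [ρ 0, ρ 1, ρ 2, ρ 3, ρ 4] = s.code) :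
    badFm.eval x.encode ρ = true ↔ Bad x.automaton s := by
  simp only [badFm, eval_disj_cons, eval_disj_nil, eval_conj_cons, eval_conj_nil, eval_isConst,
    eval_same, and_true, or_false]
  cases s with
  | before z =>
    simp only [Node.code, List.cons.injEq] at hsrc
    simp only [hsrc.1, OfNat.zero_ne_ofNat, false_and, or_false, false_iff]
    rintro ⟨⟩
  | tied a b v =>
    simp only [Node.code, List.cons.injEq] at hsrc
    simp only [hsrc.1, OfNat.one_ne_ofNat, false_and, or_false, false_iff]
    rintro ⟨⟩
  | split y z =>
    simp only [Node.code, List.cons.injEq, and_true] at hsrc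
    obtain ⟨h0, h1, h2, h3, h4⟩ := hsrc
    rw [h0, eval_isLeaf hs h2, eval_isLeaf hs h4, eval_payLt hs (by decide) (by decide) h4 h2]
    simp only [true_and, Nat.reduceEqDiff, false_and, or_false]
    constructor
    · rintro ⟨hy, hz, h⟩
      exact .split hy hz (by rwa [← Input.pay_of_mem, ← Input.pay_of_mem])
    · rintro (⟨hy, hz, h⟩ | _)
      exact ⟨hy, hz, by rwa [Input.pay_of_mem hy, Input.pay_of_mem hz]⟩
  | loop p y =>
    simp only [Node.code, List.cons.injEq, and_true] at hsrc
    obtain ⟨h0, h1, h2, h3, h4⟩ := hsrc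
    rw [h0, h1, h2, h3, h4]
    simp only [true_and, Nat.reduceEqDiff, false_and, false_or]
    constructor
    · rintro ⟨h, h'⟩
      obtain rfl : p = y := Prod.ext (Fin.ext h) (Fin.ext h')
      exact .loop
    · rintro ⟨⟩
      exact ⟨rfl, rfl⟩

/-- The tuples that stand for nodes have entries below the length of the input. -/
theorem code_mem_tuples (s : Node x.Mst x.Vtx) : s.code ∈ tuples x.encode.length 5 := by
  have hn := x.numVertices_lt
  have hm := x.numStates_lt
  have h6 := x.six_le_length
  have h₁ : ∀ a : x.Mst, (a : ℕ) < x.encode.length := fun a => a.2.trans hm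
  have h₂ : ∀ v : x.Vtx, (v : ℕ) < x.encode.length := fun v => v.2.trans hn
  rw [mem_tuples]
  cases s <;> simp [Node.code, h₁, h₂] <;> omega

theorem exists_of_mem_tuples {D : ℕ} {u : List ℕ} (hu : u ∈ tuples D 5) :
    ∃ a b c d e, u = [a, b, c, d, e] := by
  rw [mem_tuples] at hu
  match u, hu.1 with
  | [a, b, c, d, e], _ => exact ⟨a, b, c, d, e, rfl⟩

theorem assign_le {D : ℕ} {xs : List Var} : ∀ {ρ : Var → ℕ} {u : List ℕ}, (∀ y, ρ y ≤ D) →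
    (∀ i ∈ u, i < D) → ∀ y, assign ρ xs u y ≤ D := by
  induction xs with
  | nil => intro ρ u h _ y; cases u <;> exact h y
  | cons z xs ih =>
    intro ρ u h hu y
    cases u with
    | nil => exact h y
    | cons i u =>
      refine ih (fun y => ?_) (fun j hj => hu j (List.mem_cons_of_mem _ hj)) y
      by_cases hy : y = z
      · subst hy
        simpa using (hu i List.mem_cons_self).le
      · simpa [hy] using h y

theorem update_sizes_le (h : ∀ y, ρ y ≤ x.encode.length) (y : Var) :
    update (update ρ 10 x.numVertices) 11 x.numStates y ≤ x.encode.length := by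
  have hn := x.numVertices_lt
  have hm := x.numStates_lt
  have := h y
  simp only [Function.update_apply]
  split_ifs <;> omega

theorem edgeAt_iff {s : Node x.Mst x.Vtx} {u : List ℕ} (hu : u ∈ tuples x.encode.length 5) :
    chainQuery.edgeAt x.encode s.code u = true ↔
      u = s.code ∨ ∃ s', Trace x.automaton s s' ∧ u = s'.code := by
  have hw := code_mem_tuples s
  have hle := update_sizes_le (assign_le (xs := srcVars) (assign_le (xs := tgtVars) (ρ := 0)
    (fun _ => Nat.zero_le _) ((mem_tuples).1 hu).2) ((mem_tuples).1 hw).2)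
  rw [Query.edgeAt, chainQuery, eval_withSizes]
  generalize hc : s.code = w at *
  obtain ⟨a, b, c, d, e, rfl⟩ := exists_of_mem_tuples hu
  obtain ⟨a', b', c', d', e', rfl⟩ := exists_of_mem_tuples hw
  rw [eval_traceFm (s := s) ⟨by simp, by simp⟩ hle (by rw [hc]; rfl), hc]
  rfl

theorem accAt_iff {s : Node x.Mst x.Vtx} :
    chainQuery.accAt x.encode s.code = true ↔ Bad x.automaton s := by
  have hw := code_mem_tuples s
  rw [Query.accAt, chainQuery, eval_withSizes]
  generalize hc : s.code = w at *
  obtain ⟨a', b', c', d', e', rfl⟩ := exists_of_mem_tuples hw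
  exact eval_badFm ⟨by simp, by simp⟩ (by rw [hc]; rfl)

theorem edgeAt_self {u : List ℕ} (hu : u ∈ tuples x.encode.length 5) :
    chainQuery.edgeAt x.encode u u = true := by
  obtain ⟨a, b, c, d, e, rfl⟩ := exists_of_mem_tuples hu
  rw [Query.edgeAt, chainQuery, eval_withSizes, traceFm, eval_disj_cons]
  left
  simp only [eval_conj_cons, eval_conj_nil, eval_same]
  exact ⟨rfl, rfl, rfl, rfl, rfl, trivial⟩

theorem initAt_iff {u : List ℕ} (hu : u ∈ tuples x.encode.length 5) :
    chainQuery.initAt x.encode u = true ↔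
      u = (Node.before (x.automaton.start, x.game.init)).code := by
  have hle := assign_le (xs := tgtVars) (ρ := 0) (fun _ => Nat.zero_le _) ((mem_tuples).1 hu).2
  have hn := x.numVertices_lt
  have hm := x.numStates_lt
  rw [Query.initAt, chainQuery]
  simp only [eval_conj_cons, eval_conj_nil, eval_isConst, and_true]
  rw [eval_wordIs (k := x.automaton.start) (fun _ => rfl) (by decide) (by omega) (hle _),
    eval_wordIs (k := x.game.init) (fun _ => rfl) (by decide) (by omega) (hle _)]
  · obtain ⟨a, b, c, d, e, rfl⟩ := exists_of_mem_tuples hu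
    simp only [Node.code, List.cons.injEq, and_true]
    rfl
  · intro j; simp only [Tm.val]; rw [x.bitAt_encode, x.word_init, natWord_getD]
  · intro j; simp only [Tm.val]; rw [x.bitAt_encode, x.word_start, natWord_getD]

/-- The reachable nodes of the query are the codes of the reachable nodes in the graph of
counterexamples: although tuples that are no codes occur as nodes, no edge leads from a code to one.
-/
theorem result_iff_not_realizesChain :
    chainQuery.result x.encode = true ↔ ¬ x.automaton.RealizesChain := by
  rw [Query.result_iff fun u hu => edgeAt_self hu, not_realizesChain_iff]
  constructor
  · rintro ⟨u, hu, hi, w, hr, ha⟩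
    rw [initAt_iff hu] at hi
    subst hi
    have : ∃ t : Node x.Mst x.Vtx, w = t.code ∧
        ReflTransGen (Trace x.automaton) (.before (x.automaton.start, x.game.init)) t := by
      clear ha
      induction hr with
      | refl => exact ⟨_, rfl, .refl⟩
      | tail _ he ih =>
        obtain ⟨t, rfl, ht⟩ := ih
        obtain hs | ⟨s', hs, rfl⟩ := (edgeAt_iff he.1).1 he.2
        · exact ⟨t, hs, ht⟩
        · exact ⟨s', rfl, ht.tail hs⟩
    obtain ⟨t, rfl, ht⟩ := this
    exact ⟨t, ht, accAt_iff.1 ha⟩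
  · rintro ⟨t, ht, hb⟩
    refine ⟨_, code_mem_tuples _, (initAt_iff (code_mem_tuples _)).2 rfl, t.code,
      ht.lift _ fun s s' h => ⟨code_mem_tuples s', ?_⟩, accAt_iff.2 hb⟩
    exact (edgeAt_iff (code_mem_tuples s')).2 (.inr ⟨s', h, rfl⟩)

end

end SafetyReach

theorem theorem4p20 :
    ∃ f : SafetyReach.Input → Bool,
      (∀ x : SafetyReach.Input, f x = true ↔ x.automaton.RealizesChain) ∧
      Nonempty (Turing.TM2ComputableInPolyTime
        SafetyReach.Input.encode Computability.encodeBool f) := by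
  refine ⟨fun x => !SafetyReach.chainQuery.result x.encode, fun x => ?_,
    SafetyReach.polyTime_query _ _ SafetyReach.chainQuery_wellScoped (by decide)⟩
  rw [← not_iff_not, ← SafetyReach.result_iff_not_realizesChain]
  simp
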